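/- Let $\mathcal N=\{1,\dots,n\}$ be a finite ground set, let $f\colon 2^{\mathcal N}\to\mathbb R_{\ge 0}$ be a non-negative submodular function, and let $F(x)=\sum_{S\subseteq\mathcal N} f(S)\prod_{u\in S}x_u\prod_{u\notin S}(1-x_u)$ be its multilinear extension on $[0,1]^{\mathcal N}$. Let $P\subseteq[0,1]^{\mathcal N}$ be a convex set that is down-closed (if $y\in P$ and $0\le x\le y$ coordinate-wise, then $x\in P$) and solvable. Algorithms access $f$ through a value oracle, which returns $f(S)$ for a given set $S$, and access $P$ through a linear optimization oracle, which for a weight vector $w\in\mathbb R^{\mathcal N}$ returns a point of $P$ maximizing $\langle w,x\rangle$ over $x\in P$. They may toss coins with computed biases. Running time is the number of steps of a real-number random access machine: arithmetic operations and comparisons on real numbers and coin tosses cost one step, and an oracle query costs $n+1$ steps. For real numbers $\alpha\in[0,1]$ and $\beta\ge0$, a randomized algorithm is an $(\alpha,\beta)$-bicriteria algorithm for maximizing $F$ over $P$ if, for every such input $(f,P)$, every vector $r$ that it may output satisfies $r\in[0,1]^{\mathcal N}$ and $y_1\le r\le\beta y_2$ for some $y_1,y_2\in P$, and $\mathbb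 E[F(r)]\ge\alpha\cdot F(z)$ for every $z\in P$. **Theorem.** For every constant $\varepsilon\in(0,1/2)$ there is a randomized $\bigl(\tfrac12-\varepsilon,\;2(\varepsilon^{-1}+2)\bigr)$-bicriteria algorithm for maximizing the multilinear extension of a non-negative submodular function over a down-closed solvable convex set, whose running time on every input is bounded by a polynomial in $n$ (which may depend on $\varepsilon$). Every vector $r$ that it may output satisfies $\frac{r}{2(\varepsilon^{-1}+2)}\in P$. In particular, since $2(\varepsilon^{-1}+2)\le 4\varepsilon^{-1}$, the infeasibility ratio is $O(\varepsilon^{-1})$. -/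

import Mathlib

open scoped ENNReal

noncomputable section

/-! ### Submodular maximization over a down-closed convex set

The ground set is `Fin n`; a set function is `f : Finset (Fin n) → ℝ`. -/

/-- Submodularity of a set function. -/
def IsSubmodular {n : ℕ} (f : Finset (Fin n) → ℝ) : Prop :=
  ∀ S T : Finset (Fin n), f (S ∪ T) + f (S ∩ T) ≤ f S + f T

/-- The multilinear extension `F x = E[f (R x)]`, where the random set `R x` contains every
element `u` with probability `x u`, independently. -/
def multilinearExt {n : ℕ} (f : Finset (Fin n) → ℝ) (x : Fin n → ℝ) : ℝ :=
  ∑ S : Finset (Fin n), f S * (∏ u ∈ S, x u) * ∏ u ∈ Sᶜ, (1 - x u)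

/-- Down-closedness within the non-negative orthant. -/
def IsDownClosed {n : ℕ} (P : Set (Fin n → ℝ)) : Prop :=
  ∀ y ∈ P, ∀ x : Fin n → ℝ, 0 ≤ x → x ≤ y → x ∈ P

/-- `lin` solves linear optimization over `P`: for every weight vector `w` the vector `lin w` is a
point of `P` that maximizes `⟨w, x⟩` among all `x ∈ P`. -/
def IsLinearOptimizer {n : ℕ} (P : Set (Fin n → ℝ)) (lin : (Fin n → ℝ) → (Fin n → ℝ)) : Prop :=
  ∀ w : Fin n → ℝ, lin w ∈ P ∧ ∀ x ∈ P, ∑ u, w u * x u ≤ ∑ u, w u * lin w u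

/-- An instance of the problem: a non-negative submodular function `f` (given by a value oracle)
and a down-closed convex set `P ⊆ [0,1]^n` (given by a linear optimization oracle `lin`). -/
structure IsInstance {n : ℕ} (f : Finset (Fin n) → ℝ) (P : Set (Fin n → ℝ))
    (lin : (Fin n → ℝ) → (Fin n → ℝ)) : Prop where
  nonneg : ∀ S, 0 ≤ f S
  submodular : IsSubmodular f
  subset_cube : P ⊆ Set.Icc 0 1
  convex : Convex ℝ P
  downClosed : IsDownClosed P
  solvable : IsLinearOptimizer P lin

/-- The vectors that an algorithm of infeasibility ratio `β` may output: the points `x` of the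
cube `[0,1]^n` with `y₁ ≤ x ≤ β y₂` for some `y₁, y₂ ∈ P`. -/
def bicriteriaFeasible {n : ℕ} (P : Set (Fin n → ℝ)) (β : ℝ) : Set (Fin n → ℝ) :=
  {x | x ∈ Set.Icc 0 1 ∧ ∃ y₁ ∈ P, ∃ y₂ ∈ P, y₁ ≤ x ∧ x ≤ β • y₂}

/-! ### The machine model

A randomized random access machine over the reals with two oracles.  The memory consists of
natural-number registers (counters and addresses) and a two-dimensional array of real cells,
whose rows serve as vectors.  A program is a finite piece of syntax, and all its constants are
natural or rational numbers.  All loops are bounded, so every run halts.  -/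

/-- A memory configuration together with a clock. Programs cannot read the clock. -/
structure Config where
  reg : ℕ → ℕ
  cell : ℕ → ℕ → ℝ
  time : ℕ

/-- Natural-number expressions: addition and truncated subtraction only. -/
inductive NExp where
  | const (k : ℕ)
  | reg (i : ℕ)
  | add (a b : NExp)
  | sub (a b : NExp)

/-- The value of a natural-number expression. -/
def NExp.eval (s : Config) : NExp → ℕ
  | .const k => k
  | .reg i => s.reg i
  | .add a b => a.eval s + b.eval s
  | .sub a b => a.eval s - b.eval s

/-- The number of steps needed to evaluate a natural-number expression. -/
def NExp.cost : NExp → ℕ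
  | .const _ => 1
  | .reg _ => 1
  | .add a b => a.cost + b.cost + 1
  | .sub a b => a.cost + b.cost + 1

/-- Real expressions: rational constants, memory cells, natural numbers and field operations
(division by zero returns zero). -/
inductive RExp where
  | const (q : ℚ)
  | cell (row col : NExp)
  | ofNat (a : NExp)
  | add (a b : RExp)
  | sub (a b : RExp)
  | mul (a b : RExp)
  | div (a b : RExp)

/-- The value of a real expression. -/
def RExp.eval (s : Config) : RExp → ℝ
  | .const q => (q : ℝ)
  | .cell row col => s.cell (row.eval s) (col.eval s)
  | .ofNat a => (a.eval s : ℝ)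
  | .add a b => a.eval s + b.eval s
  | .sub a b => a.eval s - b.eval s
  | .mul a b => a.eval s * b.eval s
  | .div a b => a.eval s / b.eval s

/-- The number of steps needed to evaluate a real expression. -/
def RExp.cost : RExp → ℕ
  | .const _ => 1
  | .cell row col => row.cost + col.cost + 1
  | .ofNat a => a.cost + 1
  | .add a b => a.cost + b.cost + 1
  | .sub a b => a.cost + b.cost + 1
  | .mul a b => a.cost + b.cost + 1
  | .div a b => a.cost + b.cost + 1

/-- Programs.
* `setN i e`: register `i` becomes `e`.
* `setR row col e`: the cell at `(row, col)` becomes `e`.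
* `flip i p`: register `i` becomes `1` with probability `p` (clipped to `[0,1]`), and else `0`.
* `value row col src`: one query to the value oracle; the cell at `(row, col)` becomes `f S`, where
  `S` is the set of elements `u` whose cell `(src, u)` is non-zero.
* `optimize dst src`: one query to the linear optimization oracle, with the first `n` cells of row
  `src` as weights; the answer is stored in the first `n` cells of row `dst`.
* `ifN a b c d`, `ifR a b c d`: if `a ≤ b` then `c` else `d`.
* `loop e c`: `c` is repeated as many times as the value of `e` at the beginning says. -/
inductive Cmd where
  | skip
  | setN (i : ℕ) (e : NExp)
  | setR (row col : NExp) (e : RExp)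
  | flip (i : ℕ) (p : RExp)
  | value (row col src : NExp)
  | optimize (dst src : NExp)
  | seq (c d : Cmd)
  | ifN (a b : NExp) (c d : Cmd)
  | ifR (a b : RExp) (c d : Cmd)
  | loop (e : NExp) (c : Cmd)

/-- Advance the clock by `k` steps. -/
def Config.tick (k : ℕ) (s : Config) : Config :=
  { s with time := s.time + k }

/-- Write to a register. -/
def Config.setReg (i v : ℕ) (s : Config) : Config :=
  { s with reg := Function.update s.reg i v }

/-- Write to a real cell. -/
def Config.setCell (row col : ℕ) (v : ℝ) (s : Config) : Config :=
  { s with cell := Function.update s.cell row (Function.update (s.cell row) col v) }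

/-- The vector stored in the first `n` cells of a row. -/
def Config.vec (n : ℕ) (row : ℕ) (s : Config) : Fin n → ℝ :=
  fun u => s.cell row u

/-- Store a vector in the first `n` cells of a row. -/
def Config.setVec {n : ℕ} (row : ℕ) (v : Fin n → ℝ) (s : Config) : Config :=
  { s with
    cell := Function.update s.cell row
      (fun j => if h : j < n then v (Fin.mk j h) else s.cell row j) }

/-- A coin that shows `true` with probability `p`, clipped to `[0,1]`. -/
def coin (p : ℝ) : PMF Bool :=
  PMF.ofFintype
    (fun b => ENNReal.ofReal (if b then max 0 (min p 1) else 1 - max 0 (min p 1))) (by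
      have h0 : 0 ≤ max 0 (min p 1) := le_max_left _ _
      have h1 : max 0 (min p 1) ≤ 1 := max_le zero_le_one (min_le_right _ _)
      rw [Fintype.sum_bool, if_pos rfl, if_neg Bool.false_ne_true,
        ← ENNReal.ofReal_add h0 (sub_nonneg.mpr h1)]
      simp)

/-- The law of the configuration after running a program. An elementary operation takes one step
and an oracle query takes `n + 1` steps; evaluating the operands is charged in addition. -/
def Cmd.exec {n : ℕ} (f : Finset (Fin n) → ℝ) (lin : (Fin n → ℝ) → (Fin n → ℝ)) :
    Cmd → Config → PMF Config
  | .skip, s => PMF.pure (s.tick 1)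
  | .setN i e, s => PMF.pure ((s.setReg i (e.eval s)).tick (e.cost + 1))
  | .setR row col e, s =>
      PMF.pure ((s.setCell (row.eval s) (col.eval s) (e.eval s)).tick
        (row.cost + col.cost + e.cost + 1))
  | .flip i p, s =>
      (coin (p.eval s)).map fun b => (s.setReg i (if b then 1 else 0)).tick (p.cost + 1)
  | .value row col src, s =>
      PMF.pure ((s.setCell (row.eval s) (col.eval s)
        (f (Finset.univ.filter fun u => s.vec n (src.eval s) u ≠ 0))).tick
          (row.cost + col.cost + src.cost + (n + 1)))
  | .optimize dst src, s =>
      PMF.pure ((s.setVec (dst.eval s) (lin (s.vec n (src.eval s)))).tick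
        (dst.cost + src.cost + (n + 1)))
  | .seq c d, s => (c.exec f lin s).bind fun t => d.exec f lin t
  | .ifN a b c d, s =>
      if a.eval s ≤ b.eval s then c.exec f lin (s.tick (a.cost + b.cost + 1))
      else d.exec f lin (s.tick (a.cost + b.cost + 1))
  | .ifR a b c d, s =>
      if a.eval s ≤ b.eval s then c.exec f lin (s.tick (a.cost + b.cost + 1))
      else d.exec f lin (s.tick (a.cost + b.cost + 1))
  | .loop e c, s =>
      (fun μ : PMF Config => μ.bind fun t => c.exec f lin (t.tick 1))^[e.eval s]
        (PMF.pure (s.tick (e.cost + 1)))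

/-- Initially register `0` holds the size of the ground set and the rest of the memory is zero. -/
def Config.init (n : ℕ) : Config where
  reg := Function.update 0 0 n
  cell := 0
  time := 0

/-- The law of the final configuration on an input. -/
def Cmd.run {n : ℕ} (A : Cmd) (f : Finset (Fin n) → ℝ) (lin : (Fin n → ℝ) → (Fin n → ℝ)) :
    PMF Config :=
  A.exec f lin (Config.init n)

/-- The law of the output vector, which is read from row `0` of the final configuration. -/
def Cmd.output {n : ℕ} (A : Cmd) (f : Finset (Fin n) → ℝ) (lin : (Fin n → ℝ) → (Fin n → ℝ)) :
    PMF (Fin n → ℝ) :=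
  (A.run f lin).map (Config.vec n 0)

/-- Polynomial running time: every run on a ground set of size `n` takes at most `q n` steps, for
some fixed polynomial `q`. -/
def Cmd.IsPolyTime (A : Cmd) : Prop :=
  ∃ q : Polynomial ℕ, ∀ (n : ℕ) (f : Finset (Fin n) → ℝ) (lin : (Fin n → ℝ) → (Fin n → ℝ)),
    ∀ s ∈ (A.run f lin).support, s.time ≤ q.eval n

/-- `A` is a (randomized) `(α, β)`-bicriteria approximation algorithm for maximizing the
multilinear extension `F` of a non-negative submodular function over a down-closed solvable convex
set `P`: every possible output is feasible up to the infeasibility ratio `β`, and the expectation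
of `F` at the output is at least `α * F z` for every `z ∈ P`.
The expectation is taken in `[0, ∞]`; `F` is non-negative on the cube. -/
def Cmd.IsBicriteriaAlgorithm (A : Cmd) (α β : ℝ) : Prop :=
  ∀ (n : ℕ) (f : Finset (Fin n) → ℝ) (P : Set (Fin n → ℝ)) (lin : (Fin n → ℝ) → (Fin n → ℝ)),
    IsInstance f P lin →
      (∀ r ∈ (A.output f lin).support, r ∈ bicriteriaFeasible P β) ∧
      ∀ z ∈ P, ENNReal.ofReal (α * multilinearExt f z) ≤
        ∑' r, A.output f lin r * ENNReal.ofReal (multilinearExt f r)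

end

/-! Let `q`, `L` and `sc = psum (ind L) q` describe a rescaling of the coordinates: an element whose
largest coordinate `cap` in `P` is at most `1 / (k (n + 1))` gets scale `cap`, every other element
(those of `L`) keeps scale 1. Points of `P` become `sc * x` with `x` in the cube. Since the small
caps sum to at most `1 / k`, at most one small element matters, and the value at `sc * x` agrees up
to a factor `1 - 1 / k` with the multilinear extension `H` of a submodular `surrogate`
(`multilinearExt_surrogate_bounds`). The gain is that the surrogate is at most `2 k (n + 1)^2` times
the largest value of the original extension at a few points of `P` (`surrogate_scaling_le`),
although `f` itself may be arbitrarily larger than the optimum. So partial derivatives of `H` can be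
estimated by polynomially many samples, with an error that is small relative to the optimum
(`hoare_estimate`).

Write `κ = 1 / j`. The growth phase moves `x` from 0 by small steps `x + τ y (1 - x)`, where `y`
comes from the linear oracle and maximizes the damped derivative of `H` at `κ x`. Each step raises
`H (κ x)` by about `κ τ` times `slack`, which never increases along the growth (`slack_antitone`).
As the steps add up to `κ τ N = 2`, at the end `H (κ x)` is at least twice the final slack
(`hoare_growth`). The total step length `2 j` is the infeasibility ratio.

For a target `z` in scaled coordinates, set `o = κ x + z (x - κ x)`, a point between `κ x` and `x`.
Submodularity gives `H o ≥ (1 - κ) H z - slack` (`slack_bound`). A fractional double greedy between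
the lower solution `κ x` and the upper solution `x` ends at a point with `2 H ≥ H o + H (κ x) / 2 +
H x / 2` up to sampling error (`double_greedy_step`, `hoare_doubleGreedy`). The term `H (κ x) / 2`
pays for the slack, so the final value is at least `(1 - κ) / 2 * H z` up to small losses. The
double greedy never leaves the box below `x`, so feasibility survives.

On the machine, each phase is a potential argument: a loop body loses at most `η` of an expected
potential per round (`Hoare.loop_add`). The link with the actual law of the run is `tsum_exec_mul`
for expectations and `Post.of_mem_support` for certain facts; polynomial time is syntactic
(`Bounded.isPolyTime`). -/

open scoped ENNReal

noncomputable section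

/-! ### Expectations and supports of the machine semantics -/

namespace PMF

lemma tsum_pure_mul {α : Type*} (a : α) (φ : α → ℝ≥0∞) : ∑' b, PMF.pure a b * φ b = φ a := by
  rw [tsum_eq_single a]
  · simp
  · intro b hb
    simp [PMF.pure_apply, hb]

lemma tsum_bind_mul {α β : Type*} (p : PMF α) (g : α → PMF β) (φ : β → ℝ≥0∞) :
    ∑' b, p.bind g b * φ b = ∑' a, p a * ∑' b, g a b * φ b := by
  simp only [PMF.bind_apply, ← ENNReal.tsum_mul_right, ← ENNReal.tsum_mul_left]
  rw [ENNReal.tsum_comm]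
  simp only [mul_assoc]

lemma tsum_map_mul {α β : Type*} (p : PMF α) (g : α → β) (φ : β → ℝ≥0∞) :
    ∑' b, p.map g b * φ b = ∑' a, p a * φ (g a) := by
  rw [← PMF.bind_pure_comp, tsum_bind_mul]
  simp only [Function.comp, tsum_pure_mul]

end PMF

/-- A quantity that does not depend on the clock. -/
def TimeFree {α : Type*} (φ : Config → α) : Prop := ∀ s k, φ (s.tick k) = φ s

lemma NExp.eval_tick (e : NExp) (s : Config) (k : ℕ) : e.eval (s.tick k) = e.eval s := by
  induction e <;> simp_all [NExp.eval, Config.tick]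

lemma RExp.eval_tick (e : RExp) (s : Config) (k : ℕ) : e.eval (s.tick k) = e.eval s := by
  induction e <;> simp_all [RExp.eval, NExp.eval_tick]
  simp [Config.tick]

/-- The probability of the outcome `1` of a coin toss. -/
def clip (p : ℝ) : ℝ := max 0 (min p 1)

lemma clip_nonneg (p : ℝ) : 0 ≤ clip p := le_max_left _ _

lemma clip_le_one (p : ℝ) : clip p ≤ 1 := max_le zero_le_one (min_le_right _ _)

lemma clip_of_mem {p : ℝ} (h0 : 0 ≤ p) (h1 : p ≤ 1) : clip p = p := by
  simp [clip, h0, h1]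

namespace Cmd

/-! ### Clock-free backward semantics, with one recursion serving both expectations and certain
facts. -/

section Semantics

variable {α : Type*} {n : ℕ} (mix : ℝ → α → α → α) (f : Finset (Fin n) → ℝ)
  (lin : (Fin n → ℝ) → (Fin n → ℝ))

/-- The backward semantics of a program, ignoring the clock; `mix p a b` combines the outcomes `a`
(probability `p`) and `b` (probability `1 - p`) of a coin toss. -/
def sem : Cmd → (Config → α) → Config → α
  | .skip, φ, s => φ s
  | .setN i e, φ, s => φ (s.setReg i (e.eval s))
  | .setR row col e, φ, s => φ (s.setCell (row.eval s) (col.eval s) (e.eval s))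
  | .flip i p, φ, s => mix (clip (p.eval s)) (φ (s.setReg i 1)) (φ (s.setReg i 0))
  | .value row col src, φ, s => φ (s.setCell (row.eval s) (col.eval s)
        (f (Finset.univ.filter fun u => s.vec n (src.eval s) u ≠ 0)))
  | .optimize dst src, φ, s => φ (s.setVec (dst.eval s) (lin (s.vec n (src.eval s))))
  | .seq c d, φ, s => c.sem (d.sem φ) s
  | .ifN a b c d, φ, s => if a.eval s ≤ b.eval s then c.sem φ s else d.sem φ s
  | .ifR a b c d, φ, s => if a.eval s ≤ b.eval s then c.sem φ s else d.sem φ s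
  | .loop e c, φ, s => (fun ψ => c.sem ψ)^[e.eval s] φ s

variable {mix f lin}

lemma TimeFree.iterate {F : (Config → α) → Config → α} (hF : ∀ φ, TimeFree φ → TimeFree (F φ))
    {φ : Config → α} (h : TimeFree φ) (k : ℕ) : TimeFree (F^[k] φ) := by
  induction k with
  | zero => exact h
  | succ k ih =>
    rw [Function.iterate_succ_apply']
    exact hF _ ih

/-- `exec` ticks the clock at branches and loop rounds before running the body, whereas `sem` does
not; clock independence of every intermediate postcondition makes the two comparable. -/
lemma timeFree_sem (c : Cmd) {φ : Config → α} (h : TimeFree φ) :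
    TimeFree (c.sem mix f lin φ) := by
  induction c generalizing φ with
  | skip => exact h
  | setN i e => intro s k; simp only [sem, NExp.eval_tick]; exact h (s.setReg i (e.eval s)) k
  | setR row col e =>
    intro s k
    simp only [sem, NExp.eval_tick, RExp.eval_tick]
    exact h (s.setCell _ _ _) k
  | flip i p =>
    intro s k
    simp only [sem, RExp.eval_tick]
    rw [← h (s.setReg i 1) k, ← h (s.setReg i 0) k]
    rfl
  | value row col src =>
    intro s k
    simp only [sem, NExp.eval_tick]
    exact h (s.setCell _ _ _) k
  | optimize dst src =>
    intro s k
    simp only [sem, NExp.eval_tick]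
    exact h (s.setVec _ _) k
  | seq c d hc hd => exact hc (hd h)
  | ifN a b c d hc hd =>
    intro s k
    simp only [sem, NExp.eval_tick, hc h s k, hd h s k]
  | ifR a b c d hc hd =>
    intro s k
    simp only [sem, RExp.eval_tick, hc h s k, hd h s k]
  | loop e c hc =>
    intro s k
    simp only [sem, NExp.eval_tick]
    exact TimeFree.iterate (fun φ hφ => hc hφ) h _ s k

end Semantics

/-! ### Expectations, certain postconditions and Hoare triples. -/

section Logic

variable {n : ℕ} (f : Finset (Fin n) → ℝ) (lin : (Fin n → ℝ) → (Fin n → ℝ))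

/-- The expectation of `φ` after running the program. -/
def wp (c : Cmd) (φ : Config → ℝ) (s : Config) : ℝ :=
  c.sem (fun p a b => p * a + (1 - p) * b) f lin φ s

/-- All possible outcomes of the program satisfy `Q`. -/
def Post (c : Cmd) (Q : Config → Prop) (s : Config) : Prop :=
  c.sem (fun _ a b => a ∧ b) f lin Q s

/-- Every outcome satisfies `Q`, and the expectation of `φ` is at least `a`. -/
def Hoare (c : Cmd) (s : Config) (Q : Config → Prop) (φ : Config → ℝ) (a : ℝ) : Prop :=
  c.Post f lin Q s ∧ a ≤ c.wp f lin φ s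

variable {f lin}

lemma wp_nonneg (c : Cmd) {φ : Config → ℝ} (h : ∀ s, 0 ≤ φ s) (s : Config) :
    0 ≤ c.wp f lin φ s := by
  unfold wp
  induction c generalizing φ s with
  | flip i p =>
    have h0 := clip_nonneg (p.eval s)
    have h1 := clip_le_one (p.eval s)
    have := mul_nonneg h0 (h (s.setReg i 1))
    have := mul_nonneg (sub_nonneg.2 h1) (h (s.setReg i 0))
    simp only [sem]; linarith
  | seq c d hc hd => exact hc (hd h) s
  | ifN a b c d hc hd => simp only [sem]; split_ifs; exacts [hc h s, hd h s]
  | ifR a b c d hc hd => simp only [sem]; split_ifs; exacts [hc h s, hd h s]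
  | loop e c hc =>
    simp only [sem]
    suffices ∀ k s, 0 ≤ ((fun ψ => c.sem _ f lin ψ)^[k] φ) s from this _ s
    intro k
    induction k with
    | zero => exact h
    | succ k ih =>
      rw [Function.iterate_succ_apply']
      exact fun s => hc ih s
  | _ => exact h _

/-- Soundness of `wp` for the true law. Nonnegativity is what allows the passage between `ℝ` and
`ℝ≥0∞`; it propagates through sequencing and loops by `wp_nonneg`. -/
theorem tsum_exec_mul (c : Cmd) {φ : Config → ℝ} (h : ∀ s, 0 ≤ φ s) (ht : TimeFree φ)
    (s : Config) :
    ∑' t, c.exec f lin s t * ENNReal.ofReal (φ t) = ENNReal.ofReal (c.wp f lin φ s) := by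
  unfold wp
  induction c generalizing φ s with
  | skip => simp only [exec, PMF.tsum_pure_mul, ht _ _, sem]
  | setN i e => simp only [exec, PMF.tsum_pure_mul, ht _ _, sem]
  | setR row col e => simp only [exec, PMF.tsum_pure_mul, ht _ _, sem]
  | value row col src => simp only [exec, PMF.tsum_pure_mul, ht _ _, sem]
  | optimize dst src => simp only [exec, PMF.tsum_pure_mul, ht _ _, sem]
  | flip i p =>
    have h0 := clip_nonneg (p.eval s)
    have h1 := sub_nonneg.2 (clip_le_one (p.eval s))
    simp only [exec, PMF.tsum_map_mul, ht _ _, sem]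
    rw [tsum_fintype, Fintype.sum_bool]
    have e1 : coin (p.eval s) true = ENNReal.ofReal (clip (p.eval s)) := by
      simp [coin, clip, PMF.ofFintype_apply]
    have e2 : coin (p.eval s) false = ENNReal.ofReal (1 - clip (p.eval s)) := by
      simp [coin, clip, PMF.ofFintype_apply]
    rw [e1, e2, ← ENNReal.ofReal_mul h0, ← ENNReal.ofReal_mul h1,
      ← ENNReal.ofReal_add (mul_nonneg h0 (h _)) (mul_nonneg h1 (h _))]
    simp
  | seq c d hc hd =>
    simp only [exec, PMF.tsum_bind_mul, sem]
    simp only [hd h ht]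
    exact hc (fun s => wp_nonneg d h s) (timeFree_sem d ht) s
  | ifN a b c d hc hd =>
    simp only [exec, sem]
    split_ifs
    · rw [hc h ht, timeFree_sem c ht]
    · rw [hd h ht, timeFree_sem d ht]
  | ifR a b c d hc hd =>
    simp only [exec, sem]
    split_ifs
    · rw [hc h ht, timeFree_sem c ht]
    · rw [hd h ht, timeFree_sem d ht]
  | loop e c hc =>
    simp only [exec, sem]
    set F := fun ψ => c.sem (fun p a b : ℝ => p * a + (1 - p) * b) f lin ψ with hF
    have hpos : ∀ k s, 0 ≤ (F^[k] φ) s := by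
      intro k
      induction k with
      | zero => exact h
      | succ k ih =>
        rw [Function.iterate_succ_apply']
        exact fun s => wp_nonneg c ih s
    have htf : ∀ k, TimeFree (F^[k] φ) :=
      fun k => TimeFree.iterate (fun ψ hψ => timeFree_sem c hψ) ht k
    have key : ∀ (k : ℕ) (μ : PMF Config),
        ∑' t, ((fun μ : PMF Config => μ.bind fun t => c.exec f lin (t.tick 1))^[k] μ) t *
          ENNReal.ofReal (φ t) = ∑' t, μ t * ENNReal.ofReal ((F^[k] φ) t) := by
      intro k
      induction k with
      | zero => intro μ; rfl
      | succ k ih =>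
        intro μ
        rw [Function.iterate_succ_apply, ih, PMF.tsum_bind_mul, Function.iterate_succ_apply']
        simp only [hc (hpos k) (htf k)]
        refine tsum_congr fun t => ?_
        rw [timeFree_sem c (htf k)]
    rw [key, PMF.tsum_pure_mul, htf]

theorem Post.of_mem_support {c : Cmd} {Q : Config → Prop} (ht : TimeFree Q) {s : Config}
    (h : c.Post f lin Q s) {t : Config} (hmem : t ∈ (c.exec f lin s).support) : Q t := by
  unfold Post at h
  induction c generalizing Q s t with
  | skip =>
    simp only [exec, PMF.support_pure, Set.mem_singleton_iff] at hmem
    subst hmem; rw [ht]; exact h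
  | setN i e =>
    simp only [exec, PMF.support_pure, Set.mem_singleton_iff] at hmem
    subst hmem; rw [ht]; exact h
  | setR row col e =>
    simp only [exec, PMF.support_pure, Set.mem_singleton_iff] at hmem
    subst hmem; rw [ht]; exact h
  | value row col src =>
    simp only [exec, PMF.support_pure, Set.mem_singleton_iff] at hmem
    subst hmem; rw [ht]; exact h
  | optimize dst src =>
    simp only [exec, PMF.support_pure, Set.mem_singleton_iff] at hmem
    subst hmem; rw [ht]; exact h
  | flip i p =>
    simp only [exec, PMF.mem_support_map_iff] at hmem
    obtain ⟨b, -, rfl⟩ := hmem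
    rw [ht]
    cases b
    exacts [h.2, h.1]
  | seq c d hc hd =>
    simp only [exec, PMF.mem_support_bind_iff] at hmem
    obtain ⟨r, hr, hmem⟩ := hmem
    exact hd ht (hc (timeFree_sem d ht) h hr) hmem
  | ifN a b c d hc hd =>
    simp only [exec, sem] at hmem h
    split_ifs at hmem h
    · exact hc ht (by rw [timeFree_sem c ht]; exact h) hmem
    · exact hd ht (by rw [timeFree_sem d ht]; exact h) hmem
  | ifR a b c d hc hd =>
    simp only [exec, sem] at hmem h
    split_ifs at hmem h
    · exact hc ht (by rw [timeFree_sem c ht]; exact h) hmem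
    · exact hd ht (by rw [timeFree_sem d ht]; exact h) hmem
  | loop e c hc =>
    simp only [exec, sem] at hmem h
    set F := fun ψ => c.sem (fun (_ : ℝ) (a b : Prop) => a ∧ b) f lin ψ with hF
    have htf : ∀ k, TimeFree (F^[k] Q) :=
      fun k => TimeFree.iterate (fun ψ hψ => timeFree_sem c hψ) ht k
    have key : ∀ (k : ℕ) (μ : PMF Config), (∀ t ∈ μ.support, (F^[k] Q) t) →
        ∀ t ∈ ((fun μ : PMF Config => μ.bind fun t => c.exec f lin (t.tick 1))^[k] μ).support,
          Q t := by
      intro k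
      induction k with
      | zero => intro μ h; exact h
      | succ k ih =>
        intro μ hμ t hmem
        rw [Function.iterate_succ_apply] at hmem
        refine ih _ ?_ t hmem
        intro r hr
        rw [PMF.mem_support_bind_iff] at hr
        obtain ⟨r', hr', hr⟩ := hr
        refine hc (htf k) ?_ hr
        rw [timeFree_sem c (htf k)]
        have := hμ r' hr'
        rwa [Function.iterate_succ_apply'] at this
    refine key _ _ ?_ t hmem
    intro r hr
    rw [PMF.support_pure, Set.mem_singleton_iff] at hr
    subst hr
    rw [htf]
    exact h

lemma Post.mono {c : Cmd} {Q R : Config → Prop} (hQR : ∀ t, Q t → R t) {s : Config}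
    (h : c.Post f lin Q s) : c.Post f lin R s := by
  unfold Post at *
  induction c generalizing Q R s with
  | flip i p => exact ⟨hQR _ h.1, hQR _ h.2⟩
  | seq c d hc hd => exact hc (fun t => hd hQR) h
  | ifN a b c d hc hd =>
    simp only [sem] at *; split_ifs at *; exacts [hc hQR h, hd hQR h]
  | ifR a b c d hc hd =>
    simp only [sem] at *; split_ifs at *; exacts [hc hQR h, hd hQR h]
  | loop e c hc =>
    simp only [sem] at *
    set F := fun ψ => c.sem (fun (_ : ℝ) (a b : Prop) => a ∧ b) f lin ψ with hF
    have : ∀ k t, (F^[k] Q) t → (F^[k] R) t := by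
      intro k
      induction k with
      | zero => exact hQR
      | succ k ih =>
        intro t ht
        rw [Function.iterate_succ_apply'] at *
        exact hc ih ht
    exact this _ _ h
  | _ => exact hQR _ h

/-- The comparison is needed only at outcomes that can occur, so invariants may be used when
potentials are compared. -/
lemma wp_mono {c : Cmd} {Q : Config → Prop} {φ ψ : Config → ℝ} (hle : ∀ t, Q t → φ t ≤ ψ t)
    {s : Config} (h : c.Post f lin Q s) : c.wp f lin φ s ≤ c.wp f lin ψ s := by
  unfold Post at h
  unfold wp
  induction c generalizing Q φ ψ s with
  | flip i p =>
    have h0 := clip_nonneg (p.eval s)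
    have h1 := sub_nonneg.2 (clip_le_one (p.eval s))
    exact add_le_add (mul_le_mul_of_nonneg_left (hle _ h.1) h0)
      (mul_le_mul_of_nonneg_left (hle _ h.2) h1)
  | seq c d hc hd => exact hc (fun t => hd hle) h
  | ifN a b c d hc hd =>
    simp only [sem] at *; split_ifs at *; exacts [hc hle h, hd hle h]
  | ifR a b c d hc hd =>
    simp only [sem] at *; split_ifs at *; exacts [hc hle h, hd hle h]
  | loop e c hc =>
    simp only [sem] at *
    set F := fun ψ => c.sem (fun (_ : ℝ) (a b : Prop) => a ∧ b) f lin ψ with hF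
    set G := fun ψ => c.sem (fun p a b : ℝ => p * a + (1 - p) * b) f lin ψ with hG
    have : ∀ k t, (F^[k] Q) t → (G^[k] φ) t ≤ (G^[k] ψ) t := by
      intro k
      induction k with
      | zero => exact hle
      | succ k ih =>
        intro t ht
        rw [Function.iterate_succ_apply'] at *
        rw [Function.iterate_succ_apply']
        exact hc ih ht
    exact this _ _ h
  | _ => exact hle _ h

/-- Linearity of expectation. It lets a potential that is known before a call be carried through the
call as an additive constant. -/
lemma wp_affine (c : Cmd) (φ : Config → ℝ) (a b : ℝ) (s : Config) :
    c.wp f lin (fun t => a * φ t + b) s = a * c.wp f lin φ s + b := by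
  unfold wp
  induction c generalizing φ s with
  | flip i p => simp only [sem]; ring
  | seq c d hc hd =>
    simp only [sem]
    rw [← hc]
    congr 1
    funext t
    exact hd φ t
  | ifN x y c d hc hd => simp only [sem]; split_ifs; exacts [hc φ s, hd φ s]
  | ifR x y c d hc hd => simp only [sem]; split_ifs; exacts [hc φ s, hd φ s]
  | loop e c hc =>
    simp only [sem]
    set G := fun ψ => c.sem (fun p a b : ℝ => p * a + (1 - p) * b) f lin ψ with hG
    have : ∀ k, (G^[k] fun t => a * φ t + b) = fun t => a * (G^[k] φ) t + b := by
      intro k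
      induction k with
      | zero => rfl
      | succ k ih =>
        rw [Function.iterate_succ_apply', ih, Function.iterate_succ_apply']
        funext t
        exact hc _ t
    rw [this]
  | _ => rfl

lemma wp_const (c : Cmd) (b : ℝ) (s : Config) : c.wp f lin (fun _ => b) s = b := by
  have := wp_affine (f := f) (lin := lin) c (fun _ => 0) 0 b s
  simpa using this

lemma Hoare.conseq {c : Cmd} {s : Config} {Q R : Config → Prop} {φ ψ : Config → ℝ} {a b : ℝ}
    (h : c.Hoare f lin s Q φ a) (hQR : ∀ t, Q t → R t) (hle : ∀ t, Q t → φ t ≤ ψ t)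
    (hab : b ≤ a) : c.Hoare f lin s R ψ b :=
  ⟨h.1.mono hQR, hab.trans (h.2.trans (wp_mono hle h.1))⟩

/-- The tower rule: the intermediate function `φ` is a lower bound on the conditional expectation of
`ψ` given the state between the two programs. -/
lemma Hoare.seq {c d : Cmd} {s : Config} {Q R : Config → Prop} {φ ψ : Config → ℝ} {a : ℝ}
    (hc : c.Hoare f lin s Q φ a) (hd : ∀ t, Q t → d.Hoare f lin t R ψ (φ t)) :
    (c.seq d).Hoare f lin s R ψ a :=
  ⟨hc.1.mono fun t ht => (hd t ht).1, hc.2.trans (wp_mono (fun t ht => (hd t ht).2) hc.1)⟩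

lemma Post.hoare {c : Cmd} {s : Config} {Q : Config → Prop} {φ : Config → ℝ} {a : ℝ}
    (h : c.Post f lin Q s) (hle : ∀ t, Q t → a ≤ φ t) : c.Hoare f lin s Q φ a :=
  ⟨h, by rw [← wp_const (f := f) (lin := lin) c a s]; exact wp_mono hle h⟩

lemma Post.hoare_of_le {c : Cmd} {s : Config} {Q : Config → Prop} {φ : Config → ℝ} {a : ℝ}
    (h : c.Post f lin (fun t => Q t ∧ a ≤ φ t) s) : c.Hoare f lin s Q φ a :=
  (h.hoare fun _ ht => ht.2).conseq (fun _ ht => ht.1) (fun _ _ => le_rfl) le_rfl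

lemma Post.seq {c d : Cmd} {s : Config} {Q R : Config → Prop}
    (hc : c.Post f lin Q s) (hd : ∀ t, Q t → d.Post f lin R t) : (c.seq d).Post f lin R s :=
  hc.mono hd

lemma Post.seq_hoare {c d : Cmd} {s : Config} {Q R : Config → Prop} {ψ : Config → ℝ} {a : ℝ}
    (hc : c.Post f lin Q s) (hd : ∀ t, Q t → d.Hoare f lin t R ψ a) :
    (c.seq d).Hoare f lin s R ψ a :=
  (hc.hoare (φ := fun _ => a) fun _ _ => le_rfl).seq hd

/-- A supermartingale-type argument with additive drift: losing at most `η` in expectation per round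
costs at most the number of rounds times `η`. -/
lemma Hoare.loop_add {e : NExp} {c : Cmd} {s : Config} (k₀ : ℕ) (I : ℕ → Config → Prop)
    (Φ : ℕ → Config → ℝ) (η : ℝ) (h0 : I k₀ s)
    (hstep : ∀ k < e.eval s, ∀ t, I (k₀ + k) t →
      c.Hoare f lin t (I (k₀ + k + 1)) (Φ (k₀ + k + 1)) (Φ (k₀ + k) t - η)) :
    (Cmd.loop e c).Hoare f lin s (I (k₀ + e.eval s)) (Φ (k₀ + e.eval s))
      (Φ k₀ s - e.eval s * η) := by
  set N := e.eval s with hN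
  unfold Hoare Post wp
  simp only [sem, ← hN]
  set F := fun ψ => c.sem (fun (_ : ℝ) (a b : Prop) => a ∧ b) f lin ψ with hF
  set G := fun ψ => c.sem (fun p a b : ℝ => p * a + (1 - p) * b) f lin ψ with hG
  -- The semantics of a loop is iterated from the end, so the induction is on the number `j` of
  -- rounds still to come.
  have key : ∀ j k, k + j = N → ∀ t, I (k₀ + k) t →
      (F^[j] (I (k₀ + N))) t ∧ Φ (k₀ + k) t - j * η ≤ (G^[j] (Φ (k₀ + N))) t := by
    intro j
    induction j with
    | zero =>
      intro k hk t ht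
      obtain rfl : k = N := by omega
      simpa using ht
    | succ j ih =>
      intro k hk t ht
      rw [Function.iterate_succ_apply', Function.iterate_succ_apply']
      have h1 := hstep k (by omega) t ht
      have h2 : c.Hoare f lin t (F^[j] (I (k₀ + N))) (G^[j] (Φ (k₀ + N)))
          (Φ (k₀ + k) t - (j + 1 : ℕ) * η) := by
        have h3 : c.Hoare f lin t (I (k₀ + k + 1)) (fun t => 1 * Φ (k₀ + k + 1) t + -(j * η))
            (Φ (k₀ + k) t - (j + 1 : ℕ) * η) := by
          refine ⟨h1.1, ?_⟩
          rw [wp_affine]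
          have := h1.2
          push_cast
          linarith
        refine h3.conseq (fun t ht => (ih (k + 1) (by omega) t ht).1) (fun t ht => ?_) le_rfl
        have := (ih (k + 1) (by omega) t ht).2
        rw [← add_assoc] at this
        linarith
      exact h2
  simpa using key N 0 (by omega) s h0

lemma Hoare.loop {e : NExp} {c : Cmd} {s : Config} (I : ℕ → Config → Prop)
    (Φ : ℕ → Config → ℝ) (η : ℝ) (h0 : I 0 s)
    (hstep : ∀ k < e.eval s, ∀ t, I k t → c.Hoare f lin t (I (k + 1)) (Φ (k + 1)) (Φ k t - η)) :
    (Cmd.loop e c).Hoare f lin s (I (e.eval s)) (Φ (e.eval s)) (Φ 0 s - e.eval s * η) := by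
  have := Hoare.loop_add (e := e) (s := s) 0 I Φ η h0 (by simpa using hstep)
  simpa using this

lemma Post.loop {e : NExp} {c : Cmd} {s : Config} (I : ℕ → Config → Prop) (h0 : I 0 s)
    (hstep : ∀ k < e.eval s, ∀ t, I k t → c.Post f lin (I (k + 1)) t) :
    (Cmd.loop e c).Post f lin (I (e.eval s)) s :=
  (Hoare.loop I (fun _ _ => 0) 0 h0
    fun k hk t ht => (hstep k hk t ht).hoare (φ := fun _ => 0) (a := 0 - 0) (by simp)).1

end Logic

/-! ### Polynomial running time -/

end Cmd

/-- A polynomial bound on the value of an expression that only reads register `0`. -/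
def NExp.poly : NExp → Polynomial ℕ
  | .const k => Polynomial.C k
  | .reg _ => Polynomial.X
  | .add a b => a.poly + b.poly
  | .sub a _ => a.poly

/-- The expression reads no register except register `0`. -/
def NExp.ReadsZero : NExp → Prop
  | .const _ => True
  | .reg i => i = 0
  | .add a b => a.ReadsZero ∧ b.ReadsZero
  | .sub a b => a.ReadsZero ∧ b.ReadsZero

lemma NExp.eval_le_poly {e : NExp} (h : e.ReadsZero) (s : Config) :
    e.eval s ≤ e.poly.eval (s.reg 0) := by
  induction e with
  | const k => simp [NExp.eval, NExp.poly]
  | reg i => obtain rfl : i = 0 := h; simp [NExp.eval, NExp.poly]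
  | add a b ha hb =>
    simp only [NExp.eval, NExp.poly, Polynomial.eval_add]
    exact add_le_add (ha h.1) (hb h.2)
  | sub a b ha hb =>
    simp only [NExp.eval, NExp.poly]
    exact (Nat.sub_le _ _).trans (ha h.1)

namespace Cmd

/-- Register `0` is never written, and all loop lengths depend on register `0` only. -/
def Bounded : Cmd → Prop
  | .setN i _ => i ≠ 0
  | .flip i _ => i ≠ 0
  | .seq c d => c.Bounded ∧ d.Bounded
  | .ifN _ _ c d => c.Bounded ∧ d.Bounded
  | .ifR _ _ c d => c.Bounded ∧ d.Bounded
  | .loop e c => e.ReadsZero ∧ c.Bounded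
  | _ => True

/-- A polynomial bound on the running time of a bounded program. -/
def poly : Cmd → Polynomial ℕ
  | .skip => 1
  | .setN _ e => Polynomial.C (e.cost + 1)
  | .setR row col e => Polynomial.C (row.cost + col.cost + e.cost + 1)
  | .flip _ p => Polynomial.C (p.cost + 1)
  | .value row col src => Polynomial.C (row.cost + col.cost + src.cost) + (Polynomial.X + 1)
  | .optimize dst src => Polynomial.C (dst.cost + src.cost) + (Polynomial.X + 1)
  | .seq c d => c.poly + d.poly
  | .ifN a b c d => Polynomial.C (a.cost + b.cost + 1) + (c.poly + d.poly)
  | .ifR a b c d => Polynomial.C (a.cost + b.cost + 1) + (c.poly + d.poly)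
  | .loop e c => Polynomial.C (e.cost + 1) + e.poly * (c.poly + 1)

/-- The invariance of register 0 is proved together with the time bound, because it is what bounds
all later loop lengths in terms of `n`. -/
theorem time_le_of_mem_support {n : ℕ} {f : Finset (Fin n) → ℝ}
    {lin : (Fin n → ℝ) → (Fin n → ℝ)} {c : Cmd} (h : c.Bounded) {s t : Config}
    (hs : s.reg 0 = n) (ht : t ∈ (c.exec f lin s).support) :
    t.reg 0 = n ∧ t.time ≤ s.time + c.poly.eval n := by
  induction c generalizing s t with
  | skip =>
    simp only [exec, PMF.support_pure, Set.mem_singleton_iff] at ht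
    subst ht
    simp [Config.tick, hs, poly]
  | setN i e =>
    simp only [exec, PMF.support_pure, Set.mem_singleton_iff] at ht
    subst ht
    have : i ≠ 0 := h
    simp [Config.tick, Config.setReg, hs, poly, Function.update_of_ne this.symm]
  | setR row col e =>
    simp only [exec, PMF.support_pure, Set.mem_singleton_iff] at ht
    subst ht
    simp [Config.tick, Config.setCell, hs, poly]
  | flip i p =>
    simp only [exec, PMF.mem_support_map_iff] at ht
    obtain ⟨b, -, rfl⟩ := ht
    have : i ≠ 0 := h
    simp [Config.tick, Config.setReg, hs, poly, Function.update_of_ne this.symm]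
  | value row col src =>
    simp only [exec, PMF.support_pure, Set.mem_singleton_iff] at ht
    subst ht
    simp [Config.tick, Config.setCell, hs, poly]
  | optimize dst src =>
    simp only [exec, PMF.support_pure, Set.mem_singleton_iff] at ht
    subst ht
    simp [Config.tick, Config.setVec, hs, poly]
  | seq c d hc hd =>
    simp only [exec, PMF.mem_support_bind_iff] at ht
    obtain ⟨r, hr, ht⟩ := ht
    obtain ⟨h1, h2⟩ := hc h.1 hs hr
    obtain ⟨h3, h4⟩ := hd h.2 h1 ht
    refine ⟨h3, ?_⟩
    simp only [poly, Polynomial.eval_add]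
    omega
  | ifN a b c d hc hd =>
    simp only [exec] at ht
    simp only [poly, Polynomial.eval_add, Polynomial.eval_C]
    split_ifs at ht
    · obtain ⟨h1, h2⟩ := hc h.1 (by exact hs) ht
      exact ⟨h1, by simp only [Config.tick] at h2; omega⟩
    · obtain ⟨h1, h2⟩ := hd h.2 (by exact hs) ht
      exact ⟨h1, by simp only [Config.tick] at h2; omega⟩
  | ifR a b c d hc hd =>
    simp only [exec] at ht
    simp only [poly, Polynomial.eval_add, Polynomial.eval_C]
    split_ifs at ht
    · obtain ⟨h1, h2⟩ := hc h.1 (by exact hs) ht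
      exact ⟨h1, by simp only [Config.tick] at h2; omega⟩
    · obtain ⟨h1, h2⟩ := hd h.2 (by exact hs) ht
      exact ⟨h1, by simp only [Config.tick] at h2; omega⟩
  | loop e c hc =>
    simp only [exec] at ht
    have key : ∀ (k : ℕ) (μ : PMF Config) (T : ℕ), (∀ r ∈ μ.support, r.reg 0 = n ∧ r.time ≤ T) →
        ∀ r ∈ ((fun μ : PMF Config => μ.bind fun t => c.exec f lin (t.tick 1))^[k] μ).support,
          r.reg 0 = n ∧ r.time ≤ T + k * (c.poly.eval n + 1) := by
      intro k
      induction k with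
      | zero => intro μ T hμ r hr; simpa using hμ r hr
      | succ k ih =>
        intro μ T hμ r hr
        rw [Function.iterate_succ_apply] at hr
        have := ih _ (T + (c.poly.eval n + 1)) ?_ r hr
        · refine ⟨this.1, this.2.trans (le_of_eq (by ring))⟩
        · intro r hr
          rw [PMF.mem_support_bind_iff] at hr
          obtain ⟨r', hr', hr⟩ := hr
          obtain ⟨h1, h2⟩ := hμ r' hr'
          obtain ⟨h3, h4⟩ := hc h.2 (by exact h1) hr
          exact ⟨h3, by simp only [Config.tick] at h4; omega⟩
    obtain ⟨h1, h2⟩ := key _ _ (s.time + (e.cost + 1)) (by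
      intro r hr
      rw [PMF.support_pure, Set.mem_singleton_iff] at hr
      subst hr
      exact ⟨hs, le_rfl⟩) t ht
    refine ⟨h1, h2.trans ?_⟩
    simp only [poly, Polynomial.eval_add, Polynomial.eval_C, Polynomial.eval_mul,
      Polynomial.eval_one]
    have := NExp.eval_le_poly h.1 s
    rw [hs] at this
    have := Nat.mul_le_mul_right (c.poly.eval n + 1) this
    omega

theorem Bounded.isPolyTime {c : Cmd} (h : c.Bounded) : c.IsPolyTime := by
  refine ⟨c.poly, fun n f lin s hs => ?_⟩
  simpa [Config.init] using (time_le_of_mem_support h (by simp [Config.init]) hs).2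

end Cmd

/-! ### Multilinear extensions -/

section Multilinear

variable {n : ℕ}

/-- The indicator vector of a set. -/
def ind (S : Finset (Fin n)) : Fin n → ℝ := fun u => if u ∈ S then 1 else 0

/-- The coordinate-wise probabilistic sum. -/
def psum (x y : Fin n → ℝ) : Fin n → ℝ := fun u => x u + y u - x u * y u

/-- A function that is affine in every coordinate. -/
def CoordAffine (G : (Fin n → ℝ) → ℝ) : Prop :=
  ∀ x u t, G (Function.update x u t) =
    (1 - t) * G (Function.update x u 0) + t * G (Function.update x u 1)

lemma ind_mem (S : Finset (Fin n)) : ind S ∈ Set.Icc (0 : Fin n → ℝ) 1 := by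
  constructor <;> intro u <;> simp only [ind] <;> split_ifs <;> simp

lemma psum_ind (S T : Finset (Fin n)) : psum (ind S) (ind T) = ind (S ∪ T) := by
  funext u
  by_cases h1 : u ∈ S <;> by_cases h2 : u ∈ T <;> simp [psum, ind, h1, h2]

lemma mul_ind (S T : Finset (Fin n)) : ind S * ind T = ind (S ∩ T) := by
  funext u
  by_cases h1 : u ∈ S <;> by_cases h2 : u ∈ T <;> simp [ind, h1, h2]

lemma update_ind_one (S : Finset (Fin n)) (u : Fin n) :
    Function.update (ind S) u 1 = ind (insert u S) := by
  funext v
  by_cases h : v = u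
  · subst h; simp [ind]
  · simp [ind, h]

lemma update_ind_zero (S : Finset (Fin n)) (u : Fin n) :
    Function.update (ind S) u 0 = ind (S.erase u) := by
  funext v
  by_cases h : v = u
  · subst h; simp [ind]
  · simp [ind, h]

lemma psum_mem {x y : Fin n → ℝ} (hx : x ∈ Set.Icc (0 : Fin n → ℝ) 1)
    (hy : y ∈ Set.Icc (0 : Fin n → ℝ) 1) : psum x y ∈ Set.Icc (0 : Fin n → ℝ) 1 := by
  constructor <;> intro u <;> have := hx.1 u <;> have := hx.2 u <;> have := hy.1 u <;>
    have := hy.2 u <;> simp only [psum, Pi.zero_apply, Pi.one_apply] at * <;> nlinarith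

/-- The witness is `(y - x) / (1 - x)`; where `x u = 1` the quotient is zero by convention, which is
right because then `y u = 1` too. -/
lemma exists_psum_eq {x y : Fin n → ℝ} (hx : x ∈ Set.Icc (0 : Fin n → ℝ) 1)
    (hy : y ∈ Set.Icc (0 : Fin n → ℝ) 1) (h : x ≤ y) :
    ∃ d ∈ Set.Icc (0 : Fin n → ℝ) 1, psum x d = y := by
  refine ⟨fun u => (y u - x u) / (1 - x u), ⟨fun u => ?_, fun u => ?_⟩, ?_⟩
  · exact div_nonneg (sub_nonneg.2 (h u)) (sub_nonneg.2 (hx.2 u))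
  · exact div_le_one_of_le₀ (by have := hy.2 u; simp only [Pi.one_apply] at this; linarith)
      (sub_nonneg.2 (hx.2 u))
  · funext u
    simp only [psum]
    by_cases h1 : x u = 1
    · have := h u; have := hy.2 u
      simp only [Pi.one_apply] at this
      rw [h1]; simp; linarith
    · have : 1 - x u ≠ 0 := fun h' => h1 (by linarith)
      field_simp
      ring

lemma CoordAffine.comp {G : (Fin n → ℝ) → ℝ} (hG : CoordAffine G) (α β : Fin n → ℝ) :
    CoordAffine fun x => G (α + β * x) := by
  have key : ∀ x u t, α + β * Function.update x u t =
      Function.update (α + β * x) u (α u + β u * t) := by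
    intro x u t
    funext v
    by_cases h : v = u
    · subst h; simp
    · simp [h]
  intro x u t
  simp only [key]
  rw [hG _ u (α u + β u * t), hG _ u (α u + β u * 0), hG _ u (α u + β u * 1)]
  ring

/-- A coordinate-wise affine function is determined by its values at the vertices. All substitution
identities for multilinear extensions below are instances of this. -/
lemma CoordAffine.eq_sum {G : (Fin n → ℝ) → ℝ} (hG : CoordAffine G) (x : Fin n → ℝ) :
    G x = multilinearExt (fun S => G (ind S)) x := by
  -- Expand one coordinate at a time; `A` is the set of coordinates already rounded to vertices.
  have key : ∀ A : Finset (Fin n), G x = ∑ S ∈ A.powerset,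
      (∏ u ∈ S, x u) * (∏ u ∈ A \ S, (1 - x u)) * G (fun u => if u ∈ A then ind S u else x u) := by
    intro A
    induction A using Finset.induction_on with
    | empty => simp
    | insert a A ha ih =>
      rw [Finset.sum_powerset_insert ha, ih, ← Finset.sum_add_distrib]
      refine Finset.sum_congr rfl fun S hS => ?_
      have hSA := Finset.mem_powerset.1 hS
      have haS : a ∉ S := fun h => ha (hSA h)
      have e1 : insert a A \ S = insert a (A \ S) := by
        rw [Finset.insert_sdiff_of_notMem _ haS]
      have e2 : insert a A \ insert a S = A \ S := by
        ext v; by_cases hv : v = a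
        · subst hv; simp [ha]
        · simp [hv]
      have e3 : (fun u => if u ∈ insert a A then ind S u else x u) =
          Function.update (fun u => if u ∈ A then ind S u else x u) a 0 := by
        funext v; by_cases hv : v = a
        · subst hv; simp [ind, haS]
        · simp [hv]
      have e4 : (fun u => if u ∈ insert a A then ind (insert a S) u else x u) =
          Function.update (fun u => if u ∈ A then ind S u else x u) a 1 := by
        funext v; by_cases hv : v = a
        · subst hv; simp [ind]
        · simp [hv, ind]
      have e5 : (fun u => if u ∈ A then ind S u else x u) =
          Function.update (fun u => if u ∈ A then ind S u else x u) a (x a) := by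
        funext v; by_cases hv : v = a
        · subst hv; simp [ha]
        · simp [hv]
      rw [e1, e2, e3, e4, Finset.prod_insert (by simp [ha]), Finset.prod_insert haS, e5, hG]
      simp only [Function.update_idem]
      ring
  rw [key Finset.univ]
  simp only [multilinearExt, Finset.powerset_univ, Finset.mem_univ, if_true]
  refine Finset.sum_congr rfl fun S _ => ?_
  rw [Finset.compl_eq_univ_sdiff]
  ring

lemma coordAffine_multilinearExt (f : Finset (Fin n) → ℝ) : CoordAffine (multilinearExt f) := by
  intro x u t
  simp only [multilinearExt, Finset.mul_sum, ← Finset.sum_add_distrib]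
  refine Finset.sum_congr rfl fun S _ => ?_
  have hprod : ∀ (T : Finset (Fin n)), u ∉ T → ∀ (g : ℝ → ℝ) (r : ℝ),
      ∏ v ∈ T, g (Function.update x u r v) = ∏ v ∈ T, g (x v) := by
    intro T hT g r
    refine Finset.prod_congr rfl fun v hv => ?_
    rw [Function.update_of_ne (ne_of_mem_of_not_mem hv hT)]
  by_cases h : u ∈ S
  · have h' : u ∉ Sᶜ := by simpa using h
    have h'' : u ∉ S.erase u := by simp
    simp only [← Finset.mul_prod_erase S _ h, hprod _ h' (fun r => 1 - r),
      Function.update_self]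
    have := hprod _ h'' id
    simp only [id] at this
    simp only [this]
    ring
  · have h' : u ∈ Sᶜ := by simpa using h
    have h'' : u ∉ Sᶜ.erase u := by simp
    simp only [← Finset.mul_prod_erase Sᶜ _ h', hprod _ h'' (fun r => 1 - r),
      Function.update_self]
    have := hprod _ h id
    simp only [id] at this
    simp only [this]
    ring

lemma multilinearExt_ind (f : Finset (Fin n) → ℝ) (A : Finset (Fin n)) :
    multilinearExt f (ind A) = f A := by
  rw [multilinearExt, Finset.sum_eq_single A]
  · have h1 : ∏ u ∈ A, ind A u = 1 := Finset.prod_eq_one fun u hu => by simp [ind, hu]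
    have h2 : ∏ u ∈ Aᶜ, (1 - ind A u) = 1 :=
      Finset.prod_eq_one fun u hu => by simp [ind, Finset.mem_compl.1 hu]
    rw [h1, h2]; ring
  · intro S _ hS
    by_cases h : S ⊆ A
    · obtain ⟨u, hu, huS⟩ : ∃ u ∈ A, u ∉ S := by
        by_contra! h'
        exact hS (Finset.Subset.antisymm h h')
      rw [Finset.prod_eq_zero (i := u) (s := Sᶜ) (by simpa using huS) (by simp [ind, hu])]
      ring
    · obtain ⟨u, hu, huA⟩ := Finset.not_subset.1 h
      rw [Finset.prod_eq_zero (i := u) (s := S) hu (by simp [ind, huA])]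
      ring
  · simp

lemma multilinearExt_add (f g : Finset (Fin n) → ℝ) (x : Fin n → ℝ) :
    multilinearExt (fun S => f S + g S) x = multilinearExt f x + multilinearExt g x := by
  simp only [multilinearExt, ← Finset.sum_add_distrib, add_mul]

lemma multilinearExt_mul (c : ℝ) (f : Finset (Fin n) → ℝ) (x : Fin n → ℝ) :
    multilinearExt (fun S => c * f S) x = c * multilinearExt f x := by
  simp only [multilinearExt, Finset.mul_sum, mul_assoc]

lemma multilinearExt_sub (f g : Finset (Fin n) → ℝ) (x : Fin n → ℝ) :
    multilinearExt (fun S => f S - g S) x = multilinearExt f x - multilinearExt g x := by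
  simp only [multilinearExt, ← Finset.sum_sub_distrib, sub_mul]

lemma multilinearExt_sum {ι : Type*} (s : Finset ι) (f : ι → Finset (Fin n) → ℝ)
    (x : Fin n → ℝ) :
    multilinearExt (fun S => ∑ i ∈ s, f i S) x = ∑ i ∈ s, multilinearExt (f i) x := by
  simp only [multilinearExt, Finset.sum_mul]
  rw [Finset.sum_comm]

lemma multilinearExt_const (c : ℝ) (x : Fin n → ℝ) : multilinearExt (fun _ => c) x = c :=
  (CoordAffine.eq_sum (G := fun _ => c) (fun _ _ _ => by ring) x).symm

lemma multilinearExt_mono {f g : Finset (Fin n) → ℝ} (h : ∀ S, f S ≤ g S) {x : Fin n → ℝ}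
    (hx : x ∈ Set.Icc (0 : Fin n → ℝ) 1) : multilinearExt f x ≤ multilinearExt g x := by
  refine Finset.sum_le_sum fun S _ => ?_
  rw [mul_assoc, mul_assoc]
  exact mul_le_mul_of_nonneg_right (h S) (mul_nonneg (Finset.prod_nonneg fun u _ => hx.1 u)
    (Finset.prod_nonneg fun u _ => sub_nonneg.2 (hx.2 u)))

lemma multilinearExt_nonneg {f : Finset (Fin n) → ℝ} (h : ∀ S, 0 ≤ f S) {x : Fin n → ℝ}
    (hx : x ∈ Set.Icc (0 : Fin n → ℝ) 1) : 0 ≤ multilinearExt f x := by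
  rw [← multilinearExt_const 0 x]
  exact multilinearExt_mono h hx

lemma multilinearExt_le {f : Finset (Fin n) → ℝ} {B : ℝ} (h : ∀ S, f S ≤ B) {x : Fin n → ℝ}
    (hx : x ∈ Set.Icc (0 : Fin n → ℝ) 1) : multilinearExt f x ≤ B := by
  rw [← multilinearExt_const B x]
  exact multilinearExt_mono h hx

lemma multilinearExt_comp (f : Finset (Fin n) → ℝ) (α β x : Fin n → ℝ) :
    multilinearExt f (α + β * x) = multilinearExt (fun S => multilinearExt f (α + β * ind S)) x :=
  ((coordAffine_multilinearExt f).comp α β).eq_sum x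

/-- The union of two independent random sets contains `u` with probability `x u + y u - x u * y u`.
The proof avoids probability: `psum` is affine in each argument, so each can be expanded over
vertices. -/
lemma multilinearExt_psum (f : Finset (Fin n) → ℝ) (x y : Fin n → ℝ) :
    multilinearExt f (psum x y) =
      multilinearExt (fun S => multilinearExt (fun T => f (S ∪ T)) y) x := by
  have e1 : ∀ x y : Fin n → ℝ, psum x y = y + (1 - y) * x := by
    intro x y; funext u; simp [psum]; ring
  have e2 : ∀ x y : Fin n → ℝ, psum x y = x + (1 - x) * y := by
    intro x y; funext u; simp [psum]; ring
  rw [e1, multilinearExt_comp]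
  congr 1
  funext S
  rw [← e1, e2, multilinearExt_comp]
  congr 1
  funext T
  rw [← e2, psum_ind, multilinearExt_ind]

lemma multilinearExt_inter (f : Finset (Fin n) → ℝ) (x y : Fin n → ℝ) :
    multilinearExt f (x * y) =
      multilinearExt (fun S => multilinearExt (fun T => f (S ∩ T)) y) x := by
  have e1 : ∀ x y : Fin n → ℝ, x * y = 0 + y * x := by
    intro x y; rw [zero_add, mul_comm]
  have e2 : ∀ x y : Fin n → ℝ, x * y = 0 + x * y := by
    intro x y; rw [zero_add]
  rw [e1, multilinearExt_comp]
  congr 1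
  funext S
  rw [← e1, e2, multilinearExt_comp]
  congr 1
  funext T
  rw [← e2, mul_ind, multilinearExt_ind]

lemma multilinearExt_mem (v : Fin n) (x : Fin n → ℝ) :
    multilinearExt (fun S => if v ∈ S then (1 : ℝ) else 0) x = x v := by
  refine (CoordAffine.eq_sum (G := fun x => x v) (fun x u t => ?_) x).symm
  by_cases h : v = u
  · subst h; simp
  · simp [h]; ring

/-! ### Partial derivatives, and first-order estimates from submodularity. -/

/-- The partial derivative of the multilinear extension. -/
def partialD (f : Finset (Fin n) → ℝ) (u : Fin n) (x : Fin n → ℝ) : ℝ :=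
  multilinearExt (fun S => f (insert u S) - f (S.erase u)) x

lemma multilinearExt_update_eq (f : Finset (Fin n) → ℝ) (x : Fin n → ℝ) (u : Fin n) (c : ℝ) :
    multilinearExt f (Function.update x u c) =
      multilinearExt (fun S => multilinearExt f (Function.update (ind S) u c)) x := by
  have e : ∀ x : Fin n → ℝ, Function.update x u c =
      Function.update (0 : Fin n → ℝ) u c + Function.update (1 : Fin n → ℝ) u 0 * x := by
    intro x; funext v
    by_cases h : v = u
    · subst h; simp
    · simp [h]
  rw [e, multilinearExt_comp]
  simp only [← e]

lemma multilinearExt_insert (f : Finset (Fin n) → ℝ) (x : Fin n → ℝ) (u : Fin n) :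
    multilinearExt (fun S => f (insert u S)) x = multilinearExt f (Function.update x u 1) := by
  simp only [multilinearExt_update_eq f x, update_ind_one, multilinearExt_ind]

lemma multilinearExt_erase (f : Finset (Fin n) → ℝ) (x : Fin n → ℝ) (u : Fin n) :
    multilinearExt (fun S => f (S.erase u)) x = multilinearExt f (Function.update x u 0) := by
  simp only [multilinearExt_update_eq f x, update_ind_zero, multilinearExt_ind]

lemma multilinearExt_update (f : Finset (Fin n) → ℝ) (x : Fin n → ℝ) (u : Fin n) (t : ℝ) :
    multilinearExt f (Function.update x u t) =
      multilinearExt f x + (t - x u) * partialD f u x := by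
  rw [partialD, multilinearExt_sub, multilinearExt_insert, multilinearExt_erase]
  have h1 := coordAffine_multilinearExt f x u t
  have h2 := coordAffine_multilinearExt f x u (x u)
  rw [Function.update_eq_self] at h2
  rw [h1, h2]
  ring

/-- Adding `u` changes nothing when `u` is already in the random set, which accounts for the factor
`1 - x u`. -/
lemma multilinearExt_marginal (f : Finset (Fin n) → ℝ) (x : Fin n → ℝ) (u : Fin n) :
    multilinearExt (fun S => f (insert u S) - f S) x = (1 - x u) * partialD f u x := by
  rw [multilinearExt_sub, multilinearExt_insert, multilinearExt_update]
  ring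

lemma multilinearExt_antitone {f : Finset (Fin n) → ℝ} (hf : ∀ S T, S ⊆ T → f T ≤ f S)
    {x y : Fin n → ℝ} (hx : x ∈ Set.Icc (0 : Fin n → ℝ) 1) (hy : y ∈ Set.Icc (0 : Fin n → ℝ) 1)
    (h : x ≤ y) : multilinearExt f y ≤ multilinearExt f x := by
  obtain ⟨d, hd, rfl⟩ := exists_psum_eq hx hy h
  rw [multilinearExt_psum]
  exact multilinearExt_mono (fun S => multilinearExt_le
    (fun T => hf _ _ Finset.subset_union_left) hd) hx

/-- Submodularity applied to `insert u S` and `T.erase u`, whose union and intersection are `insert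
u T` and `S.erase u`, shows that the discrete derivative is antitone in the set. -/
lemma IsSubmodular.partialD_antitone {f : Finset (Fin n) → ℝ} (hf : IsSubmodular f) (u : Fin n)
    {x y : Fin n → ℝ} (hx : x ∈ Set.Icc (0 : Fin n → ℝ) 1) (hy : y ∈ Set.Icc (0 : Fin n → ℝ) 1)
    (h : x ≤ y) : partialD f u y ≤ partialD f u x := by
  refine multilinearExt_antitone (fun S T hST => ?_) hx hy h
  have h1 := hf (insert u S) (T.erase u)
  have e1 : insert u S ∪ T.erase u = insert u T := by
    ext v; by_cases hv : v = u
    · simp [hv]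
    · simp [hv]; exact fun h => hST h
  have e2 : insert u S ∩ T.erase u = S.erase u := by
    ext v; by_cases hv : v = u
    · simp [hv]
    · simp [hv]; exact fun h => hST h
  rw [e1, e2] at h1
  linarith

lemma IsSubmodular.le_sum {f : Finset (Fin n) → ℝ} (hf : IsSubmodular f) (S : Finset (Fin n)) :
    f S ≤ f ∅ + ∑ v ∈ S, (f {v} - f ∅) := by
  induction S using Finset.induction_on with
  | empty => simp
  | insert a S ha ih =>
    have h1 := hf {a} S
    have e2 : {a} ∩ S = (∅ : Finset (Fin n)) := by
      rw [Finset.singleton_inter_of_notMem ha]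
    rw [e2, ← Finset.insert_eq] at h1
    rw [Finset.sum_insert ha]
    linarith

lemma IsSubmodular.multilinearExt_le {f : Finset (Fin n) → ℝ} (hf : IsSubmodular f)
    {q : Fin n → ℝ} (hq : q ∈ Set.Icc (0 : Fin n → ℝ) 1) :
    multilinearExt f q ≤ f ∅ + ∑ v, q v * (f {v} - f ∅) := by
  have h1 : ∀ S, f S ≤ f ∅ + ∑ v, (f {v} - f ∅) * (if v ∈ S then 1 else 0) := by
    intro S
    refine (hf.le_sum S).trans_eq ?_
    simp [mul_ite, Finset.sum_ite_mem]
  refine (multilinearExt_mono h1 hq).trans_eq ?_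
  rw [multilinearExt_add, multilinearExt_const, multilinearExt_sum]
  simp only [multilinearExt_mul, multilinearExt_mem]
  simp only [mul_comm]

lemma one_sub_sum_le_prod (q : Fin n → ℝ) (hq : q ∈ Set.Icc (0 : Fin n → ℝ) 1)
    (s : Finset (Fin n)) : 1 - ∑ v, q v ≤ ∏ v ∈ s, (1 - q v) := by
  have h1 : 1 - ∑ v ∈ s, q v ≤ ∏ v ∈ s, (1 - q v) := by
    induction s using Finset.induction_on with
    | empty => simp
    | insert a s ha ih =>
      rw [Finset.sum_insert ha, Finset.prod_insert ha]
      have h0 : 0 ≤ q a := hq.1 a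
      have h1 : q a ≤ 1 := hq.2 a
      have h2 : ∏ v ∈ s, (1 - q v) ≤ 1 := Finset.prod_le_one
        (fun v _ => sub_nonneg.2 (hq.2 v)) fun v _ => sub_le_self _ (hq.1 v)
      nlinarith
  have h2 : ∑ v ∈ s, q v ≤ ∑ v, q v :=
    Finset.sum_le_sum_of_subset_of_nonneg (Finset.subset_univ _) fun v _ _ => hq.1 v
  linarith

/-- Only the empty set and the singletons are kept in the expansion; by the union bound no other
element appears with probability at least `1 - ∑ q`. -/
lemma le_multilinearExt {f : Finset (Fin n) → ℝ} (hf : ∀ S, 0 ≤ f S) {q : Fin n → ℝ}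
    (hq : q ∈ Set.Icc (0 : Fin n → ℝ) 1) :
    (1 - ∑ v, q v) * (f ∅ + ∑ v, q v * f {v}) ≤ multilinearExt f q := by
  set s := ∑ v, q v
  have hpos : ∀ S, 0 ≤ f S * (∏ u ∈ S, q u) * ∏ u ∈ Sᶜ, (1 - q u) := fun S =>
    mul_nonneg (mul_nonneg (hf S) (Finset.prod_nonneg fun u _ => hq.1 u))
      (Finset.prod_nonneg fun u _ => sub_nonneg.2 (hq.2 u))
  have h1 : ∑ S ∈ insert ∅ (Finset.univ.image fun v : Fin n => ({v} : Finset (Fin n))),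
      f S * (∏ u ∈ S, q u) * ∏ u ∈ Sᶜ, (1 - q u) ≤ multilinearExt f q :=
    Finset.sum_le_sum_of_subset_of_nonneg (Finset.subset_univ _) fun S _ _ => hpos S
  rw [Finset.sum_insert (by simp), Finset.sum_image (fun a _ b _ h => Finset.singleton_injective h)] at h1
  refine le_trans ?_ h1
  rw [mul_add, Finset.mul_sum]
  refine add_le_add ?_ (Finset.sum_le_sum fun v _ => ?_)
  · rw [Finset.prod_empty, mul_one, mul_comm]
    exact mul_le_mul_of_nonneg_left (one_sub_sum_le_prod q hq _) (hf _)
  · rw [Finset.prod_singleton, mul_comm, mul_comm (q v)]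
    exact mul_le_mul_of_nonneg_left (one_sub_sum_le_prod q hq _) (mul_nonneg (hf _) (hq.1 v))

lemma IsSubmodular.comp_inter {f : Finset (Fin n) → ℝ} (hf : IsSubmodular f)
    (A : Finset (Fin n)) : IsSubmodular fun S => f (S ∩ A) := by
  intro S T
  have := hf (S ∩ A) (T ∩ A)
  rwa [← Finset.union_inter_distrib_right, ← Finset.inter_inter_distrib_right] at this

/-- A first-order lower bound with quadratic error that needs no submodularity: `le_multilinearExt`
is applied to `T ↦ f (S ∪ T)` for each fixed `S`. The loss is `s` times the sum of the singleton
terms, which is at most `s * B`. -/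
lemma le_multilinearExt_psum {f : Finset (Fin n) → ℝ} {B : ℝ} (h0 : ∀ S, 0 ≤ f S)
    (hB : ∀ S, f S ≤ B) {x y : Fin n → ℝ} (hx : x ∈ Set.Icc (0 : Fin n → ℝ) 1)
    (hy : y ∈ Set.Icc (0 : Fin n → ℝ) 1) :
    multilinearExt f x + ∑ v, y v * ((1 - x v) * partialD f v x) - (∑ v, y v) ^ 2 * B ≤
      multilinearExt f (psum x y) := by
  rw [← multilinearExt_const ((∑ v, y v) ^ 2 * B) x]
  simp only [← multilinearExt_marginal, ← multilinearExt_mul, ← multilinearExt_sum,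
    ← multilinearExt_add, ← multilinearExt_sub, multilinearExt_psum]
  refine multilinearExt_mono (fun S => ?_) hx
  refine le_trans ?_ (le_multilinearExt (fun T => h0 (S ∪ T)) hy)
  set s := ∑ v, y v with hs
  have e : ∀ v, S ∪ {v} = insert v S := fun v => by rw [Finset.insert_eq, Finset.union_comm]
  simp only [Finset.union_empty, e, mul_sub, Finset.sum_sub_distrib, ← Finset.sum_mul, ← hs]
  have h1 : ∑ v, y v * f (insert v S) ≤ s * B := by
    rw [hs, Finset.sum_mul]
    exact Finset.sum_le_sum fun v _ => mul_le_mul_of_nonneg_left (hB _) (hy.1 v)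
  have h2 : 0 ≤ s := Finset.sum_nonneg fun v _ => hy.1 v
  nlinarith [mul_le_mul_of_nonneg_left h1 h2]

/-- Walk from `a` to `b` one coordinate at a time; each increment is exactly a partial derivative at
an intermediate point, hence lies between those at `b` and at `a`. -/
lemma IsSubmodular.slope_bounds {f : Finset (Fin n) → ℝ} (hf : IsSubmodular f)
    {a b : Fin n → ℝ} (ha : a ∈ Set.Icc (0 : Fin n → ℝ) 1) (hb : b ∈ Set.Icc (0 : Fin n → ℝ) 1)
    (h : a ≤ b) :
    ∑ u, (b u - a u) * partialD f u b ≤ multilinearExt f b - multilinearExt f a ∧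
      multilinearExt f b - multilinearExt f a ≤ ∑ u, (b u - a u) * partialD f u a := by
  have key : ∀ A : Finset (Fin n),
      ∑ u ∈ A, (b u - a u) * partialD f u b ≤
        multilinearExt f (fun u => if u ∈ A then b u else a u) - multilinearExt f a ∧
      multilinearExt f (fun u => if u ∈ A then b u else a u) - multilinearExt f a ≤
        ∑ u ∈ A, (b u - a u) * partialD f u a := by
    intro A
    induction A using Finset.induction_on with
    | empty => simp
    | insert v A hv ih =>
      set p : Fin n → ℝ := fun u => if u ∈ A then b u else a u with hp
      have hap : a ≤ p := fun u => by simp only [hp]; split_ifs; exacts [h u, le_rfl]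
      have hpb : p ≤ b := fun u => by simp only [hp]; split_ifs; exacts [le_rfl, h u]
      have hpm : p ∈ Set.Icc (0 : Fin n → ℝ) 1 := ⟨ha.1.trans hap, hpb.trans hb.2⟩
      have e1 : (fun u => if u ∈ insert v A then b u else a u) = Function.update p v (b v) := by
        funext u
        by_cases hu : u = v
        · subst hu; simp
        · simp [hu, hp]
      have e2 : p v = a v := by simp [hp, hv]
      rw [e1, multilinearExt_update, Finset.sum_insert hv, Finset.sum_insert hv, e2]
      have h1 := mul_le_mul_of_nonneg_left (hf.partialD_antitone v ha hpm hap)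
        (sub_nonneg.2 (h v))
      have h2 := mul_le_mul_of_nonneg_left (hf.partialD_antitone v hpm hb hpb)
        (sub_nonneg.2 (h v))
      constructor <;> linarith [ih.1, ih.2]
  simpa using key Finset.univ

/-- Concavity along a nonnegative direction: `psum (κ • x) z` divides the segment from `z` to `psum
x z` in the ratio `κ : 1 - κ`, and the value at the far end is nonnegative. Both slopes are compared
with the derivatives at the dividing point. -/
lemma IsSubmodular.le_multilinearExt_psum {f : Finset (Fin n) → ℝ} (hf : IsSubmodular f)
    (h0 : ∀ S, 0 ≤ f S) {κ : ℝ} (hκ0 : 0 ≤ κ) (hκ1 : κ ≤ 1) {x z : Fin n → ℝ}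
    (hx : x ∈ Set.Icc (0 : Fin n → ℝ) 1) (hz : z ∈ Set.Icc (0 : Fin n → ℝ) 1) :
    (1 - κ) * multilinearExt f z ≤ multilinearExt f (psum (κ • x) z) := by
  have hκx : κ • x ∈ Set.Icc (0 : Fin n → ℝ) 1 :=
    ⟨fun u => mul_nonneg hκ0 (hx.1 u), fun u => mul_le_one₀ hκ1 (hx.1 u) (hx.2 u)⟩
  have hm := psum_mem hκx hz
  have hb := psum_mem hx hz
  have h1 : z ≤ psum (κ • x) z := fun u => by
    have := mul_nonneg (hκx.1 u) (sub_nonneg.2 (hz.2 u))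
    simp only [psum, Pi.one_apply, Pi.smul_apply, smul_eq_mul] at *
    linarith
  have h2 : psum (κ • x) z ≤ psum x z := fun u => by
    have := mul_nonneg (mul_nonneg (sub_nonneg.2 hκ1) (hx.1 u)) (sub_nonneg.2 (hz.2 u))
    simp only [psum, Pi.one_apply, Pi.smul_apply, smul_eq_mul] at *
    linarith
  have h3 := (hf.slope_bounds hz hm h1).1
  have h4 := (hf.slope_bounds hm hb h2).2
  have e3 : ∑ u, (psum (κ • x) z u - z u) * partialD f u (psum (κ • x) z) =
      κ * ∑ u, x u * (1 - z u) * partialD f u (psum (κ • x) z) := by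
    rw [Finset.mul_sum]
    refine Finset.sum_congr rfl fun u _ => ?_
    simp only [psum, Pi.smul_apply, smul_eq_mul]
    ring
  have e4 : ∑ u, (psum x z u - psum (κ • x) z u) * partialD f u (psum (κ • x) z) =
      (1 - κ) * ∑ u, x u * (1 - z u) * partialD f u (psum (κ • x) z) := by
    rw [Finset.mul_sum]
    refine Finset.sum_congr rfl fun u _ => ?_
    simp only [psum, Pi.smul_apply, smul_eq_mul]
    ring
  rw [e3] at h3
  rw [e4] at h4
  have h5 := multilinearExt_nonneg h0 hb
  have h6 := mul_le_mul_of_nonneg_left h3 (sub_nonneg.2 hκ1)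
  have h7 := mul_le_mul_of_nonneg_left h4 hκ0
  have h8 := mul_nonneg hκ0 h5
  linarith

/-- `le_multilinearExt_psum` with the relative increments `(b - a) / (1 - a)`. Where `a u = 1` the
hypothesis forces `b u = a u`, so the zero quotient is harmless. -/
lemma le_multilinearExt_of_le {f : Finset (Fin n) → ℝ} {B : ℝ} (h0 : ∀ S, 0 ≤ f S)
    (hB : ∀ S, f S ≤ B) {a b : Fin n → ℝ} {τ : ℝ} (hτ0 : 0 ≤ τ) (hτ1 : τ ≤ 1)
    (ha : a ∈ Set.Icc (0 : Fin n → ℝ) 1) (hab : a ≤ b)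
    (hτ : ∀ u, b u - a u ≤ τ * (1 - a u)) :
    multilinearExt f a + ∑ u, (b u - a u) * partialD f u a - (n * τ) ^ 2 * B ≤
      multilinearExt f b := by
  have hd : ∀ u, (b u - a u) / (1 - a u) ≤ τ := fun u => by
    rcases (sub_nonneg.2 (ha.2 u)).eq_or_lt with h | h
    · simp only [Pi.one_apply] at h; rw [← h]; simpa using hτ0
    · exact (div_le_iff₀ h).2 (hτ u)
  have hd0 : ∀ u, 0 ≤ (b u - a u) / (1 - a u) := fun u =>
    div_nonneg (sub_nonneg.2 (hab u)) (sub_nonneg.2 (ha.2 u))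
  have hmul : ∀ u, (b u - a u) / (1 - a u) * (1 - a u) = b u - a u := fun u => by
    rcases (sub_nonneg.2 (ha.2 u)).eq_or_lt with h | h
    · simp only [Pi.one_apply] at h
      have h1 := hτ u
      have h2 := hab u
      rw [← h] at h1 ⊢
      linarith
    · exact div_mul_cancel₀ _ h.ne'
  have h1 := le_multilinearExt_psum h0 hB ha
    (y := fun u => (b u - a u) / (1 - a u)) ⟨hd0, fun u => (hd u).trans hτ1⟩
  have e : psum a (fun u => (b u - a u) / (1 - a u)) = b := by
    funext u
    simp only [psum]
    have := hmul u
    linarith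
  rw [e] at h1
  simp only [← mul_assoc, hmul] at h1
  have h2 : ∑ v, (b v - a v) / (1 - a v) ≤ n * τ := by
    refine (Finset.sum_le_card_nsmul _ _ τ fun v _ => hd v).trans_eq ?_
    simp
  have h3 := pow_le_pow_left₀ (Finset.sum_nonneg fun v _ => hd0 v) h2 2
  have h4 := mul_le_mul_of_nonneg_right h3 ((h0 ∅).trans (hB ∅))
  linarith

/-! ### The guided growth step -/

/-- A bound on the increase of the multilinear extension from the direction `z`, at the point
`κ • x` and with the coordinate `u` damped by `1 - x u`. -/
def slack (f : Finset (Fin n) → ℝ) (κ : ℝ) (z x : Fin n → ℝ) : ℝ :=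
  ∑ u, z u * ((1 - x u) * max 0 (partialD f u (κ • x)))

lemma smul_mem_cube {κ : ℝ} (hκ0 : 0 ≤ κ) (hκ1 : κ ≤ 1) {x : Fin n → ℝ}
    (hx : x ∈ Set.Icc (0 : Fin n → ℝ) 1) : κ • x ∈ Set.Icc (0 : Fin n → ℝ) 1 :=
  ⟨fun u => mul_nonneg hκ0 (hx.1 u), fun u => mul_le_one₀ hκ1 (hx.1 u) (hx.2 u)⟩

/-- Both factors decrease as `x` grows. Hence every earlier gain of the growth phase is at least the
gain measured with the final slack, the only one needed afterwards. -/
lemma slack_antitone {f : Finset (Fin n) → ℝ} (hf : IsSubmodular f) {κ : ℝ} (hκ0 : 0 ≤ κ)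
    (hκ1 : κ ≤ 1) {x x' z : Fin n → ℝ} (hz : 0 ≤ z) (hx : x ∈ Set.Icc (0 : Fin n → ℝ) 1)
    (hx' : x' ∈ Set.Icc (0 : Fin n → ℝ) 1) (h : x ≤ x') : slack f κ z x' ≤ slack f κ z x := by
  refine Finset.sum_le_sum fun u _ => mul_le_mul_of_nonneg_left ?_ (hz u)
  refine mul_le_mul (sub_le_sub_left (h u) 1) (max_le_max le_rfl ?_) (le_max_left _ _)
    (sub_nonneg.2 (hx.2 u))
  exact hf.partialD_antitone u (smul_mem_cube hκ0 hκ1 hx) (smul_mem_cube hκ0 hκ1 hx')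
    fun v => mul_le_mul_of_nonneg_left (h v) hκ0

/-- One step of the guided growth: every coordinate moves towards `1`. -/
def grow (τ : ℝ) (x y : Fin n → ℝ) : Fin n → ℝ := fun u => x u + τ * y u * (1 - x u)

lemma grow_mem {τ : ℝ} (hτ0 : 0 ≤ τ) (hτ1 : τ ≤ 1) {x y : Fin n → ℝ}
    (hx : x ∈ Set.Icc (0 : Fin n → ℝ) 1) (hy : y ∈ Set.Icc (0 : Fin n → ℝ) 1) :
    grow τ x y ∈ Set.Icc (0 : Fin n → ℝ) 1 ∧ x ≤ grow τ x y := by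
  have h0 : ∀ u, 0 ≤ τ * y u := fun u => mul_nonneg hτ0 (hy.1 u)
  have h1 : ∀ u, τ * y u ≤ 1 := fun u => mul_le_one₀ hτ1 (hy.1 u) (hy.2 u)
  have h2 : ∀ u, 0 ≤ 1 - x u := fun u => sub_nonneg.2 (hx.2 u)
  have h3 : x ≤ grow τ x y := fun u => by
    have := mul_nonneg (h0 u) (h2 u)
    simp only [grow]; linarith
  refine ⟨⟨hx.1.trans h3, fun u => ?_⟩, h3⟩
  have := mul_le_mul_of_nonneg_right (h1 u) (h2 u)
  simp only [grow, Pi.one_apply]; linarith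

/-- The oracle's `y` is compared with `z` restricted to coordinates of positive derivative, whose
damped linear value is exactly the slack. The estimates `d` replace the true derivatives twice, once
for `y` and once for this competitor, hence the factor 2 in the error. -/
lemma growth_step {f : Finset (Fin n) → ℝ} {B : ℝ} (h0 : ∀ S, 0 ≤ f S)
    (hB : ∀ S, f S ≤ B) {κ τ : ℝ} (hκ0 : 0 ≤ κ) (hκ1 : κ ≤ 1) (hτ0 : 0 ≤ τ) (hτ1 : τ ≤ 1)
    {x y z d : Fin n → ℝ} (hx : x ∈ Set.Icc (0 : Fin n → ℝ) 1)
    (hy : y ∈ Set.Icc (0 : Fin n → ℝ) 1) (hz : z ∈ Set.Icc (0 : Fin n → ℝ) 1)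
    (hopt : ∀ z', 0 ≤ z' → z' ≤ z →
      ∑ u, (1 - x u) * d u * z' u ≤ ∑ u, (1 - x u) * d u * y u) :
    multilinearExt f (κ • x) + κ * τ * slack f κ z x
        - 2 * (κ * τ) * ∑ u, |d u - partialD f u (κ • x)| - (n * (κ * τ)) ^ 2 * B ≤
      multilinearExt f (κ • grow τ x y) := by
  have hκτ : 0 ≤ κ * τ := mul_nonneg hκ0 hτ0
  obtain ⟨hg, hxg⟩ := grow_mem hτ0 hτ1 hx hy
  have h1 := le_multilinearExt_of_le h0 hB (a := κ • x) (b := κ • grow τ x y) hκτ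
    (mul_le_one₀ hκ1 hτ0 hτ1) (smul_mem_cube hκ0 hκ1 hx)
    (fun u => mul_le_mul_of_nonneg_left (hxg u) hκ0) (fun u => by
      have h1 : 0 ≤ 1 - x u := sub_nonneg.2 (hx.2 u)
      have h2 : κ * x u ≤ x u := mul_le_of_le_one_left (hx.1 u) hκ1
      have h3 := mul_le_mul_of_nonneg_left (mul_le_mul (hy.2 u)
        (show 1 - x u ≤ 1 - κ * x u by linarith) h1 zero_le_one) hκτ
      simp only [grow, Pi.smul_apply, smul_eq_mul, Pi.one_apply] at *
      linarith)
  set D := fun u => partialD f u (κ • x) with hD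
  have e1 : ∑ u, ((κ • grow τ x y) u - (κ • x) u) * partialD f u (κ • x) =
      κ * τ * ∑ u, (1 - x u) * D u * y u := by
    rw [Finset.mul_sum]
    refine Finset.sum_congr rfl fun u _ => ?_
    simp only [grow, Pi.smul_apply, smul_eq_mul, hD]
    ring
  have habs : ∀ w : Fin n → ℝ, w ∈ Set.Icc (0 : Fin n → ℝ) 1 →
      |∑ u, (1 - x u) * d u * w u - ∑ u, (1 - x u) * D u * w u| ≤ ∑ u, |d u - D u| := by
    intro w hw
    rw [← Finset.sum_sub_distrib]
    refine (Finset.abs_sum_le_sum_abs _ _).trans (Finset.sum_le_sum fun u _ => ?_)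
    have e : (1 - x u) * d u * w u - (1 - x u) * D u * w u =
      ((1 - x u) * w u) * (d u - D u) := by ring
    have h1 : 0 ≤ (1 - x u) * w u := mul_nonneg (sub_nonneg.2 (hx.2 u)) (hw.1 u)
    have h2 : (1 - x u) * w u ≤ 1 :=
      mul_le_one₀ (sub_le_self _ (hx.1 u)) (hw.1 u) (hw.2 u)
    rw [e, abs_mul, abs_of_nonneg h1]
    exact mul_le_of_le_one_left (abs_nonneg _) h2
  -- Truncation is legitimate because `hopt` covers everything below `z`; this is where
  -- down-closedness of `P` will enter.
  have h2 := hopt (fun u => if 0 < D u then z u else 0)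
    (fun u => by dsimp only; split_ifs; exacts [hz.1 u, le_rfl])
    (fun u => by dsimp only; split_ifs; exacts [le_rfl, hz.1 u])
  have h3 := habs (fun u => if 0 < D u then z u else 0)
    ⟨fun u => by dsimp only; split_ifs; exacts [hz.1 u, le_rfl],
      fun u => by dsimp only; split_ifs; exacts [hz.2 u, zero_le_one]⟩
  have h4 := habs y hy
  have e2 : slack f κ z x = ∑ u, (1 - x u) * D u * (if 0 < D u then z u else 0) := by
    refine Finset.sum_congr rfl fun u _ => ?_
    by_cases h : 0 < D u
    · rw [if_pos h, max_eq_right h.le]; ring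
    · rw [if_neg h, max_eq_left (not_lt.1 h)]; ring
  rw [e1] at h1
  rw [abs_le] at h3 h4
  have h5 : slack f κ z x - 2 * ∑ u, |d u - D u| ≤ ∑ u, (1 - x u) * D u * y u := by
    rw [e2]; linarith [h3.1, h4.2]
  have h6 := mul_le_mul_of_nonneg_left h5 hκτ
  linarith

/-- From `o` to `psum (κ • x) z` the coordinate `u` rises by exactly `z u * (1 - x u)`, and
derivatives at `o` are at most those at `κ • x`, so this rise gains no more than the slack. The
value at the upper end is bounded by `IsSubmodular.le_multilinearExt_psum`. -/
lemma slack_bound {f : Finset (Fin n) → ℝ} (hf : IsSubmodular f) (h0 : ∀ S, 0 ≤ f S)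
    {κ : ℝ} (hκ0 : 0 ≤ κ) (hκ1 : κ ≤ 1) {x z : Fin n → ℝ}
    (hx : x ∈ Set.Icc (0 : Fin n → ℝ) 1) (hz : z ∈ Set.Icc (0 : Fin n → ℝ) 1) :
    (1 - κ) * multilinearExt f z - slack f κ z x ≤
      multilinearExt f (fun u => κ * x u + z u * (x u - κ * x u)) := by
  have hκx := smul_mem_cube hκ0 hκ1 hx
  set o : Fin n → ℝ := fun u => κ * x u + z u * (x u - κ * x u) with ho
  have hle : ∀ u, κ * x u ≤ x u := fun u => mul_le_of_le_one_left (hx.1 u) hκ1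
  have h1 : κ • x ≤ o := fun u => by
    have := mul_nonneg (hz.1 u) (sub_nonneg.2 (hle u))
    simp only [ho, Pi.smul_apply, smul_eq_mul] at *
    linarith
  have h2 : o ≤ psum (κ • x) z := fun u => by
    have := mul_nonneg (hz.1 u) (sub_nonneg.2 (hx.2 u))
    simp only [ho, psum, Pi.smul_apply, smul_eq_mul, Pi.one_apply] at *
    linarith
  have hp := psum_mem hκx hz
  have hom : o ∈ Set.Icc (0 : Fin n → ℝ) 1 := ⟨hκx.1.trans h1, h2.trans hp.2⟩
  have h3 := (hf.slope_bounds hom hp h2).2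
  have h4 := hf.le_multilinearExt_psum h0 hκ0 hκ1 hx hz
  have h5 : ∑ u, (psum (κ • x) z u - o u) * partialD f u o ≤ slack f κ z x := by
    refine Finset.sum_le_sum fun u _ => ?_
    have e : psum (κ • x) z u - o u = z u * (1 - x u) := by
      simp only [ho, psum, Pi.smul_apply, smul_eq_mul]; ring
    rw [e, mul_assoc]
    refine mul_le_mul_of_nonneg_left (mul_le_mul_of_nonneg_left ?_ (sub_nonneg.2 (hx.2 u)))
      (hz.1 u)
    exact (hf.partialD_antitone u hκx hom h1).trans (le_max_right _ _)
  linarith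

/-! ### The fractional double greedy step -/

/-- The fraction chosen by the double greedy algorithm when the derivatives at the lower and the
upper solution are `a` and `c`. -/
def ratio (a c : ℝ) : ℝ := if a ≤ 0 then 0 else if 0 ≤ c then 1 else a / (a - c)

lemma ratio_mem (a c : ℝ) : 0 ≤ ratio a c ∧ ratio a c ≤ 1 := by
  unfold ratio
  split_ifs with h1 h2
  · simp
  · simp
  · push Not at h1 h2
    exact ⟨div_nonneg h1.le (by linarith), div_le_one_of_le₀ (by linarith) (by linarith)⟩

/-- In the main case this is `2 a (-c) ≤ a ^ 2 + c ^ 2`. The term with `max` is for estimated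
derivatives: exact ones satisfy `c ≤ a` by submodularity, noisy ones need not. -/
lemma ratio_bound (a c : ℝ) {l : ℝ} (hl0 : 0 ≤ l) (hl1 : l ≤ 1) :
    2 * (ratio a c * (1 - l) * (-c) + (1 - ratio a c) * l * a) ≤
      ratio a c * a + (1 - ratio a c) * (-c) + 2 * max 0 (c - a) := by
  have hm0 := le_max_left 0 (c - a)
  have hm1 := le_max_right 0 (c - a)
  unfold ratio
  split_ifs with h1 h2
  · have := mul_nonneg hl0 (neg_nonneg.2 h1)
    linarith
  · have := mul_nonneg (sub_nonneg.2 hl1) h2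
    push Not at h1
    linarith
  · push Not at h1 h2
    have hp : 0 < a - c := by linarith
    have e1 : 2 * (a / (a - c) * (1 - l) * (-c) + (1 - a / (a - c)) * l * a) =
        2 * (a * (-c)) / (a - c) := by field_simp; ring
    have e2 : a / (a - c) * a + (1 - a / (a - c)) * (-c) = (a ^ 2 + c ^ 2) / (a - c) := by
      field_simp; ring
    rw [e1, e2]
    have : 2 * (a * (-c)) / (a - c) ≤ (a ^ 2 + c ^ 2) / (a - c) :=
      div_le_div_of_nonneg_right (by nlinarith [sq_nonneg (a + c)]) hp.le
    linarith

/-- The derivative `D` at the intermediate point is known only to lie in `[c, a]`. Each of the two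
signed parts of `l - ratio` is bounded with the worse endpoint, and then the exact derivatives are
traded for the estimates `a'`, `c'`. -/
lemma ratio_loss {a c a' c' D l : ℝ} (hl0 : 0 ≤ l) (hl1 : l ≤ 1) (h1 : c ≤ D) (h2 : D ≤ a) :
    (l - ratio a' c') * D ≤ 1 / 2 * (ratio a' c' * a - (1 - ratio a' c') * c) +
      3 * (|a' - a| + |c' - c|) := by
  obtain ⟨hq0, hq1⟩ := ratio_mem a' c'
  have hb := ratio_bound a' c' hl0 hl1
  set q := ratio a' c'
  have ha := abs_nonneg (a' - a)
  have hc := abs_nonneg (c' - c)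
  have hmax : max 0 (c' - a') ≤ |a' - a| + |c' - c| :=
    max_le (by linarith) (by linarith [neg_abs_le (a' - a), le_abs_self (c' - c)])
  have hA : |a - a'| = |a' - a| := abs_sub_comm _ _
  have hC : |c - c'| = |c' - c| := abs_sub_comm _ _
  have lin : ∀ r e : ℝ, 0 ≤ r → r ≤ 1 → r * e ≤ |e| := fun r e h0 h1 =>
    (mul_le_mul_of_nonneg_left (le_abs_self e) h0).trans (mul_le_of_le_one_left (abs_nonneg e) h1)
  have t1 := mul_le_mul_of_nonneg_left h2 (mul_nonneg (sub_nonneg.2 hq1) hl0)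
  have t2 := mul_le_mul_of_nonneg_left h1 (mul_nonneg hq0 (sub_nonneg.2 hl1))
  have m1 := lin ((1 - q) * l) (a - a') (mul_nonneg (sub_nonneg.2 hq1) hl0)
    (mul_le_one₀ (by linarith) hl0 hl1)
  have m2 := lin (q * (1 - l)) (c' - c) (mul_nonneg hq0 (sub_nonneg.2 hl1))
    (mul_le_one₀ hq1 (by linarith) (by linarith))
  have m3 := lin q (a' - a) hq0 hq1
  have m4 := lin (1 - q) (c - c') (by linarith) (by linarith)
  rw [hA] at m1
  rw [hC] at m4
  linarith

/-- All three points receive the same new coordinate `v`, so each change of value is linear with the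
common factor `Y u - X u`. The loss at `o` is paid by half the gains at `X` and `Y`, which is
`ratio_loss`. -/
lemma double_greedy_step {f : Finset (Fin n) → ℝ} (hf : IsSubmodular f) {X Y o : Fin n → ℝ}
    (hX : X ∈ Set.Icc (0 : Fin n → ℝ) 1) (hY : Y ∈ Set.Icc (0 : Fin n → ℝ) 1) (hXo : X ≤ o)
    (hoY : o ≤ Y) (u : Fin n) {l : ℝ} (hl0 : 0 ≤ l) (hl1 : l ≤ 1)
    (ho : o u = X u + l * (Y u - X u)) (a' c' : ℝ) {v : ℝ}
    (hv : v = X u + ratio a' c' * (Y u - X u)) :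
    multilinearExt f o + 1 / 2 * multilinearExt f X + 1 / 2 * multilinearExt f Y
        - 3 * (|a' - partialD f u X| + |c' - partialD f u Y|) ≤
      multilinearExt f (Function.update o u v) + 1 / 2 * multilinearExt f (Function.update X u v)
        + 1 / 2 * multilinearExt f (Function.update Y u v) := by
  have hom : o ∈ Set.Icc (0 : Fin n → ℝ) 1 := ⟨hX.1.trans hXo, hoY.trans hY.2⟩
  have h1 := hf.partialD_antitone u hom hY hoY
  have h2 := hf.partialD_antitone u hX hom hXo
  have h3 := ratio_loss (a' := a') (c' := c') hl0 hl1 h1 h2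
  have hs0 : 0 ≤ Y u - X u := sub_nonneg.2 ((hXo.trans hoY) u)
  have hs1 : Y u - X u ≤ 1 := by
    have := hX.1 u; have := hY.2 u
    simp only [Pi.zero_apply, Pi.one_apply] at *
    linarith
  have h4 := mul_le_mul_of_nonneg_left h3 hs0
  have h5 : (Y u - X u) * (3 * (|a' - partialD f u X| + |c' - partialD f u Y|)) ≤
      3 * (|a' - partialD f u X| + |c' - partialD f u Y|) :=
    mul_le_of_le_one_left (by positivity) hs1
  simp only [multilinearExt_update, ho, hv]
  linarith

/-! ### The surrogate function -/

/-- The expectation of `f (S ∩ K)`, where `K` is `L` together with at most one more element, which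
is `v` with probability `q v`. -/
def surrogate (f : Finset (Fin n) → ℝ) (L : Finset (Fin n)) (q : Fin n → ℝ)
    (S : Finset (Fin n)) : ℝ :=
  (1 - ∑ v, q v) * f (S ∩ L) + ∑ v, q v * f (S ∩ insert v L)

section Surrogate

variable {f : Finset (Fin n) → ℝ} {L : Finset (Fin n)} {q : Fin n → ℝ}

lemma surrogate_nonneg (h0 : ∀ S, 0 ≤ f S) (hq : ∀ v, 0 ≤ q v) (hs : ∑ v, q v ≤ 1)
    (S : Finset (Fin n)) : 0 ≤ surrogate f L q S :=
  add_nonneg (mul_nonneg (sub_nonneg.2 hs) (h0 _))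
    (Finset.sum_nonneg fun v _ => mul_nonneg (hq v) (h0 _))

lemma surrogate_submodular (hf : IsSubmodular f) (hq : ∀ v, 0 ≤ q v) (hs : ∑ v, q v ≤ 1) :
    IsSubmodular (surrogate f L q) := by
  intro S T
  have h1 := mul_le_mul_of_nonneg_left (hf.comp_inter L S T) (sub_nonneg.2 hs)
  have h2 : ∑ v, q v * (f ((S ∪ T) ∩ insert v L) + f ((S ∩ T) ∩ insert v L)) ≤
      ∑ v, q v * (f (S ∩ insert v L) + f (T ∩ insert v L)) :=
    Finset.sum_le_sum fun v _ =>
      mul_le_mul_of_nonneg_left (hf.comp_inter (insert v L) S T) (hq v)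
  simp only [mul_add, Finset.sum_add_distrib] at h1 h2
  simp only [surrogate]
  linarith

/-- The form that the program evaluates: one query at `S ∩ L` and one for each further element. -/
lemma surrogate_eq (f : Finset (Fin n) → ℝ) (L : Finset (Fin n)) (q : Fin n → ℝ)
    (S : Finset (Fin n)) :
    surrogate f L q S =
      f (S ∩ L) + ∑ v, ind S v * q v * (f (insert v (S ∩ L)) - f (S ∩ L)) := by
  have : ∀ v, ind S v * q v * (f (insert v (S ∩ L)) - f (S ∩ L)) =
      q v * f (S ∩ insert v L) - q v * f (S ∩ L) := by
    intro v
    by_cases hv : v ∈ S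
    · rw [Finset.inter_insert_of_mem hv]; simp [ind, hv]; ring
    · rw [Finset.inter_insert_of_notMem hv]; simp [ind, hv]
  simp only [this, Finset.sum_sub_distrib, ← Finset.sum_mul, surrogate]
  ring

/-- Let `D` be the random set with marginals `q`. The lower bound keeps the outcomes with at most
one element (`le_multilinearExt`); the upper bound is subadditivity of marginals of `D ↦ f (S ∩ (L ∪
D))` at the empty set. -/
lemma multilinearExt_surrogate_bounds (hf : IsSubmodular f) (h0 : ∀ S, 0 ≤ f S)
    (hq : q ∈ Set.Icc (0 : Fin n → ℝ) 1) (hs : ∑ v, q v ≤ 1) {x : Fin n → ℝ}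
    (hx : x ∈ Set.Icc (0 : Fin n → ℝ) 1) :
    (1 - ∑ v, q v) * multilinearExt (surrogate f L q) x ≤
        multilinearExt f (x * psum (ind L) q) ∧
      multilinearExt f (x * psum (ind L) q) ≤ multilinearExt (surrogate f L q) x := by
  have e : multilinearExt f (x * psum (ind L) q) =
      multilinearExt (fun S => multilinearExt (fun D => f (S ∩ (L ∪ D))) q) x := by
    rw [multilinearExt_inter]
    congr 1
    funext S
    rw [multilinearExt_psum, multilinearExt_ind]
  have e2 : ∀ v, L ∪ {v} = insert v L := fun v => by rw [Finset.insert_eq, Finset.union_comm]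
  rw [e]
  constructor
  · rw [← multilinearExt_mul]
    refine multilinearExt_mono (fun S => ?_) hx
    refine le_trans ?_ (le_multilinearExt (fun D => h0 _) hq)
    simp only [Finset.union_empty, e2]
    refine mul_le_mul_of_nonneg_left ?_ (sub_nonneg.2 hs)
    rw [surrogate]
    have := mul_nonneg (Finset.sum_nonneg fun v (_ : v ∈ Finset.univ) => hq.1 v) (h0 (S ∩ L))
    linarith
  · refine multilinearExt_mono (fun S => ?_) hx
    have hsub : IsSubmodular fun D => f (S ∩ (L ∪ D)) := by
      intro A D
      have h := hf (S ∩ (L ∪ A)) (S ∩ (L ∪ D))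
      rwa [← Finset.inter_union_distrib_left, ← Finset.inter_inter_distrib_left,
        ← Finset.union_union_distrib_left, ← Finset.union_inter_distrib_left] at h
    refine (hsub.multilinearExt_le hq).trans_eq ?_
    simp only [Finset.union_empty, e2, surrogate, mul_sub, Finset.sum_sub_distrib,
      ← Finset.sum_mul]
    ring

/-- By submodularity it suffices to bound the surrogate at the empty set and at singletons. The
singleton `{u}` is reached through a point on the `u`-axis at height `t ≥ t₀`, where the value is at
most `M`; the factor 2 comes from `∑ q ≤ 1 / 2`. -/
lemma surrogate_le (hf : IsSubmodular f) (h0 : ∀ S, 0 ≤ f S)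
    (hq : q ∈ Set.Icc (0 : Fin n → ℝ) 1) (hs : ∑ v, q v ≤ 1 / 2) {M t₀ : ℝ} (ht₀ : 0 < t₀)
    (ht₁ : t₀ ≤ 1) (hM : multilinearExt f 0 ≤ M)
    (hMu : ∀ u, ∃ t, t₀ ≤ t ∧ t ≤ 1 ∧
      multilinearExt f (Function.update (0 : Fin n → ℝ) u t * psum (ind L) q) ≤ M) (S : Finset (Fin n)) :
    surrogate f L q S ≤ (n + 1) * (2 * M / t₀) := by
  have hs1 : ∑ v, q v ≤ 1 := hs.trans (by norm_num)
  set h := surrogate f L q with hh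
  have hn : ∀ S, 0 ≤ h S := surrogate_nonneg h0 hq.1 hs1
  have hH : ∀ x ∈ Set.Icc (0 : Fin n → ℝ) 1, multilinearExt f (x * psum (ind L) q) ≤ M →
      multilinearExt h x ≤ 2 * M := by
    intro x hx hxM
    have h1 := (multilinearExt_surrogate_bounds (L := L) hf h0 hq hs1 hx).1
    have h2 := multilinearExt_nonneg hn hx
    have h3 := mul_le_mul_of_nonneg_right (show 1 / 2 ≤ 1 - ∑ v, q v by linarith) h2
    linarith
  have e0 : ind (∅ : Finset (Fin n)) = 0 := by funext u; simp [ind]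
  have hM0 : 0 ≤ M := (multilinearExt_nonneg h0 (x := 0) ⟨le_rfl, fun _ => zero_le_one⟩).trans hM
  have hle : 2 * M ≤ 2 * M / t₀ := le_div_self (by linarith) ht₀ ht₁
  have hempty : h ∅ ≤ 2 * M / t₀ := by
    rw [← multilinearExt_ind h ∅]
    exact (hH _ (ind_mem _) (by rwa [e0, zero_mul])).trans hle
  have hsing : ∀ u, h {u} ≤ 2 * M / t₀ := by
    intro u
    obtain ⟨t, ht, ht', htM⟩ := hMu u
    have hcube : Function.update (0 : Fin n → ℝ) u t ∈ Set.Icc (0 : Fin n → ℝ) 1 := by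
      constructor <;> intro v <;> by_cases hv : v = u
      · subst hv; simpa using ht₀.le.trans ht
      · simp [hv]
      · subst hv; simpa using ht'
      · simp [hv]
    have h1 := hH _ hcube htM
    -- On the axis the value is `(1 - t) * h ∅ + t * h {u}`, so dropping the first term and dividing
    -- by `t₀` bounds `h {u}`.
    rw [coordAffine_multilinearExt h, ← e0, update_ind_zero, update_ind_one, multilinearExt_ind,
      multilinearExt_ind] at h1
    have e1 : (∅ : Finset (Fin n)).erase u = ∅ := by simp
    have e2 : insert u (∅ : Finset (Fin n)) = {u} := by simp
    rw [e1, e2] at h1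
    have h2 := mul_nonneg (sub_nonneg.2 ht') (hn ∅)
    have h3 := mul_le_mul_of_nonneg_right ht (hn {u})
    rw [le_div_iff₀ ht₀]
    linarith
  have h1 := (surrogate_submodular (L := L) hf hq.1 hs1).le_sum S
  have h2 : ∑ v ∈ S, (h {v} - h ∅) ≤ n * (2 * M / t₀) := by
    calc ∑ v ∈ S, (h {v} - h ∅) ≤ ∑ v ∈ S, 2 * M / t₀ :=
          Finset.sum_le_sum fun v _ => by linarith [hsing v, hn ∅]
      _ ≤ ∑ v : Fin n, 2 * M / t₀ :=
          Finset.sum_le_sum_of_subset_of_nonneg (Finset.subset_univ _) fun _ _ _ => by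
            linarith [hn ∅]
      _ = n * (2 * M / t₀) := by simp
  linarith

end Surrogate

end Multilinear

/-! ### Memory access -/

namespace Config

variable {n : ℕ} (s : Config)

lemma reg_setReg (i j v : ℕ) : (s.setReg i v).reg j = if j = i then v else s.reg j := by
  by_cases h : j = i
  · subst h; simp [setReg]
  · simp [setReg, h]

@[simp] lemma cell_setReg (i v : ℕ) : (s.setReg i v).cell = s.cell := rfl

@[simp] lemma reg_setCell (r c : ℕ) (v : ℝ) : (s.setCell r c v).reg = s.reg := rfl

@[simp] lemma reg_setVec (r : ℕ) (v : Fin n → ℝ) : (s.setVec r v).reg = s.reg := rfl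

lemma cell_setCell (r c r' c' : ℕ) (v : ℝ) :
    (s.setCell r c v).cell r' c' = if r' = r ∧ c' = c then v else s.cell r' c' := by
  by_cases h : r' = r
  · subst h
    by_cases h' : c' = c
    · subst h'; simp [setCell]
    · simp [setCell, h']
  · simp [setCell, h]

lemma row_setCell_of_ne {r r' : ℕ} (h : r' ≠ r) (c : ℕ) (v : ℝ) :
    (s.setCell r c v).cell r' = s.cell r' := by
  simp [setCell, h]

lemma row_setVec_of_ne {r r' : ℕ} (h : r' ≠ r) (v : Fin n → ℝ) :
    (s.setVec r v).cell r' = s.cell r' := by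
  simp [setVec, h]

lemma cell_setVec (r : ℕ) (v : Fin n → ℝ) (u : Fin n) : (s.setVec r v).cell r u = v u := by
  simp [setVec]

/-- The first `k` cells of a row are overwritten with the values of `g`, with counter `i`. -/
def fill (i row : ℕ) (g : ℕ → ℝ) (k : ℕ) : Config :=
  { s with
    reg := Function.update s.reg i k
    cell := Function.update s.cell row fun j => if j < k then g j else s.cell row j }

lemma reg_fill (i row : ℕ) (g : ℕ → ℝ) (k j : ℕ) :
    (s.fill i row g k).reg j = if j = i then k else s.reg j := by
  by_cases h : j = i
  · subst h; simp [fill]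
  · simp [fill, h]

lemma row_fill_of_ne {row row' : ℕ} (h : row' ≠ row) (i : ℕ) (g : ℕ → ℝ) (k : ℕ) :
    (s.fill i row g k).cell row' = s.cell row' := by
  simp [fill, h]

lemma cell_fill (i row : ℕ) (g : ℕ → ℝ) (k j : ℕ) :
    (s.fill i row g k).cell row j = if j < k then g j else s.cell row j := by
  simp [fill]

/-- Registers `0`, `1` and the first `m` rows agree. -/
structure Agree (m : ℕ) (s t : Config) : Prop where
  reg0 : t.reg 0 = s.reg 0
  reg1 : t.reg 1 = s.reg 1
  rows : ∀ r < m, t.cell r = s.cell r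

lemma Agree.refl (m : ℕ) (s : Config) : Agree m s s := ⟨rfl, rfl, fun _ _ => rfl⟩

lemma Agree.trans {m : ℕ} {r s t : Config} (h : Agree m r s) (h' : Agree m s t) :
    Agree m r t :=
  ⟨h'.reg0.trans h.reg0, h'.reg1.trans h.reg1, fun i hi => (h'.rows i hi).trans (h.rows i hi)⟩

lemma Agree.mono {m m' : ℕ} {s t : Config} (h : Agree m s t) (hm : m' ≤ m) : Agree m' s t :=
  ⟨h.reg0, h.reg1, fun i hi => h.rows i (hi.trans_le hm)⟩

lemma Agree.setReg {m : ℕ} {s t : Config} (h : Agree m s t) {i : ℕ} (hi : 2 ≤ i) (v : ℕ) :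
    Agree m s (t.setReg i v) :=
  ⟨by rw [reg_setReg, if_neg (by omega), h.reg0], by rw [reg_setReg, if_neg (by omega), h.reg1],
    h.rows⟩

lemma Agree.setCell {m : ℕ} {s t : Config} (h : Agree m s t) {r : ℕ} (hr : m ≤ r) (c : ℕ)
    (v : ℝ) : Agree m s (t.setCell r c v) :=
  ⟨h.reg0, h.reg1, fun i hi => by rw [row_setCell_of_ne _ (by omega), h.rows i hi]⟩

lemma Agree.fill {m : ℕ} {s t : Config} (h : Agree m s t) {i row : ℕ} (hi : 2 ≤ i)
    (hr : m ≤ row) (g : ℕ → ℝ) (k : ℕ) : Agree m s (t.fill i row g k) :=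
  ⟨by rw [reg_fill, if_neg (by omega), h.reg0], by rw [reg_fill, if_neg (by omega), h.reg1],
    fun j hj => by rw [row_fill_of_ne _ (by omega), h.rows j hj]⟩

end Config

lemma sum_lt_succ {n k : ℕ} (hk : k < n) (g : Fin n → ℝ) :
    ∑ v : Fin n with v.val < k + 1, g v = (∑ v : Fin n with v.val < k, g v) + g ⟨k, hk⟩ := by
  have : (Finset.univ.filter fun v : Fin n => v.val < k + 1) =
      insert ⟨k, hk⟩ (Finset.univ.filter fun v : Fin n => v.val < k) := by
    ext v
    simp only [Finset.mem_filter, Finset.mem_univ, true_and, Finset.mem_insert, Fin.ext_iff]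
    omega
  rw [this, Finset.sum_insert (by simp), add_comm]

lemma sum_lt_zero {n : ℕ} (g : Fin n → ℝ) : ∑ v : Fin n with v.val < 0, g v = 0 := by simp

lemma sum_lt_self {n : ℕ} (g : Fin n → ℝ) : ∑ v : Fin n with v.val < n, g v = ∑ v, g v := by
  simp

/-! ### Program constructs -/

namespace Cmd

/-- `for i = 0, …, n - 1 do c`, where register `0` holds `n`. -/
def forN (i : ℕ) (c : Cmd) : Cmd :=
  .seq (.setN i (.const 0)) (.loop (.reg 0) (.seq c (.setN i (.add (.reg i) (.const 1)))))

/-- Repeat `(n + 1) ^ j` times. -/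
def rep : ℕ → Cmd → Cmd
  | 0, c => c
  | j + 1, c => .loop (.add (.reg 0) (.const 1)) (rep j c)

/-- Repeat `K * (n + 1) ^ j` times. -/
def repeatN (K j : ℕ) (c : Cmd) : Cmd := .loop (.const K) (rep j c)

lemma Bounded.forN {i : ℕ} (hi : i ≠ 0) {c : Cmd} (h : c.Bounded) : (Cmd.forN i c).Bounded :=
  ⟨hi, rfl, h, hi⟩

lemma Bounded.rep {c : Cmd} (h : c.Bounded) (j : ℕ) : (Cmd.rep j c).Bounded := by
  induction j with
  | zero => exact h
  | succ j ih => exact ⟨⟨rfl, trivial⟩, ih⟩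

lemma Bounded.repeatN {c : Cmd} (h : c.Bounded) (K j : ℕ) : (Cmd.repeatN K j c).Bounded :=
  ⟨trivial, h.rep j⟩

variable {n : ℕ} {f : Finset (Fin n) → ℝ} {lin : (Fin n → ℝ) → (Fin n → ℝ)}

lemma Hoare.affine {c : Cmd} {s : Config} {Q : Config → Prop} {φ : Config → ℝ} {a : ℝ}
    (h : c.Hoare f lin s Q φ a) {α : ℝ} (hα : 0 ≤ α) (β : ℝ) :
    c.Hoare f lin s Q (fun t => α * φ t + β) (α * a + β) := by
  refine ⟨h.1, ?_⟩
  rw [wp_affine]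
  have := mul_le_mul_of_nonneg_left h.2 hα
  linarith

lemma Hoare.forN {i : ℕ} (hi : i ≠ 0) {c : Cmd} {s : Config} (I : ℕ → Config → Prop)
    (Φ : ℕ → Config → ℝ) (η : ℝ) (hs : s.reg 0 = n)
    (hI : ∀ k t v, I k t → I k (t.setReg i v)) (hΦ : ∀ k t v, Φ k (t.setReg i v) = Φ k t)
    (h0 : I 0 s)
    (hstep : ∀ k < n, ∀ t, t.reg 0 = n → t.reg i = k → I k t →
      c.Hoare f lin t (fun t' => t'.reg 0 = n ∧ t'.reg i = k ∧ I (k + 1) t') (Φ (k + 1))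
        (Φ k t - η)) :
    (Cmd.forN i c).Hoare f lin s (fun t => t.reg 0 = n ∧ I n t) (Φ n) (Φ 0 s - n * η) := by
  have e : NExp.eval (s.setReg i 0) (.reg 0) = n := by
    simp [NExp.eval, Config.reg_setReg, hi.symm, hs]
  have h := Hoare.loop (f := f) (lin := lin) (e := .reg 0) (s := s.setReg i 0)
    (c := .seq c (.setN i (.add (.reg i) (.const 1))))
    (fun k t => t.reg 0 = n ∧ t.reg i = k ∧ I k t) Φ η
    ⟨by rw [Config.reg_setReg, if_neg hi.symm, hs], by simp [Config.reg_setReg], hI _ _ _ h0⟩ (by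
      rw [e]
      rintro k hk t ⟨ht0, hti, ht⟩
      refine (hstep k hk t ht0 hti ht).seq ?_
      rintro t' ⟨ht0', hti', ht'⟩
      refine Post.hoare (Q := fun t => t.reg 0 = n ∧ t.reg i = k + 1 ∧ I (k + 1) t ∧
        Φ (k + 1) t = Φ (k + 1) t') ?_ (fun t ht => ht.2.2.2.ge) |>.conseq
          (fun t ht => ⟨ht.1, ht.2.1, ht.2.2.1⟩) (fun _ _ => le_rfl) le_rfl
      simp only [Post, sem]
      refine ⟨by rw [Config.reg_setReg, if_neg hi.symm, ht0'], ?_, hI _ _ _ ht', hΦ _ _ _⟩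
      simp [Config.reg_setReg, NExp.eval, hti'])
  rw [e, hΦ] at h
  exact ⟨h.1.mono fun t ht => ⟨ht.1, ht.2.2⟩, h.2⟩

lemma Post.forN {i : ℕ} (hi : i ≠ 0) {c : Cmd} {s : Config} (I : ℕ → Config → Prop)
    (hs : s.reg 0 = n) (hI : ∀ k t v, I k t → I k (t.setReg i v)) (h0 : I 0 s)
    (hstep : ∀ k < n, ∀ t, t.reg 0 = n → t.reg i = k → I k t →
      c.Post f lin (fun t' => t'.reg 0 = n ∧ t'.reg i = k ∧ I (k + 1) t') t) :
    (Cmd.forN i c).Post f lin (fun t => t.reg 0 = n ∧ I n t) s :=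
  (Hoare.forN hi I (fun _ _ => 0) 0 hs hI (fun _ _ _ => rfl) h0
    fun k hk t h0 hi ht => (hstep k hk t h0 hi ht).hoare (by simp)).1

/-- The final memory is described exactly. The expression is evaluated in the partially filled
state, so it may read the row being overwritten at the current position. -/
lemma Post.fill {i row : ℕ} (hi : i ≠ 0) {e : RExp} {s : Config} (g : ℕ → ℝ)
    (hs : s.reg 0 = n) (he : ∀ k < n, e.eval (s.fill i row g k) = g k) {Q : Config → Prop}
    (hQ : Q (s.fill i row g n)) :
    (Cmd.forN i (.setR (.const row) (.reg i) e)).Post f lin Q s := by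
  have hloop := Post.loop (f := f) (lin := lin) (e := .reg 0) (s := s.setReg i 0)
    (c := .seq (.setR (.const row) (.reg i) e) (.setN i (.add (.reg i) (.const 1))))
    (fun k t => t = s.fill i row g k) (by
      simp [Config.fill, Config.setReg]) (by
      rintro k hk t rfl
      have hk' : k < n := by
        simpa [NExp.eval, Config.reg_setReg, hi.symm, hs] using hk
      simp only [Post, sem, NExp.eval, he k hk', Config.reg_setCell, Config.reg_fill, if_true]
      simp only [Config.fill, Config.setReg, Config.setCell, Config.mk.injEq, and_true,
        Function.update_idem, Function.update_self, true_and]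
      congr 1
      funext j
      by_cases hj : j = k
      · subst hj; simp
      · have : j < k + 1 ↔ j < k := by omega
        simp [hj, this])
  refine hloop.mono ?_
  rintro t rfl
  have : NExp.eval (s.setReg i 0) (.reg 0) = n := by
    simp [NExp.eval, Config.reg_setReg, hi.symm, hs]
  rwa [this]

/-- Counters support no multiplication, so a power of `n + 1` rounds is realized by nested loops;
the round number of the invariant runs through all of them consecutively. -/
lemma Hoare.rep {c : Cmd} (I : ℕ → Config → Prop) (Φ : ℕ → Config → ℝ) (η : ℝ)
    (hreg : ∀ k t, I k t → t.reg 0 = n) (N : ℕ)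
    (hstep : ∀ k < N, ∀ t, I k t → c.Hoare f lin t (I (k + 1)) (Φ (k + 1)) (Φ k t - η))
    (j k : ℕ) (hk : k + (n + 1) ^ j ≤ N) (s : Config) (hs : I k s) :
    (Cmd.rep j c).Hoare f lin s (I (k + (n + 1) ^ j)) (Φ (k + (n + 1) ^ j))
      (Φ k s - ((n + 1) ^ j : ℕ) * η) := by
  induction j generalizing k s with
  | zero => simpa [Cmd.rep] using hstep k (by simpa using hk) s hs
  | succ j ih =>
    have e : NExp.eval s (.add (.reg 0) (.const 1)) = n + 1 := by
      simp [NExp.eval, hreg k s hs]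
    have := Hoare.loop (f := f) (lin := lin) (e := .add (.reg 0) (.const 1)) (s := s)
      (c := Cmd.rep j c)
      (fun i => I (k + i * (n + 1) ^ j)) (fun i => Φ (k + i * (n + 1) ^ j))
      (((n + 1) ^ j : ℕ) * η) (by simpa using hs) (by
        intro i hi t ht
        rw [e] at hi
        have hle : (i + 1) * (n + 1) ^ j ≤ (n + 1) ^ (j + 1) := by
          rw [pow_succ']; exact Nat.mul_le_mul_right _ hi
        have := ih (k + i * (n + 1) ^ j) (by rw [Nat.add_mul, one_mul] at hle; omega) t ht
        rwa [add_assoc, show i * (n + 1) ^ j + (n + 1) ^ j = (i + 1) * (n + 1) ^ j by ring]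
          at this)
    simp only [e, ← pow_succ', zero_mul, add_zero] at this
    refine this.conseq (fun _ h => h) (fun _ _ => le_rfl) (le_of_eq ?_)
    push_cast
    ring

lemma Hoare.repeatN {c : Cmd} (I : ℕ → Config → Prop) (Φ : ℕ → Config → ℝ) (η : ℝ)
    (hreg : ∀ k t, I k t → t.reg 0 = n) (K j : ℕ)
    (hstep : ∀ k < K * (n + 1) ^ j, ∀ t, I k t →
      c.Hoare f lin t (I (k + 1)) (Φ (k + 1)) (Φ k t - η))
    (s : Config) (hs : I 0 s) :
    (Cmd.repeatN K j c).Hoare f lin s (I (K * (n + 1) ^ j)) (Φ (K * (n + 1) ^ j))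
      (Φ 0 s - (K * (n + 1) ^ j : ℕ) * η) := by
  have e : NExp.eval s (.const K) = K := rfl
  have := Hoare.loop (f := f) (lin := lin) (e := .const K) (s := s) (c := Cmd.rep j c)
    (fun i => I (i * (n + 1) ^ j)) (fun i => Φ (i * (n + 1) ^ j))
    (((n + 1) ^ j : ℕ) * η) (by simpa using hs) (by
      intro i hi t ht
      rw [e] at hi
      have hle : (i + 1) * (n + 1) ^ j ≤ K * (n + 1) ^ j := Nat.mul_le_mul_right _ hi
      have := Hoare.rep I Φ η hreg _ hstep j (i * (n + 1) ^ j)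
        (by rwa [Nat.add_mul, one_mul] at hle) t ht
      rwa [show i * (n + 1) ^ j + (n + 1) ^ j = (i + 1) * (n + 1) ^ j by ring] at this)
  simp only [e, zero_mul] at this
  refine this.conseq (fun _ h => h) (fun _ _ => le_rfl) (le_of_eq ?_)
  push_cast
  ring

end Cmd

/-! ### The algorithm -/

namespace GuidedGreedy

open Cmd

/-- The cell of a row at the position given by a register. -/
abbrev at' (row i : ℕ) : RExp := .cell (.const row) (.reg i)

/-- A scalar variable. -/
abbrev var (i : ℕ) : RExp := .cell (.const 9) (.const i)

/-- Assignment to a scalar variable. -/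
abbrev setVar (i : ℕ) (e : RExp) : Cmd := .setR (.const 9) (.const i) e

/-- Scalar `0` becomes the value of the surrogate function at the set in row `7`. Row `2` holds the
scales, row `3` the indicator of the unscaled elements. -/
def evalSurrogate : Cmd :=
  .seq (forN 2 (.setR (.const 8) (.reg 2) (.mul (at' 7 2) (at' 3 2)))) <|
  .seq (.value (.const 9) (.const 1) (.const 8)) <|
  .seq (setVar 0 (var 1)) <|
  forN 2 <|
    .seq (setVar 3 (at' 8 2)) <|
    .seq (.setR (.const 8) (.reg 2) (.const 1)) <|
    .seq (.value (.const 9) (.const 2) (.const 8)) <|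
    .seq (.setR (.const 8) (.reg 2) (var 3)) <|
    setVar 0 (.add (var 0)
      (.mul (.mul (at' 7 2) (.mul (.sub (.const 1) (at' 3 2)) (at' 2 2))) (.sub (var 2) (var 1))))

/-- Row `7` becomes the indicator vector of a random set with marginals given by a row. -/
def sampleSet (src : ℕ) : Cmd :=
  forN 2 (.seq (.flip 3 (at' src 2)) (.setR (.const 7) (.reg 2) (.ofNat (.reg 3))))

/-- Add one sample of the partial derivative, in the direction given by register `1`, to scalar
`4`. -/
def sampleDerivative (src : ℕ) : Cmd :=
  .seq (sampleSet src) <|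
  .seq (.setR (.const 7) (.reg 1) (.const 1)) <|
  .seq evalSurrogate <|
  .seq (setVar 5 (var 0)) <|
  .seq (.setR (.const 7) (.reg 1) (.const 0)) <|
  .seq evalSurrogate <|
  setVar 4 (.add (var 4) (.sub (var 5) (var 0)))

/-- Scalar `4` becomes a sum of samples of a partial derivative. -/
def estimate (k src : ℕ) : Cmd :=
  .seq (setVar 4 (.const 0)) (repeatN (k ^ 2) 6 (sampleDerivative src))

variable {n : ℕ} {f : Finset (Fin n) → ℝ} {lin : (Fin n → ℝ) → (Fin n → ℝ)}

/-- Row `2` holds the scales and row `3` the indicator of the unscaled elements. -/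
structure Env (L : Finset (Fin n)) (q : Fin n → ℝ) (s : Config) : Prop where
  reg0 : s.reg 0 = n
  flag : ∀ u : Fin n, s.cell 3 u = ind L u
  scale : ∀ u : Fin n, s.cell 2 u = psum (ind L) q u

lemma Env.of_agree {L : Finset (Fin n)} {q : Fin n → ℝ} {s t : Config} (h : Env L q s) {m : ℕ}
    (hm : 4 ≤ m) (ha : Config.Agree m s t) : Env L q t :=
  ⟨ha.reg0.trans h.reg0, fun u => by rw [ha.rows 3 (by omega), h.flag],
    fun u => by rw [ha.rows 2 (by omega), h.scale]⟩

lemma filter_ind_ne_zero (S : Finset (Fin n)) : (Finset.univ.filter fun u => ind S u ≠ 0) = S := by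
  ext u
  by_cases h : u ∈ S <;> simp [ind, h]

lemma post_evalSurrogate {L : Finset (Fin n)} {q : Fin n → ℝ} (hqL : ∀ u ∈ L, q u = 0)
    {s : Config} (hs : Env L q s) {S : Finset (Fin n)} (hS : ∀ u : Fin n, s.cell 7 u = ind S u) :
    evalSurrogate.Post f lin (fun t => Config.Agree 8 s t ∧
      (∀ c, 4 ≤ c → t.cell 9 c = s.cell 9 c) ∧ t.cell 9 0 = surrogate f L q S) s := by
  set A := S ∩ L with hA
  -- The program stores only flags and scales; this product recovers `q` because `q` vanishes on
  -- `L`.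
  have hqq : ∀ u, (1 - ind L u) * psum (ind L) q u = q u := by
    intro u
    by_cases h : u ∈ L
    · simp [ind, psum, h, hqL u h]
    · simp [ind, psum, h]
  unfold evalSurrogate
  refine Post.seq (Q := fun t => Config.Agree 8 s t ∧ t.cell 9 = s.cell 9 ∧
      ∀ u : Fin n, t.cell 8 u = ind A u) ?_ ?_
  · refine Post.fill (by norm_num) (fun k => s.cell 7 k * s.cell 3 k) hs.reg0 ?_ ?_
    · intro k hk
      simp [RExp.eval, NExp.eval, Config.reg_fill, Config.row_fill_of_ne]
    · refine ⟨(Config.Agree.refl 8 s).fill le_rfl le_rfl _ _, ?_, fun u => ?_⟩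
      · rw [Config.row_fill_of_ne _ (by norm_num)]
      · rw [Config.cell_fill, if_pos u.2, hS, hs.flag, hA, ← mul_ind]
        rfl
  rintro t ⟨hst, h9, h8⟩
  refine Post.seq (Q := fun t => Config.Agree 8 s t ∧ (∀ c, 4 ≤ c → t.cell 9 c = s.cell 9 c) ∧
      (∀ u : Fin n, t.cell 8 u = ind A u) ∧ t.cell 9 1 = f A) ?_ ?_
  · simp only [Post, sem, NExp.eval]
    refine ⟨hst.setCell (by norm_num) _ _, fun c hc => ?_, fun u => ?_, ?_⟩
    · rw [Config.cell_setCell, if_neg (by omega), h9]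
    · rw [Config.row_setCell_of_ne _ (by norm_num), h8]
    · rw [Config.cell_setCell, if_pos ⟨rfl, rfl⟩]
      simp only [Config.vec, h8, filter_ind_ne_zero]
  rintro t ⟨hst, h9, h8, h91⟩
  refine Post.seq (Q := fun t => Config.Agree 8 s t ∧ (∀ c, 4 ≤ c → t.cell 9 c = s.cell 9 c) ∧
      (∀ u : Fin n, t.cell 8 u = ind A u) ∧ t.cell 9 1 = f A ∧ t.cell 9 0 = f A) ?_ ?_
  · simp only [Post, sem, NExp.eval, RExp.eval]
    refine ⟨hst.setCell (by norm_num) _ _, fun c hc => ?_, fun u => ?_, ?_, ?_⟩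
    · rw [Config.cell_setCell, if_neg (by omega), h9 c hc]
    · rw [Config.row_setCell_of_ne _ (by norm_num), h8]
    · rw [Config.cell_setCell, if_neg (by norm_num), h91]
    · rw [Config.cell_setCell, if_pos ⟨rfl, rfl⟩, h91]
  rintro t ⟨hst, h9, h8, h91, h90⟩
  -- Row 8 is altered at one position for the query and then restored, so it equals `ind A` again
  -- after every round. Scalars from 4 on are left to the caller.
  refine (Post.forN (by norm_num) (fun k t => Config.Agree 8 s t ∧
    (∀ c, 4 ≤ c → t.cell 9 c = s.cell 9 c) ∧ (∀ u : Fin n, t.cell 8 u = ind A u) ∧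
    t.cell 9 1 = f A ∧ t.cell 9 0 = f A + ∑ v : Fin n with v.val < k,
      ind S v * q v * (f (insert v A) - f A)) (hst.reg0.trans hs.reg0) ?_ ?_ ?_).mono ?_
  · rintro k t v ⟨h1, h2⟩
    exact ⟨h1.setReg le_rfl _, h2⟩
  · refine ⟨hst, h9, h8, h91, ?_⟩
    rw [sum_lt_zero, add_zero, h90]
  · rintro k hk t ht0 ht2 ⟨hst, h9, h8, h91, h90⟩
    have henv := hs.of_agree (by norm_num) hst
    have hset : (Finset.univ.filter fun u : Fin n =>
        (if (u : ℕ) = k then (1 : ℝ) else t.cell 8 u) ≠ 0) = insert ⟨k, hk⟩ A := by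
      rw [← filter_ind_ne_zero (insert ⟨k, hk⟩ A)]
      refine Finset.filter_congr fun u _ => ?_
      by_cases hu : (u : ℕ) = k
      · have : u = ⟨k, hk⟩ := Fin.ext hu
        simp [this, ind]
      · have : u ≠ ⟨k, hk⟩ := fun h => hu (congrArg Fin.val h)
        simp [hu, this, ind, h8]
    simp only [Post, sem, NExp.eval, RExp.eval, Config.reg_setCell, ht2, Rat.cast_one]
    refine ⟨ht0, trivial, ?_, ?_, ?_, ?_, ?_⟩
    · exact ((((hst.setCell (by norm_num) _ _).setCell le_rfl _ _).setCell
        (by norm_num) _ _).setCell le_rfl _ _).setCell (by norm_num) _ _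
    · intro c hc
      have h1 : c ≠ 0 := by omega
      have h2 : c ≠ 2 := by omega
      have h3 : c ≠ 3 := by omega
      simp [Config.cell_setCell, h1, h2, h3, h9 c hc]
    · intro u
      by_cases hu : (u : ℕ) = k
      · simp [Config.cell_setCell, hu, ← h8 u]
      · simp [Config.cell_setCell, hu, h8]
    · simp [Config.cell_setCell, h91]
    · refine Eq.trans (b := t.cell 9 0 + t.cell 7 k * ((1 - t.cell 3 k) * t.cell 2 k) *
        (f (Finset.univ.filter fun u : Fin n =>
          (if (u : ℕ) = k then (1 : ℝ) else t.cell 8 u) ≠ 0) - t.cell 9 1)) ?_ ?_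
      · simp [Config.cell_setCell, Config.vec]
      · rw [hset, h90, h91, sum_lt_succ hk, ← add_assoc, hst.rows 7 (by norm_num)]
        rw [hS ⟨k, hk⟩, henv.flag ⟨k, hk⟩, henv.scale ⟨k, hk⟩, hqq]
  · rintro t ⟨-, hst, h9, -, -, h90⟩
    refine ⟨hst, h9, ?_⟩
    rw [h90, sum_lt_self, surrogate_eq]

/-- The potential is `multilinearExt ψ` at the hybrid vector with sampled coordinates below `k` and
`x` from `k` on. By affineness in coordinate `k` a coin toss preserves its expectation, so there is
no loss. -/
lemma hoare_sampleSet {src : ℕ} (hsrc : src < 7) {s : Config} (hs : s.reg 0 = n)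
    {x : Fin n → ℝ} (hxs : ∀ u : Fin n, s.cell src u = x u)
    (hx : x ∈ Set.Icc (0 : Fin n → ℝ) 1) (ψ : Finset (Fin n) → ℝ) :
    (sampleSet src).Hoare f lin s (fun t => Config.Agree 7 s t ∧ t.cell 9 = s.cell 9 ∧
      ∃ S, t.vec n 7 = ind S) (fun t => multilinearExt ψ (t.vec n 7)) (multilinearExt ψ x) := by
  set p : ℕ → Config → Fin n → ℝ := fun k t u => if (u : ℕ) < k then t.cell 7 u else x u with hp
  have hmain := Hoare.forN (f := f) (lin := lin) (i := 2) (by norm_num)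
    (c := .seq (.flip 3 (at' src 2)) (.setR (.const 7) (.reg 2) (.ofNat (.reg 3))))
    (fun k t => Config.Agree 7 s t ∧ t.cell 9 = s.cell 9 ∧
      ∃ S, ∀ u : Fin n, (u : ℕ) < k → t.cell 7 u = ind S u)
    (fun k t => multilinearExt ψ (p k t)) 0 hs
    (fun k t v h => ⟨h.1.setReg le_rfl _, h.2⟩) (fun k t v => rfl)
    ⟨Config.Agree.refl _ _, rfl, ∅, fun u hu => absurd hu (Nat.not_lt_zero _)⟩ (by
      rintro k hk t ht0 ht2 ⟨hst, h9, S, hS⟩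
      have hpk : (at' src 2).eval t = x ⟨k, hk⟩ := by
        simp only [RExp.eval, NExp.eval, ht2]
        rw [hst.rows src hsrc, ← hxs]
      have hout : ∀ b : ℕ, b = 0 ∨ b = 1 →
          let t' := (t.setReg 3 b).setCell 7 k b
          (t'.reg 0 = n ∧ t'.reg 2 = k ∧ Config.Agree 7 s t' ∧ t'.cell 9 = s.cell 9 ∧
            ∃ S, ∀ u : Fin n, (u : ℕ) < k + 1 → t'.cell 7 u = ind S u) ∧
          p (k + 1) t' = Function.update (p k t) ⟨k, hk⟩ b := by
        intro b hb
        refine ⟨⟨?_, ?_, (hst.setReg (by norm_num) _).setCell le_rfl _ _, ?_, ?_⟩, ?_⟩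
        · simpa [Config.reg_setReg] using ht0
        · simpa [Config.reg_setReg] using ht2
        · rw [Config.row_setCell_of_ne _ (by norm_num)]; exact h9
        · rcases hb with rfl | rfl
          · refine ⟨S.erase ⟨k, hk⟩, fun u hu => ?_⟩
            rw [← update_ind_zero]
            by_cases huk : (u : ℕ) = k
            · have : u = ⟨k, hk⟩ := Fin.ext huk
              simp [this, Config.cell_setCell]
            · have : u ≠ ⟨k, hk⟩ := fun h => huk (congrArg Fin.val h)
              simp [this, huk, Config.cell_setCell, hS u (by omega)]
          · refine ⟨insert ⟨k, hk⟩ S, fun u hu => ?_⟩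
            rw [← update_ind_one]
            by_cases huk : (u : ℕ) = k
            · have : u = ⟨k, hk⟩ := Fin.ext huk
              simp [this, Config.cell_setCell]
            · have : u ≠ ⟨k, hk⟩ := fun h => huk (congrArg Fin.val h)
              simp [this, huk, Config.cell_setCell, hS u (by omega)]
        · funext u
          by_cases huk : (u : ℕ) = k
          · have : u = ⟨k, hk⟩ := Fin.ext huk
            simp [this, Config.cell_setCell, hp]
          · have h1 : u ≠ ⟨k, hk⟩ := fun h => huk (congrArg Fin.val h)
            have h2 : (u : ℕ) < k + 1 ↔ (u : ℕ) < k := by omega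
            simp only [hp, h2, Config.cell_setCell, huk, and_false, if_false,
              Config.cell_setReg, Function.update_of_ne h1]
      obtain ⟨hQ1, hp1⟩ := hout 1 (Or.inr rfl)
      obtain ⟨hQ0, hp0⟩ := hout 0 (Or.inl rfl)
      have e1 : ∀ b, NExp.eval (t.setReg 3 b) (.reg 2) = k := fun b => by
        simp [NExp.eval, Config.reg_setReg, ht2]
      have e2 : ∀ b, RExp.eval (t.setReg 3 b) (.ofNat (.reg 3)) = b := fun b => by
        simp [RExp.eval, NExp.eval, Config.reg_setReg]
      have e3 : ∀ b, NExp.eval (t.setReg 3 b) (.const 7) = 7 := fun _ => rfl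
      refine ⟨?_, ?_⟩
      · simp only [Post, sem, e1, e2, e3]
        exact ⟨hQ1, hQ0⟩
      · simp only [wp, sem, e1, e2, e3, hpk, clip_of_mem (hx.1 _) (hx.2 _), hp1, hp0]
        have h := coordAffine_multilinearExt ψ (p k t) ⟨k, hk⟩ (x ⟨k, hk⟩)
        have e4 : Function.update (p k t) ⟨k, hk⟩ (x ⟨k, hk⟩) = p k t := by
          rw [Function.update_eq_iff]
          simp [hp]
        rw [e4] at h
        simp only [Nat.cast_one, Nat.cast_zero]
        linarith)
  refine hmain.conseq ?_ ?_ ?_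
  · rintro t ⟨-, h1, h2, S, hS⟩
    exact ⟨h1, h2, S, funext fun u => hS u u.2⟩
  · rintro t -
    refine le_of_eq (congrArg _ (funext fun u => ?_))
    simp [hp, Config.vec]
  · simp [hp]

/-- The test function `g` of the accumulator is arbitrary; the variance argument takes it to be a
negated square. -/
lemma hoare_sampleDerivative {L : Finset (Fin n)} {q : Fin n → ℝ} (hqL : ∀ u ∈ L, q u = 0)
    {src : ℕ} (hsrc : src < 7) {s : Config} (hs : Env L q s) {u : Fin n} (hu : s.reg 1 = u)
    {x : Fin n → ℝ} (hxs : ∀ u : Fin n, s.cell src u = x u)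
    (hx : x ∈ Set.Icc (0 : Fin n → ℝ) 1) (g : ℝ → ℝ) :
    (sampleDerivative src).Hoare f lin s (Config.Agree 7 s) (fun t => g (t.cell 9 4))
      (multilinearExt (fun S => g (s.cell 9 4 +
        (surrogate f L q (insert u S) - surrogate f L q (S.erase u)))) x) := by
  refine (hoare_sampleSet hsrc hs.reg0 hxs hx _).seq ?_
  rintro t ⟨hst, h9, S, hS⟩
  rw [hS, multilinearExt_ind]
  refine (Post.hoare (Q := fun t => Config.Agree 7 s t ∧ t.cell 9 4 = s.cell 9 4 +
    (surrogate f L q (insert u S) - surrogate f L q (S.erase u))) ?_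
      (fun t ht => by rw [ht.2])).conseq (fun t ht => ht.1) (fun _ _ => le_rfl) le_rfl
  have hrow : ∀ (t : Config) (b : ℝ) (v : Fin n), t.reg 1 = u →
      (t.setCell 7 (t.reg 1) b).cell 7 v = Function.update (t.vec n 7) u b v := by
    intro t b v ht
    rw [Config.cell_setCell, ht]
    by_cases hv : v = u
    · subst hv; simp
    · have : (v : ℕ) ≠ u := fun h => hv (Fin.ext h)
      simp [hv, this, Config.vec]
  refine Post.seq (Q := fun t => Config.Agree 7 s t ∧ t.cell 9 4 = s.cell 9 4 ∧
    t.vec n 7 = ind (insert u S)) ?_ ?_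
  · simp only [Post, sem, NExp.eval, RExp.eval, Rat.cast_one]
    refine ⟨hst.setCell le_rfl _ _, ?_, funext fun v => ?_⟩
    · rw [Config.row_setCell_of_ne _ (by norm_num), h9]
    · rw [Config.vec, hrow _ _ _ (hst.reg1.trans hu), hS, update_ind_one]
  rintro t ⟨hst, h9, h7⟩
  refine Post.seq (post_evalSurrogate hqL (hs.of_agree (by norm_num) hst)
    (S := insert u S) fun v => congrFun h7 v) ?_
  rintro t₁ ⟨hst₁, h9₁, h90⟩
  have h71 : t₁.vec n 7 = ind (insert u S) := by
    rw [← h7]; funext v; simp only [Config.vec, hst₁.rows 7 (by norm_num)]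
  have hst₂ := hst.trans (hst₁.mono (by norm_num))
  refine Post.seq (Q := fun t => Config.Agree 7 s t ∧ t.cell 9 4 = s.cell 9 4 ∧
    t.cell 9 5 = surrogate f L q (insert u S) ∧ t.vec n 7 = ind (insert u S)) ?_ ?_
  · simp only [Post, sem, NExp.eval, RExp.eval]
    refine ⟨hst₂.setCell (by norm_num) _ _, ?_, ?_, ?_⟩
    · rw [Config.cell_setCell, if_neg (by norm_num), h9₁ 4 le_rfl, h9]
    · rw [Config.cell_setCell, if_pos ⟨rfl, rfl⟩, h90]
    · rw [← h71]; funext v; simp only [Config.vec]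
      rw [Config.row_setCell_of_ne _ (by norm_num)]
  rintro t ⟨hst, h94, h95, h7⟩
  refine Post.seq (Q := fun t => Config.Agree 7 s t ∧ t.cell 9 4 = s.cell 9 4 ∧
    t.cell 9 5 = surrogate f L q (insert u S) ∧ t.vec n 7 = ind (S.erase u)) ?_ ?_
  · simp only [Post, sem, NExp.eval, RExp.eval, Rat.cast_zero]
    refine ⟨hst.setCell le_rfl _ _, ?_, ?_, funext fun v => ?_⟩
    · rw [Config.row_setCell_of_ne _ (by norm_num), h94]
    · rw [Config.row_setCell_of_ne _ (by norm_num), h95]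
    · rw [Config.vec, hrow _ _ _ (hst.reg1.trans hu), h7, update_ind_zero, Finset.erase_insert_eq_erase]
  rintro t ⟨hst, h94, h95, h7⟩
  refine Post.seq (post_evalSurrogate hqL (hs.of_agree (by norm_num) hst)
    (S := S.erase u) fun v => congrFun h7 v) ?_
  rintro t₁ ⟨hst₁, h9₁, h90⟩
  simp only [Post, sem, NExp.eval, RExp.eval]
  refine ⟨(hst.trans (hst₁.mono (by norm_num))).setCell (by norm_num) _ _, ?_⟩
  rw [Config.cell_setCell, if_pos ⟨rfl, rfl⟩, h9₁ 4 le_rfl, h9₁ 5 (by norm_num), h90, h94, h95]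

/-- One more independent sample raises the second moment of the centred sum by at most `B ^ 2`: the
cross term vanishes because the mean of the discrete derivative is `partialD`. -/
lemma variance_bound {h : Finset (Fin n) → ℝ} {B : ℝ} (h0 : ∀ S, 0 ≤ h S) (hB : ∀ S, h S ≤ B)
    {x : Fin n → ℝ} (hx : x ∈ Set.Icc (0 : Fin n → ℝ) 1) (u : Fin n) (a : ℝ) :
    -a ^ 2 - B ^ 2 ≤ multilinearExt
      (fun S => -(a + (h (insert u S) - h (S.erase u) - partialD h u x)) ^ 2) x := by
  set w := partialD h u x with hw
  have h1 : ∀ S, (-a ^ 2 + 2 * a * w - w ^ 2 - B ^ 2) +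
      (2 * w - 2 * a) * (h (insert u S) - h (S.erase u)) ≤
      -(a + (h (insert u S) - h (S.erase u) - w)) ^ 2 := by
    intro S
    have : (h (insert u S) - h (S.erase u)) ^ 2 ≤ B ^ 2 := by
      refine sq_le_sq' ?_ ?_ <;>
        linarith [h0 (insert u S), h0 (S.erase u), hB (insert u S), hB (S.erase u)]
    linarith
  refine le_trans ?_ (multilinearExt_mono h1 hx)
  rw [multilinearExt_add, multilinearExt_const, multilinearExt_mul]
  change _ ≤ _ + (2 * w - 2 * a) * w
  linarith [sq_nonneg w]

/-- With `r ^ 2` samples of variance at most `B ^ 2` the average has root-mean-square error at most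
`B / r`. The stored scalar is the sum; the division by `r ^ 2` exists only in the analysis. -/
lemma hoare_estimate {L : Finset (Fin n)} {q : Fin n → ℝ} (hqL : ∀ u ∈ L, q u = 0)
    {B : ℝ} (hB0 : 0 < B) (h0 : ∀ S, 0 ≤ surrogate f L q S) (hB : ∀ S, surrogate f L q S ≤ B)
    {k : ℕ} (hk : 0 < k)
    {src : ℕ} (hsrc : src < 7) {s : Config} (hs : Env L q s) {u : Fin n} (hu : s.reg 1 = u)
    {x : Fin n → ℝ} (hxs : ∀ u : Fin n, s.cell src u = x u)
    (hx : x ∈ Set.Icc (0 : Fin n → ℝ) 1) :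
    (estimate k src).Hoare f lin s (Config.Agree 7 s)
      (fun t => -|t.cell 9 4 / (k * (n + 1) ^ 3) ^ 2 - partialD (surrogate f L q) u x|)
      (-(B / (k * (n + 1) ^ 3))) := by
  set w := partialD (surrogate f L q) u x with hw
  set r : ℝ := k * (n + 1) ^ 3 with hr
  have hr0 : 0 < r := by positivity
  refine Post.seq_hoare (Q := fun t => Config.Agree 7 s t ∧ t.cell 9 4 = 0) ?_ ?_
  · simp only [Post, sem, NExp.eval, RExp.eval, Rat.cast_zero]
    exact ⟨(Config.Agree.refl 7 s).setCell (by norm_num) _ _, by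
      rw [Config.cell_setCell, if_pos ⟨rfl, rfl⟩]⟩
  rintro t ⟨hst, h94⟩
  have h1 := Hoare.repeatN (f := f) (lin := lin) (c := sampleDerivative src)
    (fun _ t => Config.Agree 7 s t) (fun i t => -(t.cell 9 4 - i * w) ^ 2) (B ^ 2)
    (fun _ t ht => ht.reg0.trans hs.reg0) (k ^ 2) 6 (by
      intro i _ t ht
      have := hoare_sampleDerivative (f := f) (lin := lin) hqL hsrc (hs.of_agree (by norm_num) ht)
        (ht.reg1.trans hu) (x := x) (fun u => by rw [ht.rows _ hsrc, hxs]) hx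
        (fun A => -(A - (i + 1 : ℕ) * w) ^ 2)
      refine this.conseq (fun t' ht' => ht.trans ht') (fun _ _ => le_rfl) ?_
      refine (variance_bound h0 hB hx u (t.cell 9 4 - i * w)).trans_eq ?_
      congr 1
      funext S
      push_cast
      ring) t hst
  have hcast : ((k ^ 2 * (n + 1) ^ 6 : ℕ) : ℝ) = r ^ 2 := by rw [hr]; push_cast; ring
  rw [hcast, h94] at h1
  -- Instead of Cauchy-Schwarz, `|e| ≤ r e ^ 2 / (2 B) + B / (2 r)`, tight at `|e| = B / r`; `α` and
  -- the constant are chosen for this.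
  refine (h1.affine (α := 1 / (2 * B * r ^ 3)) (by positivity) (-(B / (2 * r)))).conseq
    (fun _ h => h) (fun t _ => ?_) (le_of_eq ?_)
  · set e := t.cell 9 4 / r ^ 2 - w with he
    have e1 : t.cell 9 4 - r ^ 2 * w = r ^ 2 * e := by rw [he]; field_simp
    rw [e1]
    have h2 : 1 / (2 * B * r ^ 3) * -(r ^ 2 * e) ^ 2 + -(B / (2 * r)) + |e| =
        -((r * |e| - B) ^ 2 / (2 * B * r)) := by
      rw [← sq_abs (r ^ 2 * e), abs_mul, abs_of_pos (by positivity : 0 < r ^ 2)]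
      field_simp
      ring
    have h3 : 0 ≤ (r * |e| - B) ^ 2 / (2 * B * r) := by positivity
    linarith
  · simp only [Nat.cast_zero, zero_mul, sub_zero]
    field_simp
    ring

end GuidedGreedy

/-! ### The programs of the growth phase and their effect on memory. -/

namespace GuidedGreedy

open Cmd

/-- The step size `2 * j / (K * (n + 1) ^ 4)` of the growth phase. -/
def stepSize (K j : ℕ) : RExp :=
  .div (.const (2 * j : ℕ)) (.mul (.const K)
    (.mul (.mul (.ofNat (.add (.reg 0) (.const 1))) (.ofNat (.add (.reg 0) (.const 1))))
      (.mul (.ofNat (.add (.reg 0) (.const 1))) (.ofNat (.add (.reg 0) (.const 1))))))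

/-- Row `6` becomes the vector of the estimates of all partial derivatives at row `5`. -/
def estimateAll (K : ℕ) : Cmd :=
  forN 1 (.seq (estimate K 5) (.setR (.const 6) (.reg 1) (var 4)))

/-- Move row `4` in the best feasible direction; row `5` is row `4` divided by `j`. -/
def move (K j : ℕ) : Cmd :=
  .seq (forN 1 (.setR (.const 1) (.reg 1)
    (.div (.mul (.sub (.const 1) (at' 4 1)) (at' 6 1)) (at' 2 1)))) <|
  .seq (.optimize (.const 6) (.const 1)) <|
  .seq (forN 1 (.setR (.const 4) (.reg 1) (.add (at' 4 1)
    (.mul (.mul (stepSize K j) (.div (at' 6 1) (at' 2 1))) (.sub (.const 1) (at' 4 1)))))) <|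
  forN 1 (.setR (.const 5) (.reg 1) (.div (at' 4 1) (.const j)))

/-- The growth phase. -/
def growth (K j : ℕ) : Cmd := repeatN K 4 (.seq (estimateAll K) (move K j))

variable {n : ℕ} {f : Finset (Fin n) → ℝ} {lin : (Fin n → ℝ) → (Fin n → ℝ)}

lemma eval_stepSize {s : Config} (hs : s.reg 0 = n) (K j : ℕ) :
    (stepSize K j).eval s = 2 * j / (K * (n + 1) ^ 4) := by
  simp only [stepSize, RExp.eval, NExp.eval, hs]
  push_cast
  ring

/-- A rescaled instance: the elements outside `L` are scaled by `q`. -/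
structure Scaled (f : Finset (Fin n) → ℝ) (P : Set (Fin n → ℝ))
    (lin : (Fin n → ℝ) → (Fin n → ℝ)) (L : Finset (Fin n)) (q : Fin n → ℝ) : Prop where
  inst : IsInstance f P lin
  q_mem : q ∈ Set.Icc (0 : Fin n → ℝ) 1
  q_zero : ∀ u ∈ L, q u = 0
  sum_le : ∑ u, q u ≤ 1
  le_scale : ∀ y ∈ P, y ≤ psum (ind L) q

lemma hoare_estimateAll {L : Finset (Fin n)} {q : Fin n → ℝ} (hqL : ∀ u ∈ L, q u = 0)
    {B : ℝ} (hB0 : 0 < B) (h0 : ∀ S, 0 ≤ surrogate f L q S) (hB : ∀ S, surrogate f L q S ≤ B)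
    {K : ℕ} (hK : 0 < K) {s : Config} (hs : Env L q s)
    (hx : s.vec n 5 ∈ Set.Icc (0 : Fin n → ℝ) 1) :
    (estimateAll K).Hoare f lin s
      (fun t => Env L q t ∧ t.vec n 4 = s.vec n 4 ∧ t.vec n 5 = s.vec n 5)
      (fun t => -∑ u, |t.vec n 6 u / (K * (n + 1) ^ 3) ^ 2 -
        partialD (surrogate f L q) u (s.vec n 5)|)
      (-(n * (B / (K * (n + 1) ^ 3)))) := by
  set r : ℝ := K * (n + 1) ^ 3
  set e : Config → Fin n → ℝ := fun t u =>
    |t.vec n 6 u / r ^ 2 - partialD (surrogate f L q) u (s.vec n 5)| with he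
  have henv : ∀ t : Config, t.reg 0 = n → (∀ i < 6, t.cell i = s.cell i) → Env L q t :=
    fun t h h' => ⟨h, fun u => by rw [h' 3 (by norm_num), hs.flag],
      fun u => by rw [h' 2 (by norm_num), hs.scale]⟩
  have h := Hoare.forN (f := f) (lin := lin) (i := 1) (by norm_num)
    (c := .seq (estimate K 5) (.setR (.const 6) (.reg 1) (var 4))) (s := s)
    (fun _ t => ∀ i < 6, t.cell i = s.cell i)
    (fun k t => -∑ u : Fin n with u.val < k, e t u) (B / r) hs.reg0 (fun _ _ _ h => h)
    (fun _ _ _ => rfl) (fun _ _ => rfl) (by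
      intro k hk t ht0 ht1 ht
      have h1 := hoare_estimate (f := f) (lin := lin) hqL hB0 h0 hB hK (src := 5) (by norm_num)
        (henv t ht0 ht) (u := ⟨k, hk⟩) ht1 (x := s.vec n 5)
        (fun u => by rw [ht 5 (by norm_num)]; rfl) hx
      have h2 := h1.affine zero_le_one (-∑ u : Fin n with u.val < k, e t u)
      refine (h2.conseq (b := -∑ u : Fin n with u.val < k, e t u - B / r)
        (fun _ h => h) (fun _ _ => le_rfl) (le_of_eq (by ring))).seq ?_
      intro t' ht'
      refine Post.hoare_of_le ?_
      simp only [Post, sem, NExp.eval, RExp.eval]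
      refine ⟨⟨ht'.reg0.trans ht0, ht'.reg1.trans ht1, fun i hi => ?_⟩, le_of_eq ?_⟩
      · rw [Config.row_setCell_of_ne _ (by omega), ht'.rows i (by omega), ht i hi]
      · have e1 : ∀ u : Fin n, u.val < k →
            e (t'.setCell 6 (t'.reg 1) (t'.cell 9 4)) u = e t u := by
          intro u hu
          simp only [he, Config.vec]
          rw [Config.cell_setCell, ht'.reg1, ht1, if_neg (by omega), ht'.rows 6 (by norm_num)]
        have e2 : e (t'.setCell 6 (t'.reg 1) (t'.cell 9 4)) ⟨k, hk⟩ =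
            |t'.cell 9 4 / r ^ 2 - partialD (surrogate f L q) ⟨k, hk⟩ (s.vec n 5)| := by
          simp only [he, Config.vec]
          rw [Config.cell_setCell, ht'.reg1, ht1, if_pos ⟨rfl, rfl⟩]
        rw [sum_lt_succ hk, e2, Finset.sum_congr rfl fun u hu => e1 u (Finset.mem_filter.1 hu).2]
        ring)
  refine h.conseq ?_ ?_ ?_
  · rintro t ⟨h0, ht⟩
    refine ⟨henv t h0 ht, ?_, ?_⟩
    · funext u; simp only [Config.vec, ht 4 (by norm_num)]
    · funext u; simp only [Config.vec, ht 5 (by norm_num)]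
  · intro t _
    rw [sum_lt_self]
  · simp

lemma post_move {L : Finset (Fin n)} {q : Fin n → ℝ} {K j : ℕ} {s : Config} (hs : Env L q s) :
    (move K j).Post f lin (fun t => Env L q t ∧
      t.vec n 4 = grow (2 * j / (K * (n + 1) ^ 4)) (s.vec n 4) (fun u =>
        lin (fun u => (1 - s.vec n 4 u) * s.vec n 6 u / psum (ind L) q u) u /
          psum (ind L) q u) ∧
      t.vec n 5 = (j : ℝ)⁻¹ • t.vec n 4) s := by
  set sc := psum (ind L) q with hsc
  unfold move
  set W : Fin n → ℝ := fun u => (1 - s.vec n 4 u) * s.vec n 6 u / sc u with hW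
  have henv : ∀ t : Config, t.reg 0 = n → t.cell 2 = s.cell 2 → t.cell 3 = s.cell 3 → Env L q t :=
    fun t h h2 h3 => ⟨h, fun u => by rw [h3, hs.flag], fun u => by rw [h2, hs.scale]⟩
  refine Post.seq (Q := fun t => t.reg 0 = n ∧ t.cell 2 = s.cell 2 ∧ t.cell 3 = s.cell 3 ∧
    t.cell 4 = s.cell 4 ∧ t.vec n 1 = W) ?_ ?_
  · refine Post.fill (by norm_num) (fun k => (1 - s.cell 4 k) * s.cell 6 k / s.cell 2 k)
      hs.reg0 ?_ ?_
    · intro k hk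
      simp [RExp.eval, NExp.eval, Config.reg_fill, Config.row_fill_of_ne]
    · refine ⟨?_, ?_, ?_, ?_, funext fun u => ?_⟩
      · simp [Config.reg_fill, hs.reg0]
      · simp [Config.row_fill_of_ne]
      · simp [Config.row_fill_of_ne]
      · simp [Config.row_fill_of_ne]
      · simp [Config.vec, Config.cell_fill, hW, hs.scale, hsc]
  rintro t ⟨ht0, ht2, ht3, ht4, ht1⟩
  refine Post.seq (Q := fun t => t.reg 0 = n ∧ t.cell 2 = s.cell 2 ∧ t.cell 3 = s.cell 3 ∧
    t.cell 4 = s.cell 4 ∧ ∀ u : Fin n, t.cell 6 u = lin W u) ?_ ?_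
  · simp only [Post, sem, NExp.eval]
    refine ⟨ht0, ?_, ?_, ?_, fun u => ?_⟩
    · rw [Config.row_setVec_of_ne _ (by norm_num), ht2]
    · rw [Config.row_setVec_of_ne _ (by norm_num), ht3]
    · rw [Config.row_setVec_of_ne _ (by norm_num), ht4]
    · rw [Config.cell_setVec, ht1]
  rintro t ⟨ht0, ht2, ht3, ht4, ht6⟩
  set x' := grow (2 * j / (K * (n + 1) ^ 4)) (s.vec n 4) (fun u => lin W u / sc u) with hx'
  refine Post.seq (Q := fun t => t.reg 0 = n ∧ t.cell 2 = s.cell 2 ∧ t.cell 3 = s.cell 3 ∧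
    t.vec n 4 = x') ?_ ?_
  · refine Post.fill (by norm_num) (fun k => t.cell 4 k + 2 * j / (K * (n + 1) ^ 4) *
      (t.cell 6 k / t.cell 2 k) * (1 - t.cell 4 k)) ht0 ?_ ?_
    · intro k hk
      have hreg : (t.fill 1 4 (fun k => t.cell 4 k + 2 * j / (K * (n + 1) ^ 4) *
        (t.cell 6 k / t.cell 2 k) * (1 - t.cell 4 k)) k).reg 0 = n := by
        simp [Config.reg_fill, ht0]
      simp only [RExp.eval, eval_stepSize hreg]
      simp [NExp.eval, Config.reg_fill, Config.row_fill_of_ne, Config.cell_fill]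
    · refine ⟨?_, ?_, ?_, funext fun u => ?_⟩
      · simp [Config.reg_fill, ht0]
      · simp [Config.row_fill_of_ne, ht2]
      · simp [Config.row_fill_of_ne, ht3]
      · simp [Config.vec, Config.cell_fill, hx', grow, ht4, ht6, ht2, hs.scale, hsc]
  rintro t ⟨ht0, ht2, ht3, ht4⟩
  refine Post.fill (by norm_num) (fun k => t.cell 4 k / j) ht0 ?_ ?_
  · intro k hk
    simp [RExp.eval, NExp.eval, Config.reg_fill, Config.row_fill_of_ne]
  · refine ⟨henv _ ?_ ?_ ?_, ?_, funext fun u => ?_⟩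
    · simp [Config.reg_fill, ht0]
    · simp [Config.row_fill_of_ne, ht2]
    · simp [Config.row_fill_of_ne, ht3]
    · rw [← ht4]; funext u; simp [Config.vec, Config.row_fill_of_ne]
    · simp [Config.vec, Config.cell_fill, Config.row_fill_of_ne, div_eq_inv_mul]

/-- The invariant of the growth phase after `i` steps of size `τ`. -/
structure GrowthInv (P : Set (Fin n → ℝ)) (L : Finset (Fin n)) (q : Fin n → ℝ) (κ b : ℝ)
    (s : Config) : Prop where
  env : Env L q s
  mem : s.vec n 4 ∈ Set.Icc (0 : Fin n → ℝ) 1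
  lower : s.vec n 5 = κ • s.vec n 4
  feasible : ∃ y ∈ P, ∀ u, psum (ind L) q u * s.vec n 4 u ≤ b * y u

end GuidedGreedy

/-! ### Analysis of the growth phase. -/

namespace GuidedGreedy

open Cmd

variable {n : ℕ} {f : Finset (Fin n) → ℝ} {lin : (Fin n → ℝ) → (Fin n → ℝ)}
  {P : Set (Fin n → ℝ)} {L : Finset (Fin n)} {q : Fin n → ℝ}

lemma Scaled.nonneg_of_mem (h : Scaled f P lin L q) {y : Fin n → ℝ} (hy : y ∈ P) : 0 ≤ y :=
  (h.inst.subset_cube hy).1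

lemma Scaled.scale_mem (h : Scaled f P lin L q) :
    psum (ind L) q ∈ Set.Icc (0 : Fin n → ℝ) 1 :=
  psum_mem (ind_mem L) h.q_mem

lemma Scaled.div_mem (h : Scaled f P lin L q) {y : Fin n → ℝ} (hy : y ∈ P) :
    (fun u => y u / psum (ind L) q u) ∈ Set.Icc (0 : Fin n → ℝ) 1 :=
  ⟨fun u => div_nonneg (h.nonneg_of_mem hy u) (h.scale_mem.1 u),
    fun u => div_le_one_of_le₀ (h.le_scale y hy u) (h.scale_mem.1 u)⟩

/-- A zero scale forces the coordinate to vanish throughout `P`, so division by zero does no harm.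
-/
lemma Scaled.mul_div (h : Scaled f P lin L q) {y : Fin n → ℝ} (hy : y ∈ P) (u : Fin n) :
    psum (ind L) q u * (y u / psum (ind L) q u) = y u := by
  by_cases h0 : psum (ind L) q u = 0
  · have h1 := h.le_scale y hy u
    have h2 := h.nonneg_of_mem hy u
    rw [h0] at h1
    rw [h0, le_antisymm h1 h2, zero_mul]
  · exact mul_div_cancel₀ _ h0

/-- A change of variables: dividing the weights by the scales turns optimization over `P` into
optimization over the rescaled set. The competitor `z'` is pulled back to `P` by down-closedness. -/
lemma Scaled.optimal (h : Scaled f P lin L q) (a : Fin n → ℝ) {z z' : Fin n → ℝ} (hz : z ∈ P)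
    (h0 : 0 ≤ z') (hle : z' ≤ fun u => z u / psum (ind L) q u) :
    ∑ u, a u * z' u ≤
      ∑ u, a u * (lin (fun u => a u / psum (ind L) q u) u / psum (ind L) q u) := by
  set sc := psum (ind L) q with hsc
  have hmem : (fun u => sc u * z' u) ∈ P := by
    refine h.inst.downClosed z hz _ (fun u => mul_nonneg (h.scale_mem.1 u) (h0 u)) fun u => ?_
    exact (mul_le_mul_of_nonneg_left (hle u) (h.scale_mem.1 u)).trans_eq (h.mul_div hz u)
  have h1 := (h.inst.solvable fun u => a u / sc u).2 _ hmem
  refine le_of_eq_of_le (Finset.sum_congr rfl fun u _ => ?_) (h1.trans_eq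
    (Finset.sum_congr rfl fun u _ => ?_))
  · by_cases hu : sc u = 0
    · have h2 := hle u
      simp only [hu, div_zero] at h2
      have : z' u = 0 := le_antisymm h2 (h0 u)
      simp [this]
    · field_simp
  · ring

/-- After `i` of the `N` steps the potential is `1 / 2 * H (κ x) - i / N * slack x`. A step raises
the first term by about `slack x / N`, which pays exactly for the larger coefficient `(i + 1) / N`,
since the slack itself can only drop. The initial potential is nonnegative. -/
lemma hoare_growth (hsc : Scaled f P lin L q) {B : ℝ} (hB0 : 0 < B)
    (hB : ∀ S, surrogate f L q S ≤ B) {K j : ℕ} (hj : 0 < j) (hK : 2 * j ≤ K) {s : Config}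
    (hs : GrowthInv P L q (j : ℝ)⁻¹ 0 s) {z : Fin n → ℝ} (hz : z ∈ P) :
    (growth K j).Hoare f lin s (GrowthInv P L q (j : ℝ)⁻¹ (2 * j))
      (fun t => 1 / 2 * multilinearExt (surrogate f L q) ((j : ℝ)⁻¹ • t.vec n 4) -
        slack (surrogate f L q) (j : ℝ)⁻¹ (fun u => z u / psum (ind L) q u) (t.vec n 4))
      (-(2 * n * (B / (K * (n + 1) ^ 3)) + 2 * n ^ 2 * B / (K * (n + 1) ^ 4))) := by
  set h := surrogate f L q with hh
  set sc := psum (ind L) q with hscdef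
  set κ : ℝ := (j : ℝ)⁻¹ with hκ
  set z' : Fin n → ℝ := fun u => z u / sc u with hz'
  have hj0 : (0 : ℝ) < j := by exact_mod_cast hj
  have hj1 : (1 : ℝ) ≤ j := by exact_mod_cast hj
  have hK0 : 0 < K := by omega
  have hK0' : (0 : ℝ) < K := by exact_mod_cast hK0
  have hκ0 : 0 ≤ κ := by positivity
  have hκ1 : κ ≤ 1 := inv_le_one_of_one_le₀ hj1
  have h0 : ∀ S, 0 ≤ h S := surrogate_nonneg hsc.inst.nonneg hsc.q_mem.1 hsc.sum_le
  have hsub : IsSubmodular h := surrogate_submodular hsc.inst.submodular hsc.q_mem.1 hsc.sum_le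
  have hz'm : z' ∈ Set.Icc (0 : Fin n → ℝ) 1 := hsc.div_mem hz
  set N : ℝ := K * (n + 1) ^ 4 with hN
  have hN0 : 0 < N := by positivity
  set τ : ℝ := 2 * j / N with hτ
  have hτ0 : 0 ≤ τ := by positivity
  have hτ1 : τ ≤ 1 := by
    rw [hτ, div_le_one hN0, hN]
    have h1 : (2 * j : ℝ) ≤ K := by exact_mod_cast hK
    have h2 : (1 : ℝ) ≤ (n + 1 : ℝ) ^ 4 := one_le_pow₀ (by linarith [n.cast_nonneg (α := ℝ)])
    nlinarith
  have hκτ : κ * τ = 2 / N := by rw [hκ, hτ]; field_simp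
  set r : ℝ := K * (n + 1) ^ 3 with hr
  have hr0 : 0 < r := by positivity
  -- The estimation error and the second-order error of `growth_step`, both halved by the
  -- coefficient `1 / 2` in the potential.
  set η : ℝ := 2 / N * (n * (B / r)) + 1 / 2 * (n * (2 / N)) ^ 2 * B with hη
  have hmain := Hoare.repeatN (f := f) (lin := lin) (c := .seq (estimateAll K) (move K j))
    (fun i t => GrowthInv P L q κ (i * τ) t)
    (fun i t => 1 / 2 * multilinearExt h (κ • t.vec n 4) - i / N * slack h κ z' (t.vec n 4)) η
    (fun i t ht => ht.env.reg0) K 4 (by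
      intro i _ t ht
      set x := t.vec n 4 with hx
      have h1 := hoare_estimateAll (f := f) (lin := lin) hsc.q_zero hB0 h0 hB hK0 ht.env
        (by rw [ht.lower]; exact smul_mem_cube hκ0 hκ1 ht.mem)
      have h2 := h1.affine (α := 2 / N) (by positivity)
        (1 / 2 * multilinearExt h (κ • x) - i / N * slack h κ z' x
          - 1 / 2 * (n * (2 / N)) ^ 2 * B)
      refine (h2.conseq (fun _ h => h) (fun _ _ => le_rfl) (le_of_eq (by rw [hη]; ring))).seq ?_
      rintro t₁ ⟨henv₁, h4, h5⟩
      rw [← hx] at h4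
      refine Post.hoare_of_le ((post_move henv₁).mono ?_)
      rintro t₂ ⟨henv₂, h4', h5'⟩
      rw [h4] at h4'
      set d : Fin n → ℝ := fun u => t₁.vec n 6 u / r ^ 2 with hd
      set W : Fin n → ℝ := fun u => (1 - x u) * t₁.vec n 6 u / sc u with hW
      set y : Fin n → ℝ := lin W with hy
      set yt : Fin n → ℝ := fun u => y u / sc u with hyt
      have hyP : y ∈ P := (hsc.inst.solvable W).1
      have hytm : yt ∈ Set.Icc (0 : Fin n → ℝ) 1 := hsc.div_mem hyP
      obtain ⟨hg, hxg⟩ := grow_mem hτ0 hτ1 ht.mem hytm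
      refine ⟨⟨henv₂, by rw [h4']; exact hg, h5', ?_⟩, ?_⟩
      · obtain ⟨y₀, hy₀, hfe⟩ := ht.feasible
        have hi0 : (0 : ℝ) < i + 1 := by positivity
        -- The running average of the oracle answers; with total length `i * τ` it dominates the
        -- rescaled `x`, the damping factor `1 - x u` only helping.
        refine ⟨(i / (i + 1) : ℝ) • y₀ + (1 / (i + 1) : ℝ) • y, hsc.inst.convex hy₀ hyP
          (by positivity) (by positivity) (by field_simp), fun u => ?_⟩
        rw [h4']
        have h6 : sc u * yt u = y u := hsc.mul_div hyP u
        have h7 : τ * y u * (1 - x u) ≤ τ * y u := mul_le_of_le_one_right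
          (mul_nonneg hτ0 (hsc.nonneg_of_mem hyP u)) (sub_le_self _ (ht.mem.1 u))
        have h8 := hfe u
        have h9 : sc u * grow τ x yt u = sc u * x u + τ * (sc u * yt u) * (1 - x u) := by
          simp only [grow]; ring
        have h10 : ((i + 1 : ℕ) : ℝ) * τ * (((i / (i + 1) : ℝ) • y₀ + (1 / (i + 1) : ℝ) • y) u) =
            i * τ * y₀ u + τ * y u := by
          simp only [Pi.add_apply, Pi.smul_apply, smul_eq_mul]
          push_cast
          field_simp
        rw [h9, h6, h10]
        linarith
      · have hopt : ∀ w, 0 ≤ w → w ≤ z' →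
            ∑ u, (1 - x u) * d u * w u ≤ ∑ u, (1 - x u) * d u * yt u := by
          intro w hw0 hw
          have h6 := hsc.optimal (fun u => (1 - x u) * t₁.vec n 6 u) hz hw0 hw
          -- The oracle was called with raw sums of samples; a positive factor does not change the
          -- maximizer.
          have h7 := mul_le_mul_of_nonneg_left h6 (by positivity : 0 ≤ 1 / r ^ 2)
          rw [Finset.mul_sum, Finset.mul_sum] at h7
          refine le_of_eq_of_le (Finset.sum_congr rfl fun u _ => ?_) (h7.trans_eq
            (Finset.sum_congr rfl fun u _ => ?_))
          · simp only [hd]; ring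
          · simp only [hd, hyt, hy, hW]; ring
        have h6 := growth_step h0 hB hκ0 hκ1 hτ0 hτ1 ht.mem hytm hz'm hopt
        have h7 := slack_antitone hsub hκ0 hκ1 hz'm.1 ht.mem hg hxg
        have h8 := mul_le_mul_of_nonneg_left h7 (by positivity : 0 ≤ ((i + 1 : ℕ) : ℝ) / N)
        rw [hκτ] at h6
        rw [h4', ht.lower]
        have h9 : ((i + 1 : ℕ) : ℝ) / N * slack h κ z' x =
            i / N * slack h κ z' x + 1 / 2 * (2 / N * slack h κ z' x) := by
          push_cast; ring
        linarith) s (by simpa using hs)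
  have hcast : ((K * (n + 1) ^ 4 : ℕ) : ℝ) = N := by rw [hN]; push_cast; ring
  rw [hcast] at hmain
  have hcast' : N * τ = 2 * j := by rw [hτ]; field_simp
  refine hmain.conseq (fun t ht => ?_) (fun t ht => ?_) ?_
  · rwa [hcast'] at ht
  · rw [div_self hN0.ne', one_mul]
  · have h1 := multilinearExt_nonneg h0 (smul_mem_cube hκ0 hκ1 hs.mem)
    have h2 : N * η = 2 * n * (B / r) + 2 * n ^ 2 * B / N := by
      rw [hη]; field_simp
    simp only [Nat.cast_zero, zero_div, zero_mul, sub_zero]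
    linarith

end GuidedGreedy

/-! ### The double greedy phase, the scales and the whole program. -/

namespace GuidedGreedy

open Cmd

/-- Scalar `5` becomes the double greedy fraction. -/
def chooseRatio : Cmd :=
  .ifR (at' 6 1) (.const 0) (setVar 5 (.const 0)) <|
  .ifR (.const 0) (var 4) (setVar 5 (.const 1)) <|
  setVar 5 (.div (at' 6 1) (.sub (at' 6 1) (var 4)))

/-- The lower solution (row `5`) and the upper solution (row `4`) are made equal in all
coordinates. -/
def doubleGreedy (K : ℕ) : Cmd :=
  forN 1 <|
    .seq (estimate K 5) <|
    .seq (.setR (.const 6) (.reg 1) (var 4)) <|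
    .seq (estimate K 4) <|
    .seq chooseRatio <|
    .seq (.setR (.const 4) (.reg 1)
      (.add (at' 5 1) (.mul (var 5) (.sub (at' 4 1) (at' 5 1))))) <|
    .setR (.const 5) (.reg 1) (at' 4 1)

/-- Compute the scales of all elements. -/
def computeScales (k : ℕ) : Cmd :=
  forN 1 <|
    .seq (.setR (.const 1) (.reg 1) (.const 1)) <|
    .seq (.optimize (.const 6) (.const 1)) <|
    .seq (.setR (.const 1) (.reg 1) (.const 0)) <|
    .ifR (.mul (at' 6 1) (.mul (.const k) (.ofNat (.add (.reg 0) (.const 1))))) (.const 1)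
      (.seq (.setR (.const 2) (.reg 1) (at' 6 1)) (.setR (.const 3) (.reg 1) (.const 0)))
      (.seq (.setR (.const 2) (.reg 1) (.const 1)) (.setR (.const 3) (.reg 1) (.const 1)))

/-- The output is the rescaled row `4`. -/
def writeOutput : Cmd := forN 1 (.setR (.const 0) (.reg 1) (.mul (at' 4 1) (at' 2 1)))

/-- The bicriteria algorithm. -/
def algorithm (k j : ℕ) : Cmd :=
  .seq (computeScales k) <| .seq (growth (k ^ 2) j) <| .seq (doubleGreedy (k ^ 2)) writeOutput

lemma bounded_algorithm (k j : ℕ) : (algorithm k j).Bounded := by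
  have h1 : evalSurrogate.Bounded := by
    refine ⟨Bounded.forN (by norm_num) trivial, trivial, trivial, Bounded.forN (by norm_num) ?_⟩
    simp [Bounded]
  have h2 : ∀ src, (sampleSet src).Bounded := fun src =>
    Bounded.forN (by norm_num) (by simp [Bounded])
  have h3 : ∀ src, (sampleDerivative src).Bounded := fun src =>
    ⟨h2 src, trivial, h1, trivial, trivial, h1, trivial⟩
  have h4 : ∀ K src, (estimate K src).Bounded := fun K src => ⟨trivial, (h3 src).repeatN _ _⟩
  have h5 : ∀ K, (estimateAll K).Bounded := fun K =>
    Bounded.forN (by norm_num) ⟨h4 _ _, trivial⟩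
  have h6 : ∀ K, (move K j).Bounded := fun K =>
    ⟨Bounded.forN (by norm_num) trivial, trivial, Bounded.forN (by norm_num) trivial,
      Bounded.forN (by norm_num) trivial⟩
  have h7 : ∀ K, (doubleGreedy K).Bounded := fun K => Bounded.forN (by norm_num)
    ⟨h4 _ _, trivial, h4 _ _, by simp [chooseRatio, Bounded], trivial, trivial⟩
  have h8 : (computeScales k).Bounded := Bounded.forN (by norm_num) (by simp [Bounded])
  have h9 : ∀ K, Bounded (.seq (estimateAll K) (move K j)) := fun K => ⟨h5 K, h6 K⟩
  exact ⟨h8, (h9 _).repeatN _ _, h7 _, Bounded.forN (by norm_num) trivial⟩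

variable {n : ℕ} {f : Finset (Fin n) → ℝ} {lin : (Fin n → ℝ) → (Fin n → ℝ)}
  {P : Set (Fin n → ℝ)} {L : Finset (Fin n)} {q : Fin n → ℝ}

/-- Homogeneity of the fraction lets the program work with unnormalized sums of samples. -/
lemma ratio_div (a c : ℝ) {m : ℝ} (hm : 0 < m) : ratio (a / m) (c / m) = ratio a c := by
  unfold ratio
  have h1 : a / m ≤ 0 ↔ a ≤ 0 := by rw [div_le_iff₀ hm, zero_mul]
  have h2 : 0 ≤ c / m ↔ 0 ≤ c := by rw [le_div_iff₀ hm, zero_mul]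
  simp only [h1, h2, ← sub_div, div_div_div_cancel_right₀ hm.ne']

/-- The potential of the double greedy phase, with respect to the direction `z`. -/
def potential (h : Finset (Fin n) → ℝ) (z X Y : Fin n → ℝ) : ℝ :=
  multilinearExt h (fun u => X u + z u * (Y u - X u)) + 1 / 2 * multilinearExt h X +
    1 / 2 * multilinearExt h Y

/-- The invariant of the double greedy phase after the first `k` coordinates. -/
structure GreedyInv (L : Finset (Fin n)) (q x : Fin n → ℝ) (k : ℕ) (s : Config) : Prop where
  env : Env L q s
  nonneg : 0 ≤ s.vec n 5
  le : s.vec n 5 ≤ s.vec n 4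
  upper : s.vec n 4 ≤ x
  eq : ∀ u : Fin n, u.val < k → s.vec n 5 u = s.vec n 4 u

lemma post_chooseRatio {s : Config} (Q : Config → Prop)
    (hQ : ∀ t, Config.Agree 9 s t → t.cell 9 5 = ratio (s.cell 6 (s.reg 1)) (s.cell 9 4) → Q t) :
    chooseRatio.Post f lin Q s := by
  have h : ∀ v, v = ratio (s.cell 6 (s.reg 1)) (s.cell 9 4) → Q (s.setCell 9 5 v) := fun v hv =>
    hQ _ ((Config.Agree.refl 9 s).setCell le_rfl _ _) (by
      rw [Config.cell_setCell, if_pos ⟨rfl, rfl⟩, hv])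
  simp only [chooseRatio, Post, sem, RExp.eval, NExp.eval, Rat.cast_zero, Rat.cast_one]
  unfold ratio at h
  split_ifs with h1 h2
  · exact h _ (by rw [if_pos h1])
  · exact h _ (by rw [if_neg h1, if_pos h2])
  · exact h _ (by rw [if_neg h1, if_neg h2])

/-- When all coordinates have been treated the two solutions coincide, so the potential collapses to
twice the value there. Each coordinate costs three times the errors of its two estimates. -/
lemma hoare_doubleGreedy (hsub : IsSubmodular (surrogate f L q)) (hqL : ∀ u ∈ L, q u = 0)
    {B : ℝ} (hB0 : 0 < B) (h0 : ∀ S, 0 ≤ surrogate f L q S) (hB : ∀ S, surrogate f L q S ≤ B)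
    {K : ℕ} (hK : 0 < K) {x : Fin n → ℝ} (hx : x ≤ 1) {s : Config} (hs : GreedyInv L q x 0 s)
    {z : Fin n → ℝ} (hz : z ∈ Set.Icc (0 : Fin n → ℝ) 1) :
    (doubleGreedy K).Hoare f lin s (GreedyInv L q x n)
      (fun t => 2 * multilinearExt (surrogate f L q) (t.vec n 4))
      (potential (surrogate f L q) z (s.vec n 5) (s.vec n 4) -
        n * (6 * (B / (K * (n + 1) ^ 3)))) := by
  set h := surrogate f L q with hh
  set r : ℝ := K * (n + 1) ^ 3 with hr
  have hr0 : 0 < r := by positivity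
  have hmain := Hoare.forN (f := f) (lin := lin) (i := 1) (by norm_num) (s := s)
    (c := .seq (estimate K 5) <|
    .seq (.setR (.const 6) (.reg 1) (var 4)) <|
    .seq (estimate K 4) <|
    .seq chooseRatio <|
    .seq (.setR (.const 4) (.reg 1)
      (.add (at' 5 1) (.mul (var 5) (.sub (at' 4 1) (at' 5 1))))) <|
    .setR (.const 5) (.reg 1) (at' 4 1))
    (fun k t => GreedyInv L q x k t) (fun _ t => potential h z (t.vec n 5) (t.vec n 4))
    (6 * (B / r)) hs.env.reg0
    (fun k t v ht => ⟨⟨by rw [Config.reg_setReg, if_neg (by norm_num), ht.env.reg0],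
      ht.env.flag, ht.env.scale⟩, ht.nonneg, ht.le, ht.upper, ht.eq⟩)
    (fun _ _ _ => rfl) hs (by
      intro k hk t ht0 ht1 ht
      set X := t.vec n 5 with hX
      set Y := t.vec n 4 with hY
      set w : Fin n := ⟨k, hk⟩ with hw
      have hXm : X ∈ Set.Icc (0 : Fin n → ℝ) 1 := ⟨ht.nonneg, ht.le.trans (ht.upper.trans hx)⟩
      have hYm : Y ∈ Set.Icc (0 : Fin n → ℝ) 1 := ⟨ht.nonneg.trans ht.le, ht.upper.trans hx⟩
      -- The multiplier 3 matches `double_greedy_step`. The potential of the current state is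
      -- carried along as a constant, and the loss of the second estimate is still to be paid.
      have h1 := (hoare_estimate (f := f) (lin := lin) hqL hB0 h0 hB hK (src := 5) (by norm_num)
        ht.env (u := w) ht1 (x := X) (fun u => rfl) hXm).affine (α := 3) (by norm_num)
        (potential h z X Y - 3 * (B / r))
      refine (h1.conseq (fun _ h => h) (fun _ _ => le_rfl) (le_of_eq (by ring))).seq ?_
      intro t₁ ht₁
      set a := t₁.cell 9 4 with ha
      refine Post.seq_hoare (Q := fun t' => Config.Agree 6 t t' ∧ t'.cell 6 k = a) ?_ ?_
      · simp only [Post, sem, NExp.eval, RExp.eval]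
        refine ⟨(ht₁.mono (by norm_num)).setCell le_rfl _ _, ?_⟩
        rw [Config.cell_setCell, ht₁.reg1, ht1, if_pos ⟨rfl, rfl⟩]
      rintro t₂ ⟨ht₂, ha₂⟩
      have h2 := (hoare_estimate (f := f) (lin := lin) hqL hB0 h0 hB hK (src := 4) (by norm_num)
        (ht.env.of_agree (by norm_num) ht₂) (u := w) (ht₂.reg1.trans ht1) (x := Y)
        (fun u => by rw [ht₂.rows 4 (by norm_num)]; rfl) hYm).affine (α := 3) (by norm_num)
        (potential h z X Y - 3 * |a / r ^ 2 - partialD h w X|)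
      refine (h2.conseq (fun _ h => h) (fun _ _ => le_rfl) (le_of_eq (by ring))).seq ?_
      intro t₃ ht₃
      have ht₃' := ht₂.trans (ht₃.mono (by norm_num))
      set c := t₃.cell 9 4 with hc
      refine Post.seq_hoare (Q := fun t' => Config.Agree 6 t t' ∧ t'.cell 9 5 = ratio a c)
        (post_chooseRatio _ fun t' h h' => ⟨ht₃'.trans (h.mono (by norm_num)), ?_⟩) ?_
      · rw [h', ht₃'.reg1, ht1, ht₃.rows 6 (by norm_num), ha₂]
      rintro t₄ ⟨ht₄, hq₄⟩
      set v := X w + ratio a c * (Y w - X w) with hv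
      refine Post.hoare_of_le (Post.seq (Q := fun t' => Config.Agree 4 t t' ∧
        t'.cell 5 = t.cell 5 ∧ ∀ u : Fin n, t'.cell 4 u = Function.update Y w v u) ?_ ?_)
      · simp only [Post, sem, NExp.eval, RExp.eval, ht₄.reg1, ht1]
        refine ⟨(ht₄.mono (by norm_num)).setCell le_rfl _ _, ?_, fun u => ?_⟩
        · rw [Config.row_setCell_of_ne _ (by norm_num), ht₄.rows 5 (by norm_num)]
        · rw [Config.cell_setCell]
          by_cases hu : u = w
          · subst hu
            rw [if_pos ⟨rfl, rfl⟩, Function.update_self, hq₄, ht₄.rows 5 (by norm_num),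
              ht₄.rows 4 (by norm_num)]
            rfl
          · have : (u : ℕ) ≠ k := fun h => hu (Fin.ext h)
            rw [if_neg (by tauto), Function.update_of_ne hu, ht₄.rows 4 (by norm_num)]
            rfl
      rintro t₅ ⟨ht₅, h5, h4⟩
      simp only [Post, sem, NExp.eval, RExp.eval, ht₅.reg1, ht1]
      set t₆ := t₅.setCell 5 k (t₅.cell 4 k) with ht₆
      have e4 : t₆.vec n 4 = Function.update Y w v := by
        funext u
        rw [← h4]
        simp only [Config.vec, ht₆]
        rw [Config.row_setCell_of_ne _ (by norm_num)]
      have e5 : t₆.vec n 5 = Function.update X w v := by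
        funext u
        simp only [Config.vec, ht₆]
        rw [Config.cell_setCell]
        by_cases hu : u = w
        · have h4w := h4 w
          rw [Function.update_self] at h4w
          subst hu
          rw [if_pos ⟨rfl, rfl⟩, Function.update_self]
          exact h4w
        · have : (u : ℕ) ≠ k := fun h => hu (Fin.ext h)
          rw [if_neg (by tauto), Function.update_of_ne hu, h5]
          rfl
      obtain ⟨hq0, hq1⟩ := ratio_mem a c
      have hXY : 0 ≤ Y w - X w := sub_nonneg.2 (ht.le w)
      have hv0 : X w ≤ v := by
        have := mul_nonneg hq0 hXY
        linarith
      have hv1 : v ≤ Y w := by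
        have := mul_le_of_le_one_left hXY hq1
        linarith
      refine ⟨⟨ht₅.reg0.trans ht0, ht₅.reg1.trans ht1, ?_⟩, ?_⟩
      · refine ⟨ht.env.of_agree le_rfl (ht₅.setCell (by norm_num) _ _), ?_, ?_, ?_, ?_⟩
        · rw [e5]
          intro u
          by_cases hu : u = w
          · subst hu; rw [Function.update_self]; exact (ht.nonneg _).trans hv0
          · rw [Function.update_of_ne hu]; exact ht.nonneg u
        · rw [e5, e4]
          intro u
          by_cases hu : u = w
          · subst hu; rw [Function.update_self, Function.update_self]
          · rw [Function.update_of_ne hu, Function.update_of_ne hu]; exact ht.le u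
        · rw [e4]
          intro u
          by_cases hu : u = w
          · subst hu; rw [Function.update_self]; exact hv1.trans (ht.upper _)
          · rw [Function.update_of_ne hu]; exact ht.upper u
        · intro u huk
          rw [e4, e5]
          by_cases hu : u = w
          · subst hu; rw [Function.update_self, Function.update_self]
          · rw [Function.update_of_ne hu, Function.update_of_ne hu]
            refine ht.eq u ?_
            have : (u : ℕ) ≠ k := fun h => hu (Fin.ext h)
            omega
      · rw [e4, e5]
        set o : Fin n → ℝ := fun u => X u + z u * (Y u - X u) with ho
        have hXo : X ≤ o := fun u => by
          have := mul_nonneg (hz.1 u) (sub_nonneg.2 (ht.le u))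
          simp only [ho]; linarith
        have hoY : o ≤ Y := fun u => by
          have := mul_le_of_le_one_left (sub_nonneg.2 (ht.le u)) (hz.2 u)
          simp only [ho]; linarith
        have h6 := double_greedy_step hsub hXm hYm hXo hoY w (hz.1 w) (hz.2 w) rfl
          (a / r ^ 2) (c / r ^ 2) (v := v) (by rw [ratio_div _ _ (by positivity)])
        -- Once the two bounds agree in coordinate `w`, the interpolated point takes the same value
        -- `v` there, whatever `z w` is.
        have e6 : (fun u => Function.update X w v u +
            z u * (Function.update Y w v u - Function.update X w v u)) =
            Function.update o w v := by
          funext u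
          by_cases hu : u = w
          · subst hu; simp
          · simp [hu, ho]
        simp only [potential, e6]
        linarith)
  refine hmain.conseq (fun t ht => ht.2) ?_ le_rfl
  rintro t ⟨-, ht⟩
  have e : t.vec n 5 = t.vec n 4 := funext fun u => ht.eq u u.2
  have e2 : (fun u => t.vec n 4 u + z u * (t.vec n 4 u - t.vec n 4 u)) = t.vec n 4 := by
    funext u; ring
  simp only [potential, e, e2]
  linarith

end GuidedGreedy

/-! ### Caps and scales, and the guarantee of the whole program. -/

namespace GuidedGreedy

open Cmd

variable {n : ℕ} {f : Finset (Fin n) → ℝ} {lin : (Fin n → ℝ) → (Fin n → ℝ)}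
  {P : Set (Fin n → ℝ)}

/-- The largest value of a coordinate in the convex set. -/
def cap (lin : (Fin n → ℝ) → (Fin n → ℝ)) (u : Fin n) : ℝ := lin (ind {u}) u

/-- The elements that are not rescaled: those with a large cap. -/
def unscaled (lin : (Fin n → ℝ) → (Fin n → ℝ)) (k : ℕ) : Finset (Fin n) :=
  Finset.univ.filter fun u => 1 < cap lin u * (k * (n + 1))

/-- The scaling factors of the rescaled elements. -/
def scaling (lin : (Fin n → ℝ) → (Fin n → ℝ)) (k : ℕ) (u : Fin n) : ℝ :=
  if u ∈ unscaled lin k then 0 else cap lin u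

lemma psum_scaling (k : ℕ) (u : Fin n) : psum (ind (unscaled lin k)) (scaling lin k) u =
    if u ∈ unscaled lin k then 1 else cap lin u := by
  by_cases h : u ∈ unscaled lin k <;> simp [psum, ind, scaling, h]

lemma post_computeScales (k : ℕ) :
    (computeScales k).Post f lin (fun t => Env (unscaled lin k) (scaling lin k) t ∧
      t.vec n 4 = 0 ∧ t.vec n 5 = 0) (Config.init n) := by
  set L := unscaled lin k with hL
  set q := scaling lin k with hq
  -- Row 1 is cleared again in every round so that each oracle call sees an indicator vector of a
  -- single element.
  refine (Post.forN (by norm_num) (fun m t => (∀ u : Fin n, t.cell 1 u = 0) ∧ t.cell 4 = 0 ∧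
    t.cell 5 = 0 ∧ ∀ u : Fin n, u.val < m → t.cell 2 u = psum (ind L) q u ∧ t.cell 3 u = ind L u)
    (by simp [Config.init]) (fun _ _ _ h => h) ?_ ?_).mono ?_
  · exact ⟨fun _ => rfl, rfl, rfl, fun u hu => absurd hu (Nat.not_lt_zero _)⟩
  · rintro m hm t ht0 ht1 ⟨h1, h4, h5, h23⟩
    set w : Fin n := ⟨m, hm⟩ with hw
    have hrow : ∀ (t : Config) (b : ℝ), (∀ u : Fin n, u ≠ w → t.cell 1 u = 0) → ∀ u : Fin n,
        (t.setCell 1 m b).cell 1 u = if u = w then b else 0 := by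
      intro t b ht u
      rw [Config.cell_setCell]
      by_cases hu : u = w
      · simp [hu, hw]
      · have : (u : ℕ) ≠ m := fun h => hu (Fin.ext h)
        simp [hu, this, ht u hu]
    refine Post.seq (Q := fun t' => t'.reg 0 = n ∧ t'.reg 1 = m ∧ t'.vec n 1 = ind {w} ∧
      ∀ i, 2 ≤ i → t'.cell i = t.cell i) ?_ ?_
    · simp only [Post, sem, NExp.eval, RExp.eval, ht1, Rat.cast_one]
      refine ⟨ht0, ht1, funext fun u => ?_, fun i hi => ?_⟩
      · simp [Config.vec, hrow t 1 (fun u _ => h1 u), ind]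
      · rw [Config.row_setCell_of_ne _ (by omega)]
    rintro t₁ ⟨ht0, ht1, hvec, hrows⟩
    refine Post.seq (Q := fun t' => t'.reg 0 = n ∧ t'.reg 1 = m ∧ t'.vec n 1 = ind {w} ∧
      t'.cell 6 m = cap lin w ∧ ∀ i, 2 ≤ i → i < 6 → t'.cell i = t.cell i) ?_ ?_
    · simp only [Post, sem, NExp.eval]
      refine ⟨ht0, ht1, ?_, ?_, fun i hi hi' => ?_⟩
      · rw [← hvec]
        funext u
        simp only [Config.vec]
        rw [Config.row_setVec_of_ne _ (by norm_num)]
      · rw [hvec]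
        exact Config.cell_setVec _ _ _ w
      · rw [Config.row_setVec_of_ne _ (by omega), hrows i hi]
    rintro t₂ ⟨ht0, ht1, hvec, h6, hrows⟩
    refine Post.seq (Q := fun t' => t'.reg 0 = n ∧ t'.reg 1 = m ∧ (∀ u : Fin n, t'.cell 1 u = 0) ∧
      t'.cell 6 m = cap lin w ∧ ∀ i, 2 ≤ i → i < 6 → t'.cell i = t.cell i) ?_ ?_
    · simp only [Post, sem, NExp.eval, RExp.eval, ht1, Rat.cast_zero]
      refine ⟨ht0, ht1, fun u => ?_, ?_, fun i hi hi' => ?_⟩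
      · rw [hrow]
        · simp
        · intro u hu
          have := congrFun hvec u
          simpa [Config.vec, ind, hu] using this
      · rw [Config.row_setCell_of_ne _ (by norm_num), h6]
      · rw [Config.row_setCell_of_ne _ (by omega), hrows i hi hi']
    rintro t₃ ⟨ht0, ht1, h1, h6, hrows⟩
    have hfin : ∀ a b : ℝ, a = psum (ind L) q w → b = ind L w →
        let t' := (t₃.setCell 2 m a).setCell 3 m b
        t'.reg 0 = n ∧ t'.reg 1 = m ∧ (∀ u : Fin n, t'.cell 1 u = 0) ∧ t'.cell 4 = 0 ∧
          t'.cell 5 = 0 ∧ ∀ u : Fin n, u.val < m + 1 →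
            t'.cell 2 u = psum (ind L) q u ∧ t'.cell 3 u = ind L u := by
      intro a b ha hb
      refine ⟨ht0, ht1, fun u => ?_, ?_, ?_, fun u hu => ?_⟩
      · rw [Config.row_setCell_of_ne _ (by norm_num), Config.row_setCell_of_ne _ (by norm_num), h1]
      · rw [Config.row_setCell_of_ne _ (by norm_num), Config.row_setCell_of_ne _ (by norm_num),
          hrows 4 (by norm_num) (by norm_num), h4]
      · rw [Config.row_setCell_of_ne _ (by norm_num), Config.row_setCell_of_ne _ (by norm_num),
          hrows 5 (by norm_num) (by norm_num), h5]
      · by_cases huw : u = w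
        · subst huw
          simp [Config.cell_setCell, hw, ha, hb]
        · have hne : (u : ℕ) ≠ m := fun h => huw (Fin.ext h)
          have := h23 u (by omega)
          simp [Config.cell_setCell, hne, hrows, this]
    simp only [Post, sem, NExp.eval, RExp.eval, ht1, ht0, Config.reg_setCell, Rat.cast_zero,
      Rat.cast_one, h6, Rat.cast_natCast]
    have hmem : w ∈ L ↔ 1 < cap lin w * (k * ((n + 1 : ℕ) : ℝ)) := by
      simp [hL, unscaled]
    split_ifs with hc
    · have hwL : w ∉ L := fun h => (hmem.1 h).not_ge hc
      exact ⟨trivial, trivial, (hfin _ 0 (by rw [psum_scaling, if_neg hwL]) (by simp [ind, hwL])).2.2⟩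
    · have hwL : w ∈ L := hmem.2 (not_le.1 hc)
      exact ⟨trivial, trivial, (hfin _ 1 (by rw [psum_scaling, if_pos hwL]) (by simp [ind, hwL])).2.2⟩
  · rintro t ⟨h0, -, h4, h5, h23⟩
    refine ⟨⟨h0, fun u => (h23 u u.2).2, fun u => (h23 u u.2).1⟩, ?_, ?_⟩
    · funext u; simp [Config.vec, h4]
    · funext u; simp [Config.vec, h5]

lemma le_cap (h : IsInstance f P lin) {y : Fin n → ℝ} (hy : y ∈ P) (u : Fin n) :
    y u ≤ cap lin u := by
  simpa [ind, cap] using (h.solvable (ind {u})).2 y hy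

lemma cap_mem (h : IsInstance f P lin) (u : Fin n) : 0 ≤ cap lin u ∧ cap lin u ≤ 1 :=
  ⟨(h.subset_cube (h.solvable _).1).1 u, (h.subset_cube (h.solvable _).1).2 u⟩

lemma update_cap_mem (h : IsInstance f P lin) (u : Fin n) :
    Function.update (0 : Fin n → ℝ) u (cap lin u) ∈ P := by
  have h1 := (h.solvable (ind {u})).1
  refine h.downClosed _ h1 _ (fun v => ?_) fun v => ?_
  · by_cases hv : v = u
    · subst hv; simpa using (cap_mem h v).1
    · simp [hv]
  · by_cases hv : v = u
    · subst hv; simp [cap]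
    · simpa [hv] using (h.subset_cube h1).1 v

lemma zero_mem (h : IsInstance f P lin) : (0 : Fin n → ℝ) ∈ P :=
  h.downClosed _ (h.solvable 0).1 _ le_rfl (h.subset_cube (h.solvable 0).1).1

lemma sum_scaling_le (lin : (Fin n → ℝ) → (Fin n → ℝ)) {k : ℕ} (hk : 0 < k) :
    ∑ u, scaling lin k u ≤ 1 / k := by
  have hk' : (0 : ℝ) < k := by exact_mod_cast hk
  have h1 : ∀ u, scaling lin k u ≤ 1 / (k * (n + 1)) := by
    intro u
    unfold scaling
    split_ifs with hu
    · positivity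
    · rw [le_div_iff₀ (by positivity)]
      simpa [unscaled] using hu
  refine (Finset.sum_le_card_nsmul _ _ _ fun u _ => h1 u).trans ?_
  simp only [Finset.card_univ, Fintype.card_fin, nsmul_eq_mul]
  rw [mul_one_div, div_le_div_iff₀ (by positivity) hk']
  nlinarith

lemma scaled (h : IsInstance f P lin) {k : ℕ} (hk : 0 < k) :
    Scaled f P lin (unscaled lin k) (scaling lin k) where
  inst := h
  q_mem := ⟨fun u => by simp only [scaling]; split_ifs; exacts [le_rfl, (cap_mem h u).1],
    fun u => by simp only [scaling]; split_ifs; exacts [zero_le_one, (cap_mem h u).2]⟩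
  q_zero := fun u hu => if_pos hu
  sum_le := (sum_scaling_le lin hk).trans (by
    have : (1 : ℝ) ≤ k := by exact_mod_cast hk
    rw [div_le_one (by linarith)]; exact this)
  le_scale := fun y hy u => by
    rw [psum_scaling]
    split_ifs
    exacts [(h.subset_cube hy).2 u, le_cap h hy u]

/-- Only the values at 0 and at the axis points of height `cap lin u` enter. These lie in `P`, so
`M` may later be taken as a value attained on `P`. -/
lemma surrogate_scaling_le (h : IsInstance f P lin) {k : ℕ} (hk : 2 ≤ k) {M : ℝ}
    (hM0 : multilinearExt f 0 ≤ M)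
    (hM : ∀ u, multilinearExt f (Function.update 0 u (cap lin u)) ≤ M) (S : Finset (Fin n)) :
    surrogate f (unscaled lin k) (scaling lin k) S ≤ 2 * k * (n + 1) ^ 2 * M := by
  have hk' : (2 : ℝ) ≤ k := by exact_mod_cast hk
  have hkn : (1 : ℝ) ≤ k * (n + 1) := by nlinarith [n.cast_nonneg (α := ℝ)]
  have hsum : ∑ u, scaling lin k u ≤ 1 / 2 := (sum_scaling_le lin (by omega)).trans
    (one_div_le_one_div_of_le (by norm_num) hk')
  have hmul : ∀ (u : Fin n) (t b : ℝ) (c : Fin n → ℝ), t * c u = b →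
      Function.update (0 : Fin n → ℝ) u t * c = Function.update (0 : Fin n → ℝ) u b := by
    intro u t b c hc
    funext v
    by_cases hv : v = u
    · subst hv; simpa using hc
    · simp [hv]
  refine (surrogate_le h.submodular h.nonneg (scaled h (by omega)).q_mem hsum
    (t₀ := 1 / (k * (n + 1))) (by positivity) ((div_le_one (by linarith)).2 hkn) hM0 ?_ S).trans_eq ?_
  -- The axis point is reached from height `cap lin u` if `u` is unscaled, which is at least `t₀` by
  -- the choice of threshold, and from height 1 otherwise.
  · intro u
    by_cases hu : u ∈ unscaled lin k
    · refine ⟨cap lin u, ?_, (cap_mem h u).2, ?_⟩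
      · rw [div_le_iff₀ (by linarith)]
        exact (Finset.mem_filter.1 hu).2.le
      · rw [hmul u _ (cap lin u)]
        · exact hM u
        · rw [psum_scaling, if_pos hu, mul_one]
    · refine ⟨1, (div_le_one (by linarith)).2 hkn, le_rfl, ?_⟩
      rw [hmul u _ (cap lin u)]
      · exact hM u
      · rw [psum_scaling, if_neg hu, one_mul]
  · field_simp

lemma hoare_algorithm (h : IsInstance f P lin) {k j : ℕ} (hj : 0 < j) (hk : 2 * j ≤ k) {M : ℝ}
    (hMpos : 0 < M) (hM0 : multilinearExt f 0 ≤ M)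
    (hM : ∀ u, multilinearExt f (Function.update 0 u (cap lin u)) ≤ M) {z : Fin n → ℝ}
    (hz : z ∈ P) :
    (algorithm k j).Hoare f lin (Config.init n)
      (fun t => t.vec n 0 ∈ Set.Icc (0 : Fin n → ℝ) 1 ∧
        ∃ y ∈ P, t.vec n 0 ≤ (2 * j : ℝ) • y)
      (fun t => multilinearExt f (t.vec n 0))
      ((1 - ∑ u, scaling lin k u) / 2 *
        ((1 - (j : ℝ)⁻¹) * multilinearExt f z - 20 / k * M)) := by
  have hk2 : 2 ≤ k := by omega
  have hk0 : 0 < k := by omega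
  have hkR : (0 : ℝ) < k := by exact_mod_cast hk0
  have hsc := scaled h hk0
  set L := unscaled lin k with hL
  set q := scaling lin k with hq
  set g := surrogate f L q with hg
  set sc := psum (ind L) q with hscdef
  set B : ℝ := 2 * k * (n + 1) ^ 2 * M with hBdef
  set κ : ℝ := (j : ℝ)⁻¹ with hκ
  have hκ0 : 0 ≤ κ := by positivity
  have hκ1 : κ ≤ 1 := inv_le_one_of_one_le₀ (by exact_mod_cast hj)
  have hB0 : 0 < B := by positivity
  have hB : ∀ S, g S ≤ B := surrogate_scaling_le h hk2 hM0 hM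
  have h0 : ∀ S, 0 ≤ g S := surrogate_nonneg h.nonneg hsc.q_mem.1 hsc.sum_le
  have hsub : IsSubmodular g := surrogate_submodular h.submodular hsc.q_mem.1 hsc.sum_le
  set z' : Fin n → ℝ := fun u => z u / sc u with hz'
  have hz'm : z' ∈ Set.Icc (0 : Fin n → ℝ) 1 := hsc.div_mem hz
  have hzH : multilinearExt f z ≤ multilinearExt g z' := by
    have h1 := (multilinearExt_surrogate_bounds (L := L) h.submodular h.nonneg hsc.q_mem
      hsc.sum_le hz'm).2
    have e : z' * psum (ind L) q = z := funext fun u => by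
      rw [Pi.mul_apply, mul_comm]; exact hsc.mul_div hz u
    rwa [e] at h1
  -- The bound `B` contains one factor `k`, so the accuracy parameter is `k ^ 2`, leaving an error
  -- of order `M / k`.
  have hnB : n * B / (((k ^ 2 : ℕ) : ℝ) * (n + 1) ^ 3) ≤ 2 / k * M := by
    rw [hBdef, div_le_iff₀ (by positivity)]
    push_cast
    have e : 2 / (k : ℝ) * M * (k ^ 2 * (n + 1) ^ 3) = (n + 1) * (2 * k * (n + 1) ^ 2 * M) := by
      field_simp
    rw [e]
    exact mul_le_mul_of_nonneg_right (by linarith) (by positivity)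
  have hn2B : n ^ 2 * B / (((k ^ 2 : ℕ) : ℝ) * (n + 1) ^ 4) ≤ 2 / k * M := by
    rw [hBdef, div_le_iff₀ (by positivity)]
    push_cast
    have e : 2 / (k : ℝ) * M * (k ^ 2 * (n + 1) ^ 4) =
        (n + 1) ^ 2 * (2 * k * (n + 1) ^ 2 * M) := by
      field_simp
    rw [e]
    exact mul_le_mul_of_nonneg_right
      (pow_le_pow_left₀ (Nat.cast_nonneg n) (by linarith) 2) (by positivity)
  refine Post.seq_hoare (post_computeScales k) ?_
  rintro t₀ ⟨henv, h4, h5⟩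
  have hinv : GrowthInv P L q κ 0 t₀ := by
    refine ⟨henv, ?_, ?_, 0, zero_mem h, fun u => ?_⟩
    · rw [h4]; exact ⟨le_rfl, fun _ => zero_le_one⟩
    · rw [h4, h5, smul_zero]
    · rw [h4]; simp
  have hkk : 2 * j ≤ k ^ 2 := hk.trans (Nat.le_self_pow (by norm_num) k)
  set α := (1 - ∑ u, q u) / 2 with hα
  have hα0 : 0 ≤ α := by have := hsc.sum_le; rw [hα]; linarith
  -- The constant anticipates the later phase: the value to be proved minus the growth potential,
  -- including the double greedy error. The factor `α` converts twice the surrogate value into the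
  -- original objective.
  have hgrow := (hoare_growth hsc hB0 hB hj hkk hinv hz).affine hα0
    (α * ((1 - κ) * multilinearExt g z' - n * (6 * (B / (((k ^ 2 : ℕ) : ℝ) * (n + 1) ^ 3)))))
  refine (hgrow.conseq (b := α * ((1 - κ) * multilinearExt f z - 20 / k * M)) (fun _ h => h)
    (fun _ _ => le_rfl) ?_).seq ?_
  · rw [← mul_add]
    refine mul_le_mul_of_nonneg_left ?_ hα0
    have h1 := mul_le_mul_of_nonneg_left hzH (sub_nonneg.2 hκ1)
    -- Ten units of `2 / k * M`: six from the double greedy estimates, two from the growth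
    -- estimates, two from the second-order errors.
    have e1 : 20 / (k : ℝ) * M = 10 * (2 / k * M) := by ring
    have e2 : n * (6 * (B / (((k ^ 2 : ℕ) : ℝ) * (n + 1) ^ 3))) =
      6 * (n * B / (((k ^ 2 : ℕ) : ℝ) * (n + 1) ^ 3)) := by ring
    have e3 : 2 * n * (B / (((k ^ 2 : ℕ) : ℝ) * (n + 1) ^ 3)) =
      2 * (n * B / (((k ^ 2 : ℕ) : ℝ) * (n + 1) ^ 3)) := by ring
    have e4 : 2 * n ^ 2 * B / (((k ^ 2 : ℕ) : ℝ) * (n + 1) ^ 4) =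
      2 * (n ^ 2 * B / (((k ^ 2 : ℕ) : ℝ) * (n + 1) ^ 4)) := by ring
    rw [e1, e2, e3, e4]
    linarith
  intro t₁ ht₁
  set x := t₁.vec n 4 with hx
  have hginv : GreedyInv L q x 0 t₁ := by
    refine ⟨ht₁.env, ?_, ?_, le_rfl, fun u hu => absurd hu (Nat.not_lt_zero _)⟩
    · rw [ht₁.lower]; exact (smul_mem_cube hκ0 hκ1 ht₁.mem).1
    · rw [ht₁.lower]; exact fun u => mul_le_of_le_one_left (ht₁.mem.1 u) hκ1
  have hgreedy := (hoare_doubleGreedy (f := f) (lin := lin) hsub hsc.q_zero hB0 h0 hB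
    (K := k ^ 2) (by positivity) ht₁.mem.2 hginv hz'm).affine hα0 0
  refine (hgreedy.conseq (fun _ h => h) (fun _ _ => le_rfl) ?_).seq ?_
  · rw [← mul_add, add_zero]
    refine mul_le_mul_of_nonneg_left ?_ hα0
    -- The initial double greedy potential contains half the value at `κ • x`, which together with
    -- the bound on the interpolated point matches the outcome of the growth phase; half the value
    -- at `x` is discarded.
    have h1 := slack_bound hsub h0 hκ0 hκ1 ht₁.mem hz'm
    have h2 := multilinearExt_nonneg h0 ht₁.mem
    rw [ht₁.lower, potential]
    simp only [Pi.smul_apply, smul_eq_mul]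
    linarith
  intro t₂ ht₂
  set y := t₂.vec n 4 with hy
  have hym : y ∈ Set.Icc (0 : Fin n → ℝ) 1 :=
    ⟨ht₂.nonneg.trans ht₂.le, ht₂.upper.trans ht₁.mem.2⟩
  refine Post.hoare_of_le (Post.fill (by norm_num) (fun i => t₂.cell 4 i * t₂.cell 2 i)
    ht₂.env.reg0 ?_ ?_)
  · intro i hi
    simp [RExp.eval, NExp.eval, Config.reg_fill, Config.row_fill_of_ne]
  have e : (t₂.fill 1 0 (fun i => t₂.cell 4 i * t₂.cell 2 i) n).vec n 0 = y * sc := by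
    funext u
    simp only [Config.vec]
    rw [Config.cell_fill, if_pos u.2, ht₂.env.scale]
    rfl
  rw [e]
  refine ⟨⟨⟨fun u => mul_nonneg (hym.1 u) (hsc.scale_mem.1 u),
    fun u => mul_le_one₀ (hym.2 u) (hsc.scale_mem.1 u) (hsc.scale_mem.2 u)⟩, ?_⟩, ?_⟩
  · obtain ⟨y₀, hy₀, hle⟩ := ht₁.feasible
    refine ⟨y₀, hy₀, fun u => ?_⟩
    have h1 := mul_le_mul_of_nonneg_right (ht₂.upper u) (hsc.scale_mem.1 u)
    have h2 := hle u
    simp only [Pi.mul_apply, Pi.smul_apply, smul_eq_mul]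
    linarith
  · have h1 := (multilinearExt_surrogate_bounds (L := L) h.submodular h.nonneg hsc.q_mem
      hsc.sum_le hym).1
    rw [hα]
    linarith

end GuidedGreedy

end

/-! ### Choice of the parameters and conclusion. -/

theorem mainTheorem3 (ε : ℝ) (hε₀ : 0 < ε) (hε₁ : ε < 1 / 2) :
    ∃ A : Cmd, A.IsPolyTime ∧
      A.IsBicriteriaAlgorithm (1 / 2 - ε) (2 * (1 / ε + 2)) ∧
      ∀ (n : ℕ) (f : Finset (Fin n) → ℝ) (P : Set (Fin n → ℝ))
        (lin : (Fin n → ℝ) → (Fin n → ℝ)), IsInstance f P lin →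
        ∀ r ∈ (A.output f lin).support, (2 * (1 / ε + 2))⁻¹ • r ∈ P := by
  obtain ⟨j, hj0, hj1, hj2⟩ : ∃ j : ℕ, 0 < j ∧ 1 / ε ≤ j ∧ (j : ℝ) ≤ 1 / ε + 2 := by
    have h1 : 0 < 1 / ε := by positivity
    refine ⟨⌈1 / ε⌉₊, Nat.ceil_pos.2 h1, Nat.le_ceil _, ?_⟩
    linarith [Nat.ceil_lt_add_one h1.le]
  set β := 2 * (1 / ε + 2) with hβ
  have hβ0 : 0 < β := by positivity
  have hjβ : (2 * j : ℝ) ≤ β := by rw [hβ]; linarith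
  have hjR : (0 : ℝ) < j := by exact_mod_cast hj0
  have hκ : (j : ℝ)⁻¹ ≤ ε := by
    rw [inv_le_comm₀ hjR hε₀, ← one_div]; exact hj1
  -- The relative losses are `κ` from the lower solution, `20 / 22 * κ` from errors and `κ / 22`
  -- from the surrogate; together `43 / 22 * κ ≤ 2 ε`, which becomes `ε` after halving.
  set k := 22 * j with hk
  have hkj : 2 * j ≤ k := by omega
  set A := GuidedGreedy.algorithm k j with hA
  have hfeas : ∀ (n : ℕ) (f : Finset (Fin n) → ℝ) (P : Set (Fin n → ℝ))
      (lin : (Fin n → ℝ) → (Fin n → ℝ)), IsInstance f P lin →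
      ∀ r ∈ (A.output f lin).support, r ∈ Set.Icc (0 : Fin n → ℝ) 1 ∧
        ∃ y ∈ P, r ≤ β • y := by
    intro n f P lin h r hr
    -- Feasibility does not involve the value of `M`, so any positive upper bound and the comparison
    -- point 0 will do.
    obtain ⟨M, hM⟩ : ∃ M, ∀ o : Option (Fin n), multilinearExt f
        (o.elim 0 fun u => Function.update 0 u (GuidedGreedy.cap lin u)) ≤ M :=
      (Set.finite_range _).bddAbove.imp fun M hM o => hM ⟨o, rfl⟩
    have h1 := (GuidedGreedy.hoare_algorithm h hj0 hkj (M := max M 1) (by positivity)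
      ((hM none).trans (le_max_left _ _)) (fun u => (hM (some u)).trans (le_max_left _ _))
      (GuidedGreedy.zero_mem h)).1
    rw [Cmd.output, PMF.mem_support_map_iff] at hr
    obtain ⟨t, ht, rfl⟩ := hr
    obtain ⟨h2, y, hy, hle⟩ := h1.of_mem_support (fun s i => rfl) ht
    refine ⟨h2, y, hy, hle.trans fun u => ?_⟩
    exact mul_le_mul_of_nonneg_right hjβ ((h.subset_cube hy).1 u)
  refine ⟨A, (GuidedGreedy.bounded_algorithm k j).isPolyTime, fun n f P lin h => ⟨?_, ?_⟩, ?_⟩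
  · intro r hr
    obtain ⟨h1, y, hy, hle⟩ := hfeas n f P lin h r hr
    exact ⟨h1, 0, GuidedGreedy.zero_mem h, y, hy, h1.1, hle⟩
  · intro z hz
    set F := multilinearExt f with hF
    -- Comparing with the best of `z`, 0 and the axis points makes `M = F z₁`, which turns the
    -- additive error `20 / k * M` into a relative one.
    obtain ⟨z₁, hz₁, hM0, hM, hMz⟩ : ∃ z₁ ∈ P, F 0 ≤ F z₁ ∧
        (∀ u, F (Function.update 0 u (GuidedGreedy.cap lin u)) ≤ F z₁) ∧ F z ≤ F z₁ := by
      set p : Option (Option (Fin n)) → Fin n → ℝ := fun o => o.elim z fun o =>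
        o.elim 0 fun u => Function.update 0 u (GuidedGreedy.cap lin u) with hp
      obtain ⟨o, ho⟩ := Finite.exists_max fun o => F (p o)
      refine ⟨p o, ?_, ho (some none), fun u => ho (some (some u)), ho none⟩
      rcases o with _ | _ | u
      exacts [hz, GuidedGreedy.zero_mem h, GuidedGreedy.update_cap_mem h u]
    rcases le_or_gt (F z₁) 0 with hM' | hM'
    · rw [ENNReal.ofReal_of_nonpos
        (mul_nonpos_of_nonneg_of_nonpos (by linarith) (hMz.trans hM'))]
      exact zero_le
    have h1 := (GuidedGreedy.hoare_algorithm h hj0 hkj hM' hM0 hM hz₁).2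
    rw [Cmd.output, PMF.tsum_map_mul]
    -- Off the cube `F` may be negative, while the soundness theorem asks for a globally nonnegative
    -- function; truncation at 0 is invisible to `ENNReal.ofReal`.
    have h2 := Cmd.tsum_exec_mul (f := f) (lin := lin) A
      (φ := fun t => max 0 (F (t.vec n 0))) (fun _ => le_max_left _ _) (fun _ _ => rfl)
      (Config.init n)
    have e : ∀ t : Config, ENNReal.ofReal (max 0 (F (t.vec n 0))) =
        ENNReal.ofReal (F (t.vec n 0)) := fun t => by simp
    simp only [e] at h2
    refine le_of_le_of_eq (ENNReal.ofReal_le_ofReal ?_) h2.symm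
    have h3 := Cmd.wp_mono (f := f) (lin := lin) (c := A) (s := Config.init n)
      (Q := fun _ => True) (φ := fun t => F (t.vec n 0))
      (ψ := fun t => max 0 (F (t.vec n 0))) (fun _ _ => le_max_right _ _)
      (((GuidedGreedy.hoare_algorithm h hj0 hkj hM' hM0 hM hz₁).1).mono fun _ _ => trivial)
    refine le_trans ?_ (h1.trans h3)
    have hs := GuidedGreedy.sum_scaling_le lin (k := k) (by omega)
    have hk1 : (1 : ℝ) / k = 1 / 22 * (j : ℝ)⁻¹ := by
      rw [hk]; push_cast; field_simp
    have hk2 : (20 : ℝ) / k = 20 / 22 * (j : ℝ)⁻¹ := by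
      rw [hk]; push_cast; field_simp
    rw [hk1] at hs
    rw [hk2]
    set κ := (j : ℝ)⁻¹
    set σ := ∑ u, GuidedGreedy.scaling lin k u
    have hκ0 : 0 ≤ κ := by positivity
    have h4 : (1 / 2 - ε) * F z ≤ (1 / 2 - ε) * F z₁ :=
      mul_le_mul_of_nonneg_left hMz (by linarith)
    have h5 : 1 / 2 - ε ≤ (1 - σ) / 2 * (1 - κ - 20 / 22 * κ) := by
      have h6 : (1 - 1 / 22 * κ) / 2 * (1 - κ - 20 / 22 * κ) ≤
          (1 - σ) / 2 * (1 - κ - 20 / 22 * κ) :=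
        mul_le_mul_of_nonneg_right (by linarith) (by linarith)
      nlinarith
    have h6 := mul_le_mul_of_nonneg_right h5 hM'.le
    calc _ ≤ _ := h4
      _ ≤ _ := h6
      _ = _ := by ring
  · intro n f P lin h r hr
    obtain ⟨h1, y, hy, hle⟩ := hfeas n f P lin h r hr
    refine h.downClosed y hy _ (fun u => mul_nonneg (by positivity) (h1.1 u)) fun u => ?_
    have h2 := hle u
    simp only [Pi.smul_apply, smul_eq_mul] at h2 ⊢
    rw [inv_mul_le_iff₀ hβ0]
    exact h2
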